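/- **Setting.** Let $\mathcal A=(L,X,E,\mathcal I,\mathcal L)$ be a timed automaton with finite sets of locations $L$, clocks $X$ and edges $E$. Each edge $e$ has a source, a target, a guard and a set of clocks to reset. Each location $\ell$ has an invariant $\mathcal I(\ell)$ and a label $\mathcal L(\ell)\subseteq \mathrm{AP}$. Guards and invariants are finite conjunctions of constraints $x\sim c$ with $c\in\mathbb N$ and $\sim\ \in\{<,\le,=,\ge,>\}$. A state is a pair $(\ell,v)$ with $v\in\mathbb R_+^X$ and $v\models\mathcal I(\ell)$. For an edge $e$ from $\ell$ to $\ell'$ with guard $g$ and reset set $Y$, there is a transition $(\ell,v)\xrightarrow{\tau,e}(\ell',v')$ iff $v+\tau'\models\mathcal I(\ell)$ for all $0\le\tau'\le\tau$, $v+\tau\models g$, $v'=[Y\leftarrow 0](v+\tau)$ and $v'\models\mathcal I(\ell')$. Put $I(s,e)=\{\tau\ge0\mid \exists s'\ s\xrightarrow{\tau,e}s'\}$ and $I(s)=\bigcup_e I(s,e)$. Assume that $\mathcal A$ is non-blocking, i.e. $I(s)\ne\emptyset$ for every state $s$. **Probabilities.** Let $\mu=(\mu_s)_s$ be any family of probability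 measures on $\mathbb R_+$, depending measurably on $s\in L\times\mathbb R_+^X$, such that for every state $s$ condition $(\star)$ holds: $\mu_s(I(s))=1$; if $I(s)$ has positive Lebesgue measure, then $\mu_s$ has the same null sets as Lebesgue measure restricted to $I(s)$; otherwise $\mu_s$ has the same null sets as the uniform distribution on the (finite) set $I(s)$. Let $w(e)>0$ ($e\in E$) be any weights. From a state $s$, a delay $\tau$ is drawn from $\mu_s$, then an edge $e$ among those enabled (without delay) in $s+\tau$ with probability proportional to $w(e)$; the edge is fired and this is iterated. This defines a probability measure $\mathbb P_{\mathcal A}$ on the infinite runs from $s$. **Thickness and topology.** For a state $s$, edges $e_1,\dots,e_n$ and $\mathcal C\subseteq\mathbb R_+^n$, let $\pi_{\mathcal C}(s,e_1\dots e_n)$ be the set of runs $s\xrightarrow{\tau_1,e_1}s_1\cdots\xrightarrow{\tau_n,e_n}s_n$ with $(\tau_i)_i\in\mathcal C$, and $\mathrm{Pol}(\pi_{\mathcal C})\subseteq\mathbb R_+^n$ the set of the corresponding tuples $(\tau_i)_i$. Let $\mathcal C_i$ be the projection of $\mathrm{Pol}(\pi_{\mathcal C})$ to the first $i$ coordinates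 ($\mathcal C_0$ is true). The path $\pi_{\mathcal C}$ is thin if for some $1\le i\le n$ $$\dim \mathrm{Pol}\big(\pi_{\mathcal C_i}(s,e_1\dots e_i)\big)<\dim\bigcup_e\mathrm{Pol}\big(\pi_{\mathcal C_{i-1}}(s,e_1\dots e_{i-1}e)\big),$$ and thick otherwise; the empty set has smaller dimension than a point. An infinite symbolic path is thick if all its finite prefixes are. The set of infinite runs from $s$ carries the topology whose basic open sets are the whole set, the empty set, and the cylinders of the thick paths $\pi_{\mathcal C}(s,e_1\dots e_n)$ with $\mathcal C$ Borel and $\mathrm{Pol}(\pi_{\mathcal C})$ open in $\mathrm{Pol}(\pi(s,e_1\dots e_n))$. A set is large if its complement is meagre. **Regions.** Let $M$ be the largest constant in $\mathcal A$. Valuations $v,v'$ are region equivalent if for every clock $x$ either $v(x),v'(x)>M$, or $\lfloor v(x)\rfloor=\lfloor v'(x)\rfloor$ and the fractional parts satisfy $\{v(x)\}=0\Leftrightarrow\{v'(x)\}=0$; and for all $x,y$ with $v(x),v(y)\le M$: $\{v(x)\}\le\{v(y)\}\Leftrightarrow\{v'(x)\}\le\{v'(y)\}$. The timed region automaton $\mathsf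 R(\mathcal A)$ has the locations $(\ell,r)$, $r$ a region, with invariant $\mathcal I(\ell)$ and label $\mathcal L(\ell)$. It has an edge from $(\ell,r)$ to $(\ell',r')$ for each region $r''$ and edge $e$ of $\mathcal A$ such that $(\ell,v)\xrightarrow{\tau,e}(\ell',v')$ for some $v\in r$, $\tau\ge 0$, $v'\in r'$ with $v+\tau\in r''$; its guard says that the valuation is in $r''$, and its reset set is that of $e$. For $s=(\ell,v)$ put $\iota(s)=((\ell,[v]),v)$. An edge $f$ of $\mathsf R(\mathcal A)$ with source $(\ell,r)$ is thin if $\dim I(s,f)<\dim I(s)$ for some $s=((\ell,r),v)$ with $v\in r$. The thick graph $\mathcal G_{\mathrm t}(\mathcal A)$ is $\mathsf R(\mathcal A)$ without its thin edges, seen as a finite graph. $\mathsf{MC}(\mathcal A)$ is the finite Markov chain on the locations of $\mathsf R(\mathcal A)$ that moves along an outgoing edge of $\mathcal G_{\mathrm t}(\mathcal A)$ chosen uniformly at random. **Theorem.** Let $s$ be a state of $\mathcal A$ and $P\subseteq(2^{\mathrm{AP}})^\omega$ an (untimed) safety property, i.e. for every $u=u_0u_1\dots$: $u\notin P$ iff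 there is $i$ such that no infinite word with prefix $u_0\dots u_i$ is in $P$. A run or path satisfies $P$ if its sequence of location labels is in $P$. Then, for every choice of $\mu$ satisfying $(\star)$ and of $w$, the following are equivalent: (a) $\mathbb P_{\mathcal A}(\{\varrho \text{ run from } s\mid \varrho\models P\})=1$; (b) the set $\{\varrho \text{ run from } s\mid \varrho\models P\}$ is large in the space of infinite runs of $\mathcal A$ from $s$; (c) every infinite thick symbolic path from $\iota(s)$ in $\mathsf R(\mathcal A)$ satisfies $P$ (i.e. all its runs do); (d) every infinite path from $(\ell,[v])$ in $\mathcal G_{\mathrm t}(\mathcal A)$ satisfies $P$, where $s=(\ell,v)$; (e) $\mathsf{MC}(\mathcal A)$ started in $(\ell,[v])$ satisfies $P$ with probability one. -/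

import Mathlib

open MeasureTheory ProbabilityTheory Set
open scoped NNReal ENNReal

namespace STA

/-! ### Clocks, guards, timed automata -/

/-- Clock valuations over `X`. -/
abbrev Val (X : Type*) := X → ℝ≥0

/-- The valuation `v + τ`. -/
def delay {X : Type*} (v : Val X) (τ : ℝ≥0) : Val X := fun x => v x + τ

open Classical in
/-- The valuation `[Y ← 0] v`. -/
noncomputable def resetTo {X : Type*} (Y : Set X) (v : Val X) : Val X :=
  fun x => if x ∈ Y then 0 else v x

/-- The comparison symbols `<`, `≤`, `=`, `≥`, `>`. -/
inductive Cmp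
  | lt | le | eq | ge | gt

/-- Interpretation of a comparison symbol. -/
def Cmp.Holds (c : Cmp) (a b : ℝ≥0) : Prop :=
  match c with
  | .lt => a < b
  | .le => a ≤ b
  | .eq => a = b
  | .ge => b ≤ a
  | .gt => b < a

/-- An atomic constraint `x ∼ c` with `c` a natural number. -/
structure AtomicConstraint (X : Type*) where
  clock : X
  cmp : Cmp
  const : ℕ

/-- A guard is a finite conjunction of atomic constraints. -/
abbrev Guard (X : Type*) := List (AtomicConstraint X)

/-- The set of valuations which satisfy a guard. -/
def guardSet {X : Type*} (g : Guard X) : Set (Val X) :=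
  {v | ∀ c ∈ g, c.cmp.Holds (v c.clock) (c.const : ℝ≥0)}

/-- The largest constant of a guard (`0` if there is none). -/
def guardMax {X : Type*} (g : Guard X) : ℕ := (g.map AtomicConstraint.const).foldr max 0

/-- A timed automaton over the atomic propositions `AP`, with set of locations `L`, set of clocks
`X` and set of edges `E` (an edge `e` is `src e --(guard e, reset e)--> tgt e`). The finiteness of
`L`, `X`, `E` is assumed where it is needed. -/
structure TimedAutomaton (L X E AP : Type*) where
  src : E → L
  guard : E → Guard X
  reset : E → Set X
  tgt : E → L
  inv : L → Guard X
  label : L → Set AP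

/-- A timed automaton in which guards and invariants are given by the set of valuations that
satisfy them. Both a timed automaton and its timed region automaton are of this form. -/
structure ClockAutomaton (Q X T AP : Type*) where
  src : T → Q
  guard : T → Set (Val X)
  reset : T → Set X
  tgt : T → Q
  inv : Q → Set (Val X)
  label : Q → Set AP

/-- Interpretation of the guards and invariants of a timed automaton. -/
def TimedAutomaton.sem {L X E AP : Type*} (A : TimedAutomaton L X E AP) :
    ClockAutomaton L X E AP where
  src := A.src
  guard e := guardSet (A.guard e)
  reset := A.reset
  tgt := A.tgt
  inv l := guardSet (A.inv l)
  label := A.label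

/-- Pairs of a location and a valuation. -/
abbrev Config (Q X : Type*) := Q × Val X

/-! ### Semantics: states, transitions, runs, symbolic paths -/

namespace ClockAutomaton

variable {Q X T AP : Type*}

/-- The pair `(q, v)` is a state iff `v` satisfies the invariant of `q`. -/
def IsState (M : ClockAutomaton Q X T AP) (s : Config Q X) : Prop := s.2 ∈ M.inv s.1

/-- The transition relation `s --(τ, e)--> s'`. -/
def Step (M : ClockAutomaton Q X T AP) (s : Config Q X) (τ : ℝ≥0) (e : T) (s' : Config Q X) :
    Prop :=
  M.src e = s.1 ∧ (∀ τ' ≤ τ, delay s.2 τ' ∈ M.inv s.1) ∧ delay s.2 τ ∈ M.guard e ∧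
    s'.1 = M.tgt e ∧ s'.2 = resetTo (M.reset e) (delay s.2 τ) ∧ s'.2 ∈ M.inv s'.1

/-- `I(s, e)`: the delays after which `e` can be taken from `s`. -/
def delaysOf (M : ClockAutomaton Q X T AP) (s : Config Q X) (e : T) : Set ℝ≥0 :=
  {τ | ∃ s', M.Step s τ e s'}

/-- `I(s)`: the delays after which some edge can be taken from `s`. -/
def delays (M : ClockAutomaton Q X T AP) (s : Config Q X) : Set ℝ≥0 := ⋃ e, M.delaysOf s e

/-- Non-blocking: `I(s) ≠ ∅` for every state `s`. -/
def NonBlocking (M : ClockAutomaton Q X T AP) : Prop :=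
  ∀ s, M.IsState s → (M.delays s).Nonempty

/-- A run `s₀ --(τ₁, e₁)--> s₁ --(τ₂, e₂)--> ⋯` is encoded as the sequence of the triples
`(s_i, (τ_{i+1}, e_{i+1}))`, `i ≥ 0`. This is the set of the infinite runs from `s`. -/
def Runs (M : ClockAutomaton Q X T AP) (s : Config Q X) :
    Set (ℕ → Config Q X × (ℝ≥0 × T)) :=
  {ρ | (ρ 0).1 = s ∧ ∀ i, M.Step (ρ i).1 (ρ i).2.1 (ρ i).2.2 (ρ (i + 1)).1}

/-- The word `𝓛(s₀) 𝓛(s₁) ⋯` of a run. -/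
def word (M : ClockAutomaton Q X T AP) (ρ : ℕ → Config Q X × (ℝ≥0 × T)) : ℕ → Set AP :=
  fun i => M.label (ρ i).1.1

/-- The polyhedron `Pol(π_C(s, e₁ … e_n))`: all `(τ_1, …, τ_n)` that satisfy the constraint `C`
and for which there is a run `s --(τ₁, e₁)--> s₁ ⋯ --(τ_n, e_n)--> s_n`. The sequence of edges is
`e 0, …, e (n - 1)`; later entries of `e` play no role. -/
def Pol (M : ClockAutomaton Q X T AP) (s : Config Q X) (n : ℕ) (e : ℕ → T)
    (C : Set (Fin n → ℝ≥0)) : Set (Fin n → ℝ≥0) :=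
  {τ | τ ∈ C ∧ ∃ st : ℕ → Config Q X, st 0 = s ∧
    ∀ i : Fin n, M.Step (st i) (τ i) (e i) (st (i + 1))}

open Classical in
/-- The constraint `C_i`: the projection of `Pol(π_C(s, e₁ … e_n))` to the first `i` coordinates,
with the convention that `C_0` is true. -/
def projConstraint (M : ClockAutomaton Q X T AP) (s : Config Q X) (n : ℕ) (e : ℕ → T)
    (C : Set (Fin n → ℝ≥0)) (i : ℕ) (h : i ≤ n) : Set (Fin i → ℝ≥0) :=
  if i = 0 then univ else (fun τ j => τ (Fin.castLE h j)) '' M.Pol s n e C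

end ClockAutomaton

open Classical in
/-- Dimension of a set of delays or of tuples of delays: the Hausdorff dimension (for finite unions
of polyhedra, this is the usual dimension), where the empty set has dimension `⊥`, below the
dimension `0` of a point. (`ℝ≥0` and its powers carry the metrics induced by `ℝ` and its powers.) -/
noncomputable def dim {α : Type*} [EMetricSpace α] (S : Set α) : WithBot ℝ≥0∞ :=
  if S = ∅ then ⊥ else ((dimH S : ℝ≥0∞) : WithBot ℝ≥0∞)

namespace ClockAutomaton

variable {Q X T AP : Type*}

/-- The constrained path `π_C(s, e₁ … e_n)` is thin: for some `1 ≤ k ≤ n` (here `k = i + 1`),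
`dim Pol(π_{C_k}(s, e₁ … e_k)) < dim ⋃_e Pol(π_{C_{k-1}}(s, e₁ … e_{k-1} e))`. -/
def ThinPath (M : ClockAutomaton Q X T AP) (s : Config Q X) (n : ℕ) (e : ℕ → T)
    (C : Set (Fin n → ℝ≥0)) : Prop :=
  ∃ (i : ℕ) (h : i < n),
    dim (M.Pol s (i + 1) e (M.projConstraint s n e C (i + 1) h)) <
      dim (⋃ e' : T, M.Pol s (i + 1) (Function.update e i e')
        {τ | Fin.init τ ∈ M.projConstraint s n e C i h.le})

/-- A constrained path is thick iff it is not thin. -/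
def ThickPath (M : ClockAutomaton Q X T AP) (s : Config Q X) (n : ℕ) (e : ℕ → T)
    (C : Set (Fin n → ℝ≥0)) : Prop := ¬ M.ThinPath s n e C

/-- The infinite symbolic path `π(s, e₁ e₂ …)`. -/
def infPath (M : ClockAutomaton Q X T AP) (s : Config Q X) (e : ℕ → T) :
    Set (ℕ → Config Q X × (ℝ≥0 × T)) :=
  {ρ | ρ ∈ M.Runs s ∧ ∀ i, (ρ i).2.2 = e i}

/-- The infinite symbolic path `π(s, e₁ e₂ …)` is thick: all `π(s, e₁ … e_n)`, `n ≥ 1`, are. -/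
def ThickInfPath (M : ClockAutomaton Q X T AP) (s : Config Q X) (e : ℕ → T) : Prop :=
  ∀ n ≥ 1, M.ThickPath s n e univ

/-- The cylinder of the constrained path `π_C(s, e₁ … e_n)` in the set of infinite runs. -/
def cyl (M : ClockAutomaton Q X T AP) (s : Config Q X) (n : ℕ) (e : ℕ → T)
    (C : Set (Fin n → ℝ≥0)) : Set (M.Runs s) :=
  {ρ | (∀ i < n, (ρ.1 i).2.2 = e i) ∧ (fun i : Fin n => (ρ.1 i).2.1) ∈ C}

/-- `Pol(π_C(s, e₁ … e_n))` is open in `Pol(π(s, e₁ … e_n))`. -/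
def IsOpenPath (M : ClockAutomaton Q X T AP) (s : Config Q X) (n : ℕ) (e : ℕ → T)
    (C : Set (Fin n → ℝ≥0)) : Prop :=
  ∃ U : Set (Fin n → ℝ≥0), IsOpen U ∧ M.Pol s n e C = U ∩ M.Pol s n e univ

/-- The basic open sets of the space of infinite runs from `s`. -/
def basicOpens (M : ClockAutomaton Q X T AP) (s : Config Q X) : Set (Set (M.Runs s)) :=
  {B | B = univ ∨ B = ∅ ∨ ∃ (n : ℕ) (e : ℕ → T) (C : Set (Fin n → ℝ≥0)),
    M.ThickPath s n e C ∧ MeasurableSet C ∧ M.IsOpenPath s n e C ∧ B = M.cyl s n e C}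

/-- The topology on the infinite runs from `s` given by the basic open sets. -/
abbrev runTopology (M : ClockAutomaton Q X T AP) (s : Config Q X) : TopologicalSpace (M.Runs s) :=
  TopologicalSpace.generateFrom (M.basicOpens s)

/-- Large satisfaction: the set of the runs from `s` that satisfy `P` is large, i.e. its complement
is meagre. -/
def LargelySatisfies (M : ClockAutomaton Q X T AP) (s : Config Q X) (P : Set (ℕ → Set AP)) :
    Prop :=
  letI := M.runTopology s
  IsMeagre {ρ : M.Runs s | M.word ρ.1 ∈ P}ᶜ

end ClockAutomaton

/-! ### The timed region automaton and the thick graph -/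

/-- Region equivalence with respect to the maximal constant `K`. -/
def RegionEquiv {X : Type*} (K : ℕ) (v v' : Val X) : Prop :=
  (∀ x, ((K : ℝ≥0) < v x ∧ (K : ℝ≥0) < v' x) ∨
    (⌊v x⌋₊ = ⌊v' x⌋₊ ∧ (Int.fract (v x : ℝ) = 0 ↔ Int.fract (v' x : ℝ) = 0))) ∧
  ∀ x y, v x ≤ K → v y ≤ K →
    (Int.fract (v x : ℝ) ≤ Int.fract (v y : ℝ) ↔ Int.fract (v' x : ℝ) ≤ Int.fract (v' y : ℝ))

theorem natFloor_eq_of_fract_eq_zero {a : ℝ≥0} (h : Int.fract (a : ℝ) = 0) :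
    a = (⌊a⌋₊ : ℝ≥0) := by
  obtain ⟨z, hz⟩ := Int.fract_eq_zero_iff.1 h
  have hz0 : 0 ≤ z := by
    have : (0 : ℝ) ≤ (z : ℝ) := hz ▸ a.2
    exact_mod_cast this
  lift z to ℕ using hz0
  have : a = (z : ℝ≥0) := by
    apply NNReal.coe_injective
    simpa using hz.symm
  simp [this]

theorem RegionEquiv.le_iff {X : Type*} {K : ℕ} {v v' : Val X} (h : RegionEquiv K v v') (x : X) :
    v x ≤ K ↔ v' x ≤ K := by
  have key : ∀ a b : ℝ≥0, ⌊a⌋₊ = ⌊b⌋₊ →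
      (Int.fract (a : ℝ) = 0 ↔ Int.fract (b : ℝ) = 0) → a ≤ K → b ≤ K := by
    intro a b hf hz ha
    by_contra hb
    push Not at hb
    have h1 : K ≤ ⌊b⌋₊ := Nat.le_floor hb.le
    have h2 : ⌊a⌋₊ ≤ K := by simpa using Nat.floor_mono ha
    have h3 : ⌊a⌋₊ = K := le_antisymm h2 (hf ▸ h1)
    have h4 : a = K := le_antisymm ha (h3 ▸ Nat.floor_le zero_le)
    have h5 : Int.fract (b : ℝ) = 0 := hz.1 (by simp [h4])
    have h6 := natFloor_eq_of_fract_eq_zero h5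
    rw [← hf, h3] at h6
    exact absurd h6 hb.ne'
  rcases h.1 x with ⟨h1, h2⟩ | ⟨h1, h2⟩
  · exact ⟨fun h => absurd h (not_le.2 h1), fun h => absurd h (not_le.2 h2)⟩
  · exact ⟨key _ _ h1 h2, key _ _ h1.symm h2.symm⟩

/-- Region equivalence is an equivalence relation. -/
def regionSetoid (X : Type*) (K : ℕ) : Setoid (Val X) where
  r := RegionEquiv K
  iseqv :=
    { refl := fun v => ⟨fun _ => Or.inr ⟨rfl, Iff.rfl⟩, fun _ _ _ _ => Iff.rfl⟩
      symm := fun {v v'} h => by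
        refine ⟨fun x => (h.1 x).imp (fun h => ⟨h.2, h.1⟩) (fun h => ⟨h.1.symm, h.2.symm⟩),
          fun x y hx hy => ?_⟩
        exact (h.2 x y ((h.le_iff x).2 hx) ((h.le_iff y).2 hy)).symm
      trans := fun {u v w} h k => by
        refine ⟨fun x => ?_, fun x y hx hy => ?_⟩
        · rcases h.1 x with ⟨h1, h2⟩ | ⟨h1, h2⟩
          · refine Or.inl ⟨h1, ?_⟩
            by_contra hw
            exact absurd ((k.le_iff x).2 (not_lt.1 hw)) (not_le.2 h2)
          · rcases k.1 x with ⟨k1, k2⟩ | ⟨k1, k2⟩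
            · refine Or.inl ⟨?_, k2⟩
              by_contra hu
              exact absurd ((h.le_iff x).1 (not_lt.1 hu)) (not_le.2 k1)
            · exact Or.inr ⟨h1.trans k1, h2.trans k2⟩
        · exact (h.2 x y hx hy).trans
            (k.2 x y ((h.le_iff x).1 hx) ((h.le_iff y).1 hy)) }

/-- The regions: equivalence classes of valuations. -/
def Region (X : Type*) (K : ℕ) : Type _ := Quotient (regionSetoid X K)

/-- The region `[v]`. -/
def regionOf {X : Type*} (K : ℕ) (v : Val X) : Region X K := Quotient.mk (regionSetoid X K) v

instance {X : Type*} [Finite X] {K : ℕ} : Finite (Region X K) := by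
  classical
  let code : Val X → (X → Option (Fin (K + 1) × Prop)) × (X → X → Prop) := fun v =>
    (fun x => if h : v x ≤ K then
      some (⟨⌊v x⌋₊, Nat.lt_succ_of_le (by simpa using Nat.floor_mono h)⟩,
        Int.fract (v x : ℝ) = 0) else none,
     fun x y => Int.fract (v x : ℝ) ≤ Int.fract (v y : ℝ))
  refine Finite.of_injective (fun r : Region X K => code (Quotient.out r)) ?_
  intro r r' h
  have h1 := congrArg Prod.fst h
  have h2 := congrArg Prod.snd h
  have : RegionEquiv K (Quotient.out r) (Quotient.out r') := by
    refine ⟨fun x => ?_, fun x y _ _ => ?_⟩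
    · have hx := congrFun h1 x
      simp only [code] at hx
      split_ifs at hx with a b b
      · simp only [Option.some.injEq, Prod.mk.injEq, Fin.mk.injEq] at hx
        exact Or.inr ⟨hx.1, iff_of_eq hx.2⟩
      · exact Or.inl ⟨not_le.1 a, not_le.1 b⟩
    · exact iff_of_eq (congrFun (congrFun h2 x) y)
  exact Quotient.out_equiv_out.1 this

/-- The maximal constant used in the guards and invariants of `A`. -/
def TimedAutomaton.maxConst {L X E AP : Type*} [Fintype L] [Fintype E]
    (A : TimedAutomaton L X E AP) : ℕ :=
  max (Finset.univ.sup fun e => guardMax (A.guard e))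
    (Finset.univ.sup fun l => guardMax (A.inv l))

/-- The locations `(ℓ, r)` of the timed region automaton. -/
abbrev RegionLoc {L X E AP : Type*} [Fintype L] [Fintype E] (A : TimedAutomaton L X E AP) :=
  L × Region X A.maxConst

/-- The edges `(ℓ, r) --(guard(r''), e, Y)--> (ℓ', r')` of the timed region automaton. The field
`mid` is `r''`; the set `Y` of clocks to be reset is the one of `e`. -/
@[ext]
structure RegionEdge {L X E AP : Type*} [Fintype L] [Fintype E] (A : TimedAutomaton L X E AP) where
  src : RegionLoc A
  mid : Region X A.maxConst
  edge : E
  tgt : RegionLoc A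
  exists_step : ∃ (v v' : Val X) (τ : ℝ≥0),
    regionOf A.maxConst v = src.2 ∧ A.sem.Step (src.1, v) τ edge (tgt.1, v') ∧
    regionOf A.maxConst (delay v τ) = mid ∧ regionOf A.maxConst v' = tgt.2

instance {L X E AP : Type*} [Fintype L] [Finite X] [Fintype E] {A : TimedAutomaton L X E AP} :
    Finite (RegionEdge A) := by
  refine Finite.of_injective
    (fun f : RegionEdge A => (f.src, f.mid, f.edge, f.tgt)) fun f g h => ?_
  simp only [Prod.mk.injEq] at h
  exact RegionEdge.ext h.1 h.2.1 h.2.2.1 h.2.2.2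

/-- The timed region automaton of `A`. The guard of an edge characterises the region `mid`. -/
def TimedAutomaton.regionAutomaton {L X E AP : Type*} [Fintype L] [Fintype E]
    (A : TimedAutomaton L X E AP) : ClockAutomaton (RegionLoc A) X (RegionEdge A) AP where
  src := RegionEdge.src
  guard f := {v | regionOf A.maxConst v = f.mid}
  reset f := A.reset f.edge
  tgt := RegionEdge.tgt
  inv q := guardSet (A.inv q.1)
  label q := A.label q.1

/-- The location `(ℓ, [v])` of the region automaton for `s = (ℓ, v)`. -/
def TimedAutomaton.regionLoc {L X E AP : Type*} [Fintype L] [Fintype E]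
    (A : TimedAutomaton L X E AP) (s : Config L X) : RegionLoc A :=
  (s.1, regionOf A.maxConst s.2)

/-- The state `ι(s) = ((ℓ, [v]), v)` of the region automaton for `s = (ℓ, v)`. -/
def TimedAutomaton.iota {L X E AP : Type*} [Fintype L] [Fintype E]
    (A : TimedAutomaton L X E AP) (s : Config L X) : Config (RegionLoc A) X :=
  (A.regionLoc s, s.2)

/-- The edge `f` of the region automaton, with source `q = (ℓ, r)`, is thin: `dim I(s, f) < dim I(s)`
for some `s` in `q`, i.e. for some `s = (q, v)` with `v ∈ r`. -/
def ThinEdge {L X E AP : Type*} [Fintype L] [Fintype E] {A : TimedAutomaton L X E AP}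
    (f : RegionEdge A) : Prop :=
  ∃ v : Val X, regionOf A.maxConst v = f.src.2 ∧
    dim (A.regionAutomaton.delaysOf (f.src, v) f) < dim (A.regionAutomaton.delays (f.src, v))

/-- The edges of the thick graph: the edges of the region automaton that are not thin. -/
abbrev ThickEdge {L X E AP : Type*} [Fintype L] [Fintype E] (A : TimedAutomaton L X E AP) :=
  {f : RegionEdge A // ¬ ThinEdge f}

/-- The infinite path with edges `f 0, f 1, …` in the thick graph starts in `q`. -/
def IsThickGraphPath {L X E AP : Type*} [Fintype L] [Fintype E] {A : TimedAutomaton L X E AP}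
    (q : RegionLoc A) (f : ℕ → ThickEdge A) : Prop :=
  (f 0).1.src = q ∧ ∀ i, (f i).1.tgt = (f (i + 1)).1.src

/-! ### Probabilities -/

/-- The law on infinite sequences of the homogeneous Markov chain with initial distribution `ν` and
transition kernel `κ`. -/
noncomputable def chainLaw {S : Type*} [MeasurableSpace S] (ν : Measure S) (κ : Kernel S S)
    [IsMarkovKernel κ] : Measure (ℕ → S) :=
  Kernel.trajMeasure (X := fun _ => S) ν
    (fun n => κ.comap (fun h : (Finset.Iic n → S) => h ⟨n, Finset.mem_Iic.2 le_rfl⟩)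
      (measurable_pi_apply _))

section MarkovChain

variable {L X E AP : Type*} [Fintype L] [Finite X] [Fintype E]

instance {K : ℕ} : MeasurableSpace (Region X K) := ⊤

instance {A : TimedAutomaton L X E AP} : MeasurableSpace (RegionEdge A) := ⊤

/-- The edges of the thick graph that leave `q`. -/
def thickOut (A : TimedAutomaton L X E AP) (q : RegionLoc A) : Set (RegionEdge A) :=
  {f | f.src = q ∧ ¬ ThinEdge f}

variable [MeasurableSpace L] [DiscreteMeasurableSpace L]

open Classical in
/-- The transition kernel of the finite Markov chain `MC(A)`: take an edge of the thick graph out of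
the current location, uniformly at random. (A location without such an edge is made absorbing.) -/
noncomputable def mcKernel (A : TimedAutomaton L X E AP) : Kernel (RegionLoc A) (RegionLoc A) :=
  Kernel.ofFunOfCountable fun q =>
    if (thickOut A q).Nonempty then (uniformOn (thickOut A q)).map RegionEdge.tgt
    else Measure.dirac q

instance (A : TimedAutomaton L X E AP) : IsMarkovKernel (mcKernel A) := by
  classical
  refine ⟨fun q => ?_⟩
  change IsProbabilityMeasure (if (thickOut A q).Nonempty then
    (uniformOn (thickOut A q)).map RegionEdge.tgt else Measure.dirac q)
  split_ifs with h
  · have := isProbabilityMeasure_uniformOn (toFinite (thickOut A q)) h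
    exact Measure.isProbabilityMeasure_map measurable_from_top.aemeasurable
  · infer_instance

/-- The finite Markov chain `MC(A)` almost surely satisfies `P` from its state `q`. -/
def MCSatisfies (A : TimedAutomaton L X E AP) (q : RegionLoc A) (P : Set (ℕ → Set AP)) : Prop :=
  chainLaw (Measure.dirac q) (mcKernel A)
    {ω | (fun i => A.regionAutomaton.label (ω i)) ∈ P} = 1

end MarkovChain

section Stochastic

variable {L X E AP : Type*}

/-- Two measures with the same null measurable sets. -/
def MeasEquiv {α : Type*} [MeasurableSpace α] (μ ν : Measure α) : Prop :=
  ∀ B, MeasurableSet B → (μ B = 0 ↔ ν B = 0)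

/-- Lebesgue measure on `ℝ≥0`. -/
noncomputable def lebesgue : Measure ℝ≥0 := (volume : Measure ℝ).comap NNReal.toReal

/-- A stochastic timed automaton: a non-blocking timed automaton with a family `μ = (μ_s)` of
probability measures on delays, which depends measurably on `s`, and with positive weights on the
edges, such that the conditions (H1) and (H2) hold at every state `s`. -/
structure StochasticTimedAutomaton (L X E AP : Type*) [MeasurableSpace L]
    extends TimedAutomaton L X E AP where
  nonBlocking : toTimedAutomaton.sem.NonBlocking
  μ : Kernel (Config L X) ℝ≥0
  isMarkov : IsMarkovKernel μ
  h1 : ∀ s, toTimedAutomaton.sem.IsState s → μ s (toTimedAutomaton.sem.delays s) = 1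
  h2_pos : ∀ s, toTimedAutomaton.sem.IsState s →
    0 < lebesgue (toTimedAutomaton.sem.delays s) →
    MeasEquiv (μ s) (lebesgue.restrict (toTimedAutomaton.sem.delays s))
  h2_zero : ∀ s, toTimedAutomaton.sem.IsState s →
    lebesgue (toTimedAutomaton.sem.delays s) = 0 →
    MeasEquiv (μ s) (uniformOn (toTimedAutomaton.sem.delays s))
  weight : E → ℝ≥0
  weight_pos : ∀ e, 0 < weight e

attribute [instance] StochasticTimedAutomaton.isMarkov

/-- The edge `e` is enabled in `s`, i.e. it can be taken without delay. -/
def TimedAutomaton.Enabled (A : TimedAutomaton L X E AP) (s : Config L X) (e : E) : Prop :=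
  ∃ s', A.sem.Step s 0 e s'

/-- The configuration reached from `s` by the delay `τ` followed by the edge `e`. -/
noncomputable def TimedAutomaton.fire (A : TimedAutomaton L X E AP)
    (z : Config L X × (ℝ≥0 × E)) : Config L X :=
  (A.tgt z.2.2, resetTo (A.reset z.2.2) (delay z.1.2 z.2.1))

theorem measurable_resetTo (Y : Set X) : Measurable (resetTo Y : Val X → Val X) := by
  refine measurable_pi_lambda _ fun x => ?_
  unfold resetTo
  split_ifs
  · exact measurable_const
  · exact measurable_pi_apply x

theorem measurableSet_guardSet (g : Guard X) : MeasurableSet (guardSet g) := by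
  have : guardSet g = ⋂ c ∈ {c | c ∈ g}, {v : Val X | c.cmp.Holds (v c.clock) (c.const : ℝ≥0)} := by
    ext v; simp [guardSet]
  rw [this]
  refine MeasurableSet.biInter (List.finite_toSet g).countable fun c _ => ?_
  have hm : Measurable fun v : Val X => v c.clock := measurable_pi_apply _
  rcases c with ⟨x, _ | _ | _ | _ | _, k⟩
  · exact measurableSet_lt hm measurable_const
  · exact measurableSet_le hm measurable_const
  · exact measurableSet_eq_fun hm measurable_const
  · exact measurableSet_le measurable_const hm
  · exact measurableSet_lt measurable_const hm

theorem measurableSet_enabled [MeasurableSpace L] [DiscreteMeasurableSpace L]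
    (A : TimedAutomaton L X E AP) (e : E) : MeasurableSet {s | A.Enabled s e} := by
  have : {s | A.Enabled s e} = Prod.fst ⁻¹' {A.src e} ∩
      (Prod.snd ⁻¹' guardSet (A.inv (A.src e)) ∩ (Prod.snd ⁻¹' guardSet (A.guard e) ∩
        (fun s : Config L X => resetTo (A.reset e) s.2) ⁻¹' guardSet (A.inv (A.tgt e)))) := by
    ext s
    have h0 : delay s.2 0 = s.2 := by ext x; simp [delay]
    constructor
    · rintro ⟨⟨l, v⟩, h1, h2, h3, h4, h5, h6⟩
      simp only [TimedAutomaton.sem] at h1 h2 h3 h4 h5 h6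
      have h2 := h2 0 le_rfl
      rw [h0] at h2 h3 h5
      subst h4 h5
      exact ⟨h1.symm, by rw [mem_preimage, h1]; exact h2, h3, h6⟩
    · rintro ⟨h1, h2, h3, h4⟩
      have h1 : s.1 = A.src e := h1
      refine ⟨(A.tgt e, resetTo (A.reset e) (delay s.2 0)), h1.symm, ?_, ?_, rfl, rfl, ?_⟩
      · intro τ' hτ'
        have : τ' = 0 := le_antisymm hτ' zero_le
        subst this
        rw [h0, h1]; exact h2
      · rw [h0]; exact h3
      · change resetTo (A.reset e) (delay s.2 0) ∈ guardSet (A.inv (A.tgt e))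
        rw [h0]; exact h4
  rw [this]
  exact ((measurable_fst (MeasurableSet.of_discrete)).inter
    ((measurable_snd (measurableSet_guardSet _)).inter
      ((measurable_snd (measurableSet_guardSet _)).inter
        (((measurable_resetTo _).comp measurable_snd) (measurableSet_guardSet _)))))

theorem measurable_delay [MeasurableSpace L] : Measurable
    fun p : Config L X × ℝ≥0 => ((p.1.1, delay p.1.2 p.2) : Config L X) := by
  refine (measurable_fst.comp measurable_fst).prodMk (measurable_pi_lambda _ fun x => ?_)
  exact ((measurable_pi_apply x).comp (measurable_snd.comp measurable_fst)).add measurable_snd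

theorem measurable_fire [MeasurableSpace L] [Countable E] [MeasurableSpace E]
    [DiscreteMeasurableSpace E] (A : TimedAutomaton L X E AP) : Measurable A.fire := by
  have : Measurable fun z : (Config L X × ℝ≥0) × E => A.fire (z.1.1, (z.1.2, z.2)) := by
    refine measurable_from_prod_countable_left fun e => ?_
    have h : Measurable fun p : Config L X × ℝ≥0 => delay p.1.2 p.2 :=
      measurable_snd.comp measurable_delay
    exact Measurable.prodMk
      (measurable_const : Measurable fun _ : Config L X × ℝ≥0 => A.tgt e) ((measurable_resetTo (A.reset e)).comp h)
  exact this.comp (MeasurableEquiv.prodAssoc.symm.measurable)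

namespace StochasticTimedAutomaton

variable [MeasurableSpace L]

open Classical in
/-- The probability `p_s(e)`: it is `0` if `e` is not enabled in `s`, and otherwise the weight of
`e` divided by the sum of the weights of the edges that are enabled in `s`. -/
noncomputable def edgeProb [Fintype E] (A : StochasticTimedAutomaton L X E AP) (s : Config L X)
    (e : E) : ℝ≥0∞ :=
  if A.Enabled s e then
    (A.weight e : ℝ≥0∞) / ∑ e', if A.Enabled s e' then (A.weight e' : ℝ≥0∞) else 0
  else 0

theorem measurable_edgeProb [DiscreteMeasurableSpace L] [Fintype E]
    (A : StochasticTimedAutomaton L X E AP) (e : E) :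
    Measurable fun s => A.edgeProb s e := by
  classical
  unfold edgeProb
  refine Measurable.ite (measurableSet_enabled _ e) ?_ measurable_const
  refine measurable_const.div (Finset.measurable_sum _ fun e' _ => ?_)
  exact Measurable.ite (measurableSet_enabled _ e') measurable_const measurable_const

theorem sum_edgeProb [Fintype E] (A : StochasticTimedAutomaton L X E AP) (s : Config L X)
    (h : ∃ e, A.Enabled s e) : ∑ e, A.edgeProb s e = 1 := by
  classical
  obtain ⟨e, he⟩ := h
  have h1 : ∀ e, A.edgeProb s e = (if A.Enabled s e then (A.weight e : ℝ≥0∞) else 0) /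
      ∑ e', if A.Enabled s e' then (A.weight e' : ℝ≥0∞) else 0 := by
    intro e
    unfold edgeProb
    split_ifs <;> simp
  simp only [h1, div_eq_mul_inv]
  rw [← Finset.sum_mul]
  refine ENNReal.mul_inv_cancel ?_ ?_
  · intro h0
    have := (Finset.sum_eq_zero_iff.1 h0) e (Finset.mem_univ e)
    rw [if_pos he] at this
    exact (A.weight_pos e).ne' (by exact_mod_cast this)
  · refine ENNReal.sum_ne_top.2 fun e _ => ?_
    split_ifs <;> simp

variable [DiscreteMeasurableSpace L] [Fintype E] [Nonempty E] [MeasurableSpace E]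
  [DiscreteMeasurableSpace E]

open Classical in
/-- The random choice of an edge enabled in `s`, according to `p_s`. (If no edge is enabled, an
arbitrary one is taken; this has probability zero in a run from a state.) -/
noncomputable def edgeKernel (A : StochasticTimedAutomaton L X E AP) :
    Kernel (Config L X) E where
  toFun s := if ∃ e, A.Enabled s e then ∑ e, A.edgeProb s e • Measure.dirac e
    else Measure.dirac (Classical.arbitrary E)
  measurable' := by
    refine Measurable.ite ?_ ?_ measurable_const
    · have : {s | ∃ e, A.Enabled s e} = ⋃ e, {s | A.Enabled s e} := by ext; simp
      rw [this]
      exact MeasurableSet.iUnion fun e => measurableSet_enabled _ e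
    · refine Measure.measurable_of_measurable_coe _ fun B _ => ?_
      simp only [Measure.coe_finsetSum, Measure.smul_apply, Finset.sum_apply, smul_eq_mul]
      exact Finset.measurable_sum _ fun e _ => (A.measurable_edgeProb e).mul measurable_const

instance (A : StochasticTimedAutomaton L X E AP) : IsMarkovKernel A.edgeKernel := by
  classical
  refine ⟨fun s => ?_⟩
  change IsProbabilityMeasure (if ∃ e, A.Enabled s e then ∑ e, A.edgeProb s e • Measure.dirac e
    else Measure.dirac (Classical.arbitrary E))
  split_ifs with h
  · refine ⟨?_⟩
    simp only [Measure.coe_finsetSum, Measure.smul_apply, Finset.sum_apply, smul_eq_mul,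
      measure_univ, mul_one]
    exact A.sum_edgeProb s h
  · infer_instance

/-- From `s`, choose a delay `τ` according to `μ_s`, then an edge according to `p_{s+τ}`. -/
noncomputable def stepKernel (A : StochasticTimedAutomaton L X E AP) :
    Kernel (Config L X) (ℝ≥0 × E) :=
  A.μ ⊗ₖ A.edgeKernel.comap (fun p => (p.1.1, delay p.1.2 p.2)) measurable_delay

instance (A : StochasticTimedAutomaton L X E AP) : IsMarkovKernel A.stepKernel := by
  unfold stepKernel
  infer_instance

/-- The current state, together with the next delay and the next edge. -/
noncomputable def outKernel (A : StochasticTimedAutomaton L X E AP) :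
    Kernel (Config L X) (Config L X × (ℝ≥0 × E)) :=
  Kernel.id ×ₖ A.stepKernel

instance (A : StochasticTimedAutomaton L X E AP) : IsMarkovKernel A.outKernel := by
  unfold outKernel
  infer_instance

/-- The probability measure `ℙ_A` on (the sequences that encode) infinite runs from `s`. -/
noncomputable def prob (A : StochasticTimedAutomaton L X E AP) (s : Config L X) :
    Measure (ℕ → Config L X × (ℝ≥0 × E)) :=
  chainLaw (A.outKernel s) (A.outKernel.comap A.fire (measurable_fire _))

/-- Almost-sure satisfaction: the runs from `s` that satisfy `P` have probability one. -/
def AlmostSurelySatisfies (A : StochasticTimedAutomaton L X E AP) (s : Config L X)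
    (P : Set (ℕ → Set AP)) : Prop :=
  A.prob s {ρ | ρ ∈ A.sem.Runs s ∧ A.sem.word ρ ∈ P} = 1

end StochasticTimedAutomaton

end Stochastic

/-- (Untimed) safety properties over `AP`: those that are violated by a finite prefix. -/
def IsSafety {AP : Type*} (P : Set (ℕ → Set AP)) : Prop :=
  ∀ u : ℕ → Set AP, u ∉ P ↔ ∃ i, ∀ u' : ℕ → Set AP, (∀ j ≤ i, u' j = u j) → u' ∉ P

end STA

/-!
All five conditions say the same: the property holds along every run all of whose delays are
*thick* (`ThickRunsSatisfy`). A delay `t` from `(ℓ, v)` is thick if no clock has an integer value in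
`[0, M]` at `v + t`, or if no possible delay from `(ℓ, v)` has this property (`ThickDelay`).

Thick delays and dimension. Region equivalence is the agreement of all the constraints `x ≤ n`,
`n ≤ x` and `x - y ≤ m` (`regionEquiv_iff_diffEquiv`), from which regions have delay successors
(`RegionEquiv.exists_delay`). The delays into a region contain an interval if the region has no
integer clock, and they are countably many otherwise. So an edge of the region automaton is thin iff
its delays are not thick (`thinEdge_iff`), and paths in the thick graph correspond to runs with thick
delays (`thickGraphPath_satisfy_iff`). For a path of length `n`, consider the *cell* of a delay
sequence `p`, i.e. the sequences that follow the same regions as `p`. The cell projects onto a set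
that contains a box in the coordinates at which no clock becomes an integer (`count_le_dimH`). Any
other delay is an affine function of the earlier delays, up to countably many choices, and so the
dimension is not larger than the number of the coordinates of the first kind (`dimH_le_count`).
Hence the cell of `p` yields a thick path iff all delays of `p` are thick. The cells are the
polyhedra of the paths of the region automaton, which gives `thickInfPath_satisfy_iff`.

Category. By convexity, a nonempty relatively open part of any thick constrained path contains a
delay sequence with thick delays only: one with as many non-integer delays as possible
(`exists_thickAt_of_thickPath`). If all its delays are thick, then the cell of a sequence is open in
the polyhedron of the path (`eventually_mem_cell`). Therefore the cylinders of small neighbourhoods of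
such sequences form a pseudo-base of the space of runs (`exists_isolating_cyl_subset`). It follows
that the runs with a delay that is not thick form a meagre set. Conversely, the runs with thick
delays are a `Gδ` set in a Polish space, hence a Baire space, whose topology has the same
pseudo-base, so the cylinders in question are not meagre (`Isolates.not_isMeagre`). A violation of a
safety property on one run with thick delays is a violation on such a cylinder.

Probability. The law of the delay is equivalent to Lebesgue measure on the possible delays if one of
them avoids the integers, and otherwise to the uniform law. So almost every delay is thick
(`ae_thickDelay`), and every edge of the thick graph is followed with positive probability
(`outKernel_ne_zero`). The same is true for the finite Markov chain, by definition. In both cases, a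
path in the thick graph that violates a safety property has a bad prefix, of positive probability.
-/

namespace STA

open Filter Topology

/-! ### Regions as systems of difference constraints -/

section Regions

variable {X : Type*} {K : ℕ} {v v' : Val X} {t t' : ℝ≥0}

theorem fract_coe_eq_sub (a : ℝ≥0) : Int.fract (a : ℝ) = a - (⌊a⌋₊ : ℝ) := by
  have h : ⌊(a : ℝ)⌋₊ = ⌊a⌋₊ := rfl
  rw [← h, Int.fract, natCast_floor_eq_intCast_floor a.coe_nonneg]

theorem fract_coe_eq_zero_iff (a : ℝ≥0) : Int.fract (a : ℝ) = 0 ↔ (a : ℝ) ≤ ⌊a⌋₊ := by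
  have h := Int.fract_nonneg (a : ℝ)
  rw [fract_coe_eq_sub] at *
  constructor <;> intro h' <;> linarith

/-- The equivalence of valuations expressed by the truth values of all the linear constraints
`x ≤ n`, `n ≤ x` with `n ≤ K`, and `x - y ≤ m` with `m : ℤ` for clocks `x, y` of value at
most `K`. It coincides with region equivalence, see `regionEquiv_iff_diffEquiv`. -/
def DiffEquiv (K : ℕ) (v v' : Val X) : Prop :=
  (∀ x, ∀ n : ℕ, n ≤ K → (((v x : ℝ) ≤ n ↔ (v' x : ℝ) ≤ n) ∧ ((n : ℝ) ≤ v x ↔ (n : ℝ) ≤ v' x))) ∧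
  ∀ x y, (v x : ℝ) ≤ K → (v y : ℝ) ≤ K → ∀ m : ℤ,
    ((v x : ℝ) - v y ≤ m ↔ (v' x : ℝ) - v' y ≤ m)

theorem DiffEquiv.floor_eq (h : DiffEquiv K v v') {x : X} (hx : (v x : ℝ) ≤ K) :
    ⌊v x⌋₊ = ⌊v' x⌋₊ := by
  symm
  have hn : ((⌊v x⌋₊ : ℕ) : ℝ) ≤ v x := by exact_mod_cast Nat.floor_le (zero_le : 0 ≤ v x)
  have hlt : (v x : ℝ) < (⌊v x⌋₊ : ℕ) + 1 := by exact_mod_cast Nat.lt_floor_add_one (v x)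
  have hnK : ⌊v x⌋₊ ≤ K := by
    have : ((⌊v x⌋₊ : ℕ) : ℝ) ≤ K := hn.trans hx
    exact_mod_cast this
  rw [Nat.floor_eq_iff zero_le]
  refine ⟨by exact_mod_cast (h.1 x _ hnK).2.1 hn, ?_⟩
  suffices (v' x : ℝ) < (⌊v x⌋₊ : ℕ) + 1 by exact_mod_cast this
  rcases hnK.lt_or_eq with hlt' | heq
  · by_contra hc
    have := (h.1 x (⌊v x⌋₊ + 1) hlt').2.2 (by push_cast; linarith)
    push_cast at this
    linarith
  · have := (h.1 x K le_rfl).1.1 hx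
    rw [heq]; linarith

theorem DiffEquiv.regionEquiv (h : DiffEquiv K v v') : RegionEquiv K v v' := by
  refine ⟨fun x => ?_, fun x y hx hy => ?_⟩
  · rcases le_or_gt (v x : ℝ) K with hx | hx
    · right
      have hf := h.floor_eq hx
      refine ⟨hf, ?_⟩
      rw [fract_coe_eq_zero_iff, fract_coe_eq_zero_iff, ← hf]
      refine (h.1 x _ ?_).1
      have hn : ((⌊v x⌋₊ : ℕ) : ℝ) ≤ v x := by exact_mod_cast Nat.floor_le (zero_le : 0 ≤ v x)
      exact_mod_cast hn.trans hx
    · left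
      have := mt (h.1 x K le_rfl).1.2 (not_le.2 hx)
      exact ⟨by exact_mod_cast hx, by exact_mod_cast not_le.1 this⟩
  · have hx : (v x : ℝ) ≤ K := by exact_mod_cast hx
    have hy : (v y : ℝ) ≤ K := by exact_mod_cast hy
    have := h.2 x y hx hy ((⌊v x⌋₊ : ℤ) - ⌊v y⌋₊)
    simp only [fract_coe_eq_sub, ← h.floor_eq hx, ← h.floor_eq hy]
    push_cast at this
    constructor <;> intro h1
    · have := this.1 (by linarith); linarith
    · have := this.2 (by linarith); linarith

theorem RegionEquiv.diffEquiv (h : RegionEquiv K v v') : DiffEquiv K v v' := by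
  have hfl : ∀ x, (v x : ℝ) ≤ K → ⌊v x⌋₊ = ⌊v' x⌋₊ ∧
      (Int.fract (v x : ℝ) = 0 ↔ Int.fract (v' x : ℝ) = 0) := by
    intro x hx
    refine (h.1 x).resolve_left fun h' => ?_
    have : (K : ℝ) < v x := by exact_mod_cast h'.1
    linarith
  refine ⟨fun x n hn => ?_, fun x y hx hy m => ?_⟩
  · have hnK : (n : ℝ) ≤ K := by exact_mod_cast hn
    rcases h.1 x with ⟨h1, h2⟩ | ⟨h1, h2⟩
    · have h1 : (K : ℝ) < v x := by exact_mod_cast h1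
      have h2 : (K : ℝ) < v' x := by exact_mod_cast h2
      exact ⟨⟨fun _ => by linarith, fun _ => by linarith⟩,
        ⟨fun _ => by linarith, fun _ => by linarith⟩⟩
    · have key : ∀ a b : ℝ≥0, ⌊a⌋₊ = ⌊b⌋₊ → (Int.fract (a : ℝ) = 0 → Int.fract (b : ℝ) = 0) →
          (a : ℝ) ≤ n → (b : ℝ) ≤ n := by
        intro a b hab hf ha
        have h3 : ⌊a⌋₊ ≤ n := Nat.floor_le_of_le (by exact_mod_cast ha)
        rcases h3.lt_or_eq with h3 | h3
        · have h4 : (b : ℝ) < (⌊b⌋₊ : ℕ) + 1 := by exact_mod_cast Nat.lt_floor_add_one b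
          have h5 : ((⌊b⌋₊ : ℕ) : ℝ) + 1 ≤ n := by rw [← hab]; exact_mod_cast h3
          linarith
        · rw [fract_coe_eq_zero_iff, fract_coe_eq_zero_iff, ← hab, h3] at hf
          exact hf ha
      refine ⟨⟨key _ _ h1 h2.1, key _ _ h1.symm h2.2⟩, ?_⟩
      have h3 : ∀ a : ℝ≥0, ((n : ℝ) ≤ a ↔ n ≤ ⌊a⌋₊) := fun a => by
        rw [Nat.le_floor_iff zero_le]; exact_mod_cast Iff.rfl
      rw [h3, h3, h1]
  · obtain ⟨h1, -⟩ := hfl x hx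
    obtain ⟨h2, -⟩ := hfl y hy
    have h3 := h.2 x y (by exact_mod_cast hx) (by exact_mod_cast hy)
    have e : ∀ a : ℝ≥0, (a : ℝ) = (⌊a⌋₊ : ℝ) + Int.fract (a : ℝ) := fun a => by
      rw [fract_coe_eq_sub]; ring
    have p : ∀ a : ℝ≥0, 0 ≤ Int.fract (a : ℝ) ∧ Int.fract (a : ℝ) < 1 := fun a =>
      ⟨Int.fract_nonneg _, Int.fract_lt_one _⟩
    rw [e (v x), e (v y), e (v' x), e (v' y), ← h1, ← h2]
    -- only the integer `m - ⌊v x⌋ + ⌊v y⌋` and the order of the fractional parts matter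
    have hm : ∀ α β : ℝ, 0 ≤ α ∧ α < 1 → 0 ≤ β ∧ β < 1 →
        ((⌊v x⌋₊ : ℝ) + α - ((⌊v y⌋₊ : ℝ) + β) ≤ m ↔
          (1 ≤ m - (⌊v x⌋₊ : ℤ) + ⌊v y⌋₊ ∨ (m - (⌊v x⌋₊ : ℤ) + ⌊v y⌋₊ = 0 ∧ α ≤ β))) := by
      intro α β hα hβ
      have hc : ((m - (⌊v x⌋₊ : ℤ) + ⌊v y⌋₊ : ℤ) : ℝ) = m - ⌊v x⌋₊ + ⌊v y⌋₊ := by push_cast; ring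
      generalize (m - (⌊v x⌋₊ : ℤ) + ⌊v y⌋₊ : ℤ) = j at *
      constructor
      · intro h4
        have h5 : (-1 : ℝ) < j := by rw [hc]; linarith
        have h6 : -1 < j := by exact_mod_cast h5
        rcases (show 0 ≤ j by omega).lt_or_eq with h7 | h7
        · left; omega
        · right
          refine ⟨h7.symm, ?_⟩
          rw [← h7] at hc; push_cast at hc; linarith
      · rintro (h4 | ⟨h4, h5⟩)
        · have : (1 : ℝ) ≤ j := by exact_mod_cast h4
          linarith
        · rw [h4] at hc; push_cast at hc; linarith
    rw [hm _ _ (p _) (p _), hm _ _ (p _) (p _), h3]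

theorem regionEquiv_iff_diffEquiv : RegionEquiv K v v' ↔ DiffEquiv K v v' :=
  ⟨RegionEquiv.diffEquiv, DiffEquiv.regionEquiv⟩

theorem RegionEquiv.refl (v : Val X) : RegionEquiv K v v := (regionSetoid X K).refl v

theorem RegionEquiv.symm (h : RegionEquiv K v v') : RegionEquiv K v' v := (regionSetoid X K).symm h

theorem regionOf_eq_iff : regionOf K v = regionOf K v' ↔ RegionEquiv K v v' :=
  ⟨fun h => Quotient.exact (s := regionSetoid X K) h,
    fun h => Quotient.sound (s := regionSetoid X K) h⟩

theorem exists_regionOf_eq (r : Region X K) : ∃ v, regionOf K v = r := Quotient.exists_rep r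

@[simp] theorem delay_zero (v : Val X) : delay v 0 = v := by
  ext x; simp [delay]

theorem coe_delay (v : Val X) (t : ℝ≥0) (x : X) : ((delay v t x : ℝ≥0) : ℝ) = v x + t := by
  simp [delay]

/-- No clock has an integer value in `[0, K]`. Such a region is left only after a positive time. -/
def NoInt (K : ℕ) (v : Val X) : Prop := ∀ x, ∀ n : ℕ, n ≤ K → (v x : ℝ) ≠ n

theorem RegionEquiv.eq_natCast (h : RegionEquiv K v v') {x : X} {n : ℕ} (hn : n ≤ K)
    (hx : (v x : ℝ) = n) : (v' x : ℝ) = n := by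
  obtain ⟨h1, h2⟩ := h.diffEquiv.1 x n hn
  exact le_antisymm (h1.1 hx.le) (h2.1 hx.ge)

theorem RegionEquiv.noInt (h : RegionEquiv K v v') (hv : NoInt K v) : NoInt K v' :=
  fun x n hn hx => hv x n hn (h.symm.eq_natCast hn hx)

theorem RegionEquiv.noInt_iff (h : RegionEquiv K v v') : NoInt K v ↔ NoInt K v' :=
  ⟨h.noInt, h.symm.noInt⟩

theorem RegionEquiv.resetTo (h : RegionEquiv K v v') (Y : Set X) :
    RegionEquiv K (resetTo Y v) (resetTo Y v') := by
  have h0 : ((0 : ℝ≥0) : ℝ) = ((0 : ℕ) : ℝ) := by simp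
  replace h := h.diffEquiv
  refine DiffEquiv.regionEquiv ⟨fun x n hn => ?_, fun x y hx hy m => ?_⟩
  · unfold STA.resetTo
    split_ifs
    · exact ⟨Iff.rfl, Iff.rfl⟩
    · exact h.1 x n hn
  · unfold STA.resetTo at *
    -- for a reset clock the difference constraint is a constraint on a single clock
    have side : ∀ z, (v z : ℝ) ≤ K → ∀ m : ℤ, ((v z : ℝ) ≤ m ↔ (v' z : ℝ) ≤ m) ∧
        ((m : ℝ) ≤ v z ↔ (m : ℝ) ≤ v' z) := by
      intro z hz m
      have hz' := (h.1 z K le_rfl).1.1 hz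
      rcases lt_or_ge m 0 with hm | hm
      · have hm' : (m : ℝ) < 0 := by exact_mod_cast hm
        have h1 := (v z).coe_nonneg
        have h2 := (v' z).coe_nonneg
        exact ⟨⟨fun _ => by linarith, fun _ => by linarith⟩,
          ⟨fun _ => by linarith, fun _ => by linarith⟩⟩
      · lift m to ℕ using hm
        rcases le_or_gt m K with hmK | hmK
        · exact_mod_cast h.1 z m hmK
        · have hmK : (K : ℝ) < m := by exact_mod_cast hmK
          push_cast
          exact ⟨⟨fun _ => by linarith, fun _ => by linarith⟩,
            ⟨fun _ => by linarith, fun _ => by linarith⟩⟩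
    split_ifs at * with h1 h2
    · exact Iff.rfl
    · have := (side y hy (-m)).2
      push_cast at this ⊢
      constructor <;> intro h3
      · have := this.1 (by linarith); linarith
      · have := this.2 (by linarith); linarith
    · have := (side x hx m).1
      push_cast at this ⊢
      simpa using this
    · exact h.2 x y hx hy m

theorem RegionEquiv.mem_guardSet (h : RegionEquiv K v v') {g : Guard X} (hg : guardMax g ≤ K)
    (hv : v ∈ guardSet g) : v' ∈ guardSet g := by
  intro c hc
  have hcK : c.const ≤ K := by
    refine le_trans ?_ hg
    unfold guardMax
    clear hv hg
    induction g with
    | nil => simp at hc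
    | cons a g ih =>
      simp only [List.map_cons, List.foldr_cons]
      rcases List.mem_cons.1 hc with rfl | hc
      · exact le_max_left _ _
      · exact (ih hc).trans (le_max_right _ _)
  have h1 := (h.diffEquiv.1 c.clock c.const hcK).1
  have h2 := (h.diffEquiv.1 c.clock c.const hcK).2
  have h1 : v c.clock ≤ c.const ↔ v' c.clock ≤ c.const := by exact_mod_cast h1
  have h2 : (c.const : ℝ≥0) ≤ v c.clock ↔ (c.const : ℝ≥0) ≤ v' c.clock := by exact_mod_cast h2
  have := hv c hc
  rcases c with ⟨x, _ | _ | _ | _ | _, k⟩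
  · simp only [Cmp.Holds] at *; rw [← not_le] at *; rwa [← h2]
  · simp only [Cmp.Holds] at *; rwa [← h1]
  · simp only [Cmp.Holds] at *; exact le_antisymm (h1.1 this.le) (h2.1 this.ge)
  · simp only [Cmp.Holds] at *; rwa [← h2]
  · simp only [Cmp.Holds] at *; rw [← not_le] at *; rwa [← h1]

/-- Guards define convex sets. -/
theorem convexComb_mem_guardSet {g : Guard X} (hv : v ∈ guardSet g) (hv' : v' ∈ guardSet g)
    {a b : ℝ≥0} (hab : a + b = 1) : (fun x => a * v x + b * v' x) ∈ guardSet g := by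
  intro c hc
  have h1 := hv c hc
  have h2 := hv' c hc
  have hk : (c.const : ℝ≥0) = a * c.const + b * c.const := by rw [← add_mul, hab, one_mul]
  have hpos : 0 < a ∨ 0 < b := by
    by_contra hn
    push Not at hn
    have ha : a = 0 := le_antisymm hn.1 zero_le
    have hb : b = 0 := le_antisymm hn.2 zero_le
    simp [ha, hb] at hab
  rcases c with ⟨x, _ | _ | _ | _ | _, k⟩ <;> simp only [Cmp.Holds] at * <;> rw [hk]
  · rcases hpos with h | h
    · exact add_lt_add_of_lt_of_le (mul_lt_mul_of_pos_left h1 h) (by gcongr)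
    · exact add_lt_add_of_le_of_lt (by gcongr) (mul_lt_mul_of_pos_left h2 h)
  · gcongr
  · rw [h1, h2]
  · gcongr
  · rcases hpos with h | h
    · exact add_lt_add_of_lt_of_le (mul_lt_mul_of_pos_left h1 h) (by gcongr)
    · exact add_lt_add_of_le_of_lt (by gcongr) (mul_lt_mul_of_pos_left h2 h)

/-- A guard that holds now and after the delay `t` holds all the time in between, so the invariants
have to be checked at the end points of a delay only. -/
theorem delay_mem_guardSet_of_le {g : Guard X} (hv : v ∈ guardSet g) (hv' : delay v t ∈ guardSet g)
    (ht : t' ≤ t) : delay v t' ∈ guardSet g := by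
  intro c hc
  have h1 := hv c hc
  have h2 := hv' c hc
  have h3 : v c.clock ≤ delay v t' c.clock := by simp [delay]
  have h4 : delay v t' c.clock ≤ delay v t c.clock := by simp [delay, ht]
  rcases c with ⟨x, _ | _ | _ | _ | _, k⟩ <;> simp only [Cmp.Holds] at *
  · exact h4.trans_lt h2
  · exact h4.trans h2
  · exact le_antisymm (h4.trans h2.le) (h1.ge.trans h3)
  · exact h1.trans h3
  · exact h1.trans_le h3

/-! ### Delay successors of regions -/

/-- Region equivalence of two valuations is preserved by delays after which some clock has the same
value `n ≤ K`. -/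
theorem RegionEquiv.delay_of_eq (h : RegionEquiv K v v') {y : X} {n : ℕ} (hn : n ≤ K)
    (hy : (v y : ℝ) + t = n) (hy' : (v' y : ℝ) + t' = n) :
    RegionEquiv K (delay v t) (delay v' t') := by
  replace h := h.diffEquiv
  have hnK : (n : ℝ) ≤ K := by exact_mod_cast hn
  have ht := t.coe_nonneg
  have ht' := t'.coe_nonneg
  have hyK : (v y : ℝ) ≤ K := by linarith
  refine DiffEquiv.regionEquiv ⟨fun x k hk => ?_, fun x z hx hz m => ?_⟩
  · have hkK : (k : ℝ) ≤ K := by exact_mod_cast hk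
    simp only [coe_delay]
    rcases le_or_gt (v x : ℝ) K with hx | hx
    · have h1 := h.2 x y hx hyK ((k : ℤ) - n)
      have h2 := h.2 y x hyK hx ((n : ℤ) - k)
      push_cast at h1 h2
      refine ⟨⟨fun h3 => ?_, fun h3 => ?_⟩, ⟨fun h3 => ?_, fun h3 => ?_⟩⟩
      · have := h1.1 (by linarith); linarith
      · have := h1.2 (by linarith); linarith
      · have := h2.1 (by linarith); linarith
      · have := h2.2 (by linarith); linarith
    · have hx' := not_le.1 (mt (h.1 x K le_rfl).1.2 (not_le.2 hx))
      exact ⟨⟨fun _ => by linarith, fun _ => by linarith⟩,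
        ⟨fun _ => by linarith, fun _ => by linarith⟩⟩
  · simp only [coe_delay] at *
    have := h.2 x z (by linarith) (by linarith) m
    constructor <;> intro h3
    · have := this.1 (by linarith); linarith
    · have := this.2 (by linarith); linarith

/-- Region equivalence of two valuations is preserved by delays after which all clocks lie in the
same open unit intervals (or are beyond `K`). -/
theorem RegionEquiv.delay_of_floor (h : RegionEquiv K v v')
    (h1 : ∀ x, (v x : ℝ) + t ≤ K → (⌊v x + t⌋₊ : ℝ) < v x + t ∧
      (⌊v x + t⌋₊ : ℝ) < v' x + t' ∧ (v' x : ℝ) + t' < ⌊v x + t⌋₊ + 1)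
    (h2 : ∀ x, (K : ℝ) < v x + t → (K : ℝ) < v' x + t') :
    RegionEquiv K (delay v t) (delay v' t') := by
  replace h := h.diffEquiv
  have ht := t.coe_nonneg
  refine DiffEquiv.regionEquiv ⟨fun x k hk => ?_, fun x z hx hz m => ?_⟩
  · have hkK : (k : ℝ) ≤ K := by exact_mod_cast hk
    simp only [coe_delay]
    rcases le_or_gt ((v x : ℝ) + t) K with hx | hx
    · obtain ⟨a1, a2, a3⟩ := h1 x hx
      have a4 : ((v x : ℝ) + t) < ⌊v x + t⌋₊ + 1 := by
        exact_mod_cast Nat.lt_floor_add_one (v x + t)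
      generalize ⌊v x + t⌋₊ = N at *
      rcases le_or_gt k N with hkN | hkN
      · have : (k : ℝ) ≤ N := by exact_mod_cast hkN
        exact ⟨⟨fun _ => by linarith, fun _ => by linarith⟩,
          ⟨fun _ => by linarith, fun _ => by linarith⟩⟩
      · have : (N : ℝ) + 1 ≤ k := by exact_mod_cast hkN
        exact ⟨⟨fun _ => by linarith, fun _ => by linarith⟩,
          ⟨fun _ => by linarith, fun _ => by linarith⟩⟩
    · have hx' := h2 x hx
      exact ⟨⟨fun _ => by linarith, fun _ => by linarith⟩,
        ⟨fun _ => by linarith, fun _ => by linarith⟩⟩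
  · simp only [coe_delay] at *
    have := h.2 x z (by linarith) (by linarith) m
    constructor <;> intro h3
    · have := this.1 (by linarith); linarith
    · have := this.2 (by linarith); linarith

theorem NoInt.floor_lt (h : NoInt K (delay v t)) {x : X} (hx : (v x : ℝ) + t ≤ K) :
    (⌊v x + t⌋₊ : ℝ) < v x + t := by
  have h1 : (⌊v x + t⌋₊ : ℝ) ≤ v x + t := by
    exact_mod_cast Nat.floor_le (zero_le : 0 ≤ v x + t)
  refine h1.lt_of_ne fun h2 => h x ⌊v x + t⌋₊ (by exact_mod_cast h1.trans hx) ?_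
  rw [coe_delay, h2]

theorem not_noInt_iff : ¬ NoInt K v ↔ ∃ x, ∃ n : ℕ, n ≤ K ∧ (v x : ℝ) = n := by
  unfold NoInt; push Not; rfl

/-- Delay successors: if `v` and `v'` are in the same region, then the regions reached from `v` by
delays are also reached from `v'`. -/
theorem RegionEquiv.exists_delay [Finite X] (h : RegionEquiv K v v') (t : ℝ≥0) :
    ∃ t', RegionEquiv K (delay v t) (delay v' t') := by
  classical
  have := Fintype.ofFinite X
  have ht := t.coe_nonneg
  by_cases hI : NoInt K (delay v t)
  · -- the delay `t'` has to satisfy finitely many strict bounds; each lower bound is less than each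
    -- upper bound since this is so for `v`, and since it is a difference constraint
    have hd := h.diffEquiv
    let S : Finset X := Finset.univ.filter fun x => (v x : ℝ) + t ≤ K
    let hi : Finset ℝ := S.image fun x => (⌊v x + t⌋₊ : ℝ) + 1 - v' x
    let lo : Finset ℝ := insert 0 (S.image (fun x => (⌊v x + t⌋₊ : ℝ) - v' x) ∪
      (Finset.univ.filter fun x => (K : ℝ) < v x + t).image fun x => (K : ℝ) - v' x)
    have hlt : ∀ x : X, ((v x : ℝ) + t) < ⌊v x + t⌋₊ + 1 := fun x => by
      exact_mod_cast Nat.lt_floor_add_one (v x + t)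
    have hle : ∀ x : X, (⌊v x + t⌋₊ : ℝ) ≤ v x + t := fun x => by
      exact_mod_cast Nat.floor_le (zero_le : 0 ≤ v x + t)
    have hfK : ∀ x : X, (v x : ℝ) + t ≤ K → ⌊v x + t⌋₊ + 1 ≤ K := by
      intro x hx
      have h1 : (⌊v x + t⌋₊ : ℝ) < K := (hI.floor_lt hx).trans_le hx
      exact_mod_cast h1
    obtain ⟨r, hr1, hr2⟩ := Order.exists_between_finsets lo hi (by
      intro a ha b hb
      simp only [hi, lo, S, Finset.mem_insert, Finset.mem_union, Finset.mem_image,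
        Finset.mem_filter, Finset.mem_univ, true_and] at ha hb
      obtain ⟨y, hy, rfl⟩ := hb
      have hy1 := hlt y
      have hyy : (v y : ℝ) ≤ K := by linarith
      rcases ha with rfl | ⟨x, hx, rfl⟩ | ⟨x, hx, rfl⟩
      · have := mt (hd.1 y _ (hfK y hy)).2.2 (by push_cast; linarith)
        push_cast at this
        linarith
      · have h3 := hI.floor_lt hx
        by_contra hc
        have h9 := (hd.2 x y (by linarith) hyy (-(⌊v y + t⌋₊ + 1 - ⌊v x + t⌋₊))).2
        push_cast at h9
        have := h9 (by linarith)
        linarith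
      · rcases le_or_gt (v x : ℝ) K with hxK | hxK
        · by_contra hc
          have h9 := (hd.2 x y hxK hyy (-(⌊v y + t⌋₊ + 1 - K))).2
          push_cast at h9
          have := h9 (by linarith)
          linarith
        · have hx' := not_le.1 (mt (hd.1 x K le_rfl).1.2 (not_le.2 hxK))
          have := mt (hd.1 y _ (hfK y hy)).2.2 (by push_cast; linarith)
          push_cast at this
          linarith)
    have hr0 : 0 < r := hr1 0 (by simp [lo])
    lift r to ℝ≥0 using hr0.le
    refine ⟨r, h.delay_of_floor (fun x hx => ⟨hI.floor_lt hx, ?_, ?_⟩) fun x hx => ?_⟩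
    · have := hr1 ((⌊v x + t⌋₊ : ℝ) - v' x) (by
        simp only [lo, S, Finset.mem_insert, Finset.mem_union, Finset.mem_image,
          Finset.mem_filter, Finset.mem_univ, true_and]
        exact Or.inr (Or.inl ⟨x, hx, rfl⟩))
      linarith
    · have := hr2 ((⌊v x + t⌋₊ : ℝ) + 1 - v' x) (by
        simp only [hi, S, Finset.mem_image, Finset.mem_filter, Finset.mem_univ, true_and]
        exact ⟨x, hx, rfl⟩)
      linarith
    · have := hr1 ((K : ℝ) - v' x) (by
        simp only [lo, Finset.mem_insert, Finset.mem_union, Finset.mem_image,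
          Finset.mem_filter, Finset.mem_univ, true_and]
        exact Or.inr (Or.inr ⟨x, hx, rfl⟩))
      linarith
  · obtain ⟨y, n, hn, hy⟩ := not_noInt_iff.1 hI
    rw [coe_delay] at hy
    have h1 := (h.diffEquiv.1 y n hn).1.1 (by linarith)
    obtain ⟨t', ht'⟩ : ∃ t' : ℝ≥0, (t' : ℝ) = n - v' y := ⟨⟨n - v' y, by linarith⟩, rfl⟩
    exact ⟨t', h.delay_of_eq hn hy (by rw [ht']; ring)⟩

theorem continuous_delay : Continuous fun p : Val X × ℝ≥0 => delay p.1 p.2 := by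
  unfold delay; fun_prop

/-- A region without integer clocks is stable under small changes of the delay, and of the
valuation within its region. -/
theorem NoInt.eventually_regionEquiv [Finite X] (h : NoInt K (delay v t)) :
    ∀ᶠ p : Val X × ℝ≥0 in 𝓝 (v, t), RegionEquiv K v p.1 →
      RegionEquiv K (delay v t) (delay p.1 p.2) := by
  have hc : ∀ x : X, Tendsto (fun p : Val X × ℝ≥0 => ((p.1 x : ℝ) + p.2)) (𝓝 (v, t))
      (𝓝 ((v x : ℝ) + t)) := fun x => by
    refine Continuous.tendsto ?_ (v, t)
    fun_prop
  have h1 : ∀ᶠ p : Val X × ℝ≥0 in 𝓝 (v, t), ∀ x, (v x : ℝ) + t ≤ K →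
      (⌊v x + t⌋₊ : ℝ) < p.1 x + p.2 ∧ (p.1 x : ℝ) + p.2 < ⌊v x + t⌋₊ + 1 := by
    refine eventually_all.2 fun x => ?_
    by_cases hx : (v x : ℝ) + t ≤ K
    · have hlt : ((v x : ℝ) + t) < ⌊v x + t⌋₊ + 1 := by
        exact_mod_cast Nat.lt_floor_add_one (v x + t)
      filter_upwards [(hc x).eventually_const_lt (h.floor_lt hx),
        (hc x).eventually_lt_const hlt] with p h3 h4 _ using ⟨h3, h4⟩
    · simp [hx]
  have h2 : ∀ᶠ p : Val X × ℝ≥0 in 𝓝 (v, t), ∀ x, (K : ℝ) < v x + t → (K : ℝ) < p.1 x + p.2 := by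
    refine eventually_all.2 fun x => ?_
    by_cases hx : (K : ℝ) < v x + t
    · filter_upwards [(hc x).eventually_const_lt hx] with p h3 _ using h3
    · simp [hx]
  filter_upwards [h1, h2] with p h1 h2 h3
  exact h3.delay_of_floor (fun x hx => ⟨h.floor_lt hx, h1 x hx⟩) h2

/-- Having no integer clock is an open condition. -/
theorem NoInt.eventually [Finite X] (h : NoInt K v) : ∀ᶠ v' in 𝓝 v, NoInt K v' := by
  unfold NoInt
  refine eventually_all.2 fun x => ?_
  have : ∀ᶠ v' : Val X in 𝓝 v, ∀ n ∈ Finset.range (K + 1), (v' x : ℝ) ≠ n := by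
    rw [Filter.eventually_all_finset]
    intro n hn
    have hc : Continuous fun v' : Val X => (v' x : ℝ) := by fun_prop
    exact hc.continuousAt.eventually_ne (h x n (Nat.lt_succ_iff.1 (Finset.mem_range.1 hn)))
  filter_upwards [this] with v' h1 n hn using h1 n (Finset.mem_range.2 (Nat.lt_succ_of_le hn))

/-- Delay successors depend continuously on the valuation within its region. -/
theorem eventually_exists_delay [Finite X] (v : Val X) {T : Set ℝ≥0} (hT : T ∈ 𝓝 t) :
    ∀ᶠ v' in 𝓝 v, RegionEquiv K v v' → ∃ t' ∈ T, RegionEquiv K (delay v t) (delay v' t') := by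
  by_cases hI : NoInt K (delay v t)
  · have h1 := hI.eventually_regionEquiv
    rw [nhds_prod_eq] at h1
    filter_upwards [h1.curry] with v' h2 h3
    exact ⟨t, mem_of_mem_nhds hT, h2.self_of_nhds h3⟩
  · obtain ⟨y, n, hn, hy⟩ := not_noInt_iff.1 hI
    rw [coe_delay] at hy
    have hc : Tendsto (fun v' : Val X => (n : ℝ≥0) - v' y) (𝓝 v) (𝓝 t) := by
      have h1 : (n : ℝ≥0) - v y = t := by
        have : v y + t = n := by exact_mod_cast hy
        rw [← this]; simp
      rw [← h1]
      refine Continuous.tendsto ?_ v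
      fun_prop
    filter_upwards [hc hT] with v' h2 h3
    refine ⟨_, h2, h3.delay_of_eq hn hy ?_⟩
    have h4 : v' y ≤ n := by
      have := (h3.diffEquiv.1 y n hn).1.1 (by have := t.coe_nonneg; linarith)
      exact_mod_cast this
    rw [NNReal.coe_sub h4]; push_cast; ring

/-- If close valuations `v, v'` of the same region are followed by close delays `t, t'`, and if
`v' + t'` has an integer clock, then `v + t` and `v' + t'` are in the same region. -/
theorem eventually_regionEquiv_of_not_noInt [Finite X] (v : Val X) (t : ℝ≥0) :
    ∀ᶠ p : Val X × ℝ≥0 in 𝓝 (v, t), RegionEquiv K v p.1 → ¬ NoInt K (delay p.1 p.2) →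
      RegionEquiv K (delay v t) (delay p.1 p.2) := by
  -- close to `(v, t)`, a clock can only have an integer value that it has at `v + t`
  have : ∀ᶠ p : Val X × ℝ≥0 in 𝓝 (v, t), ∀ x, ∀ n ∈ Finset.range (K + 1),
      (v x : ℝ) + t ≠ n → (p.1 x : ℝ) + p.2 ≠ n := by
    refine eventually_all.2 fun x => ?_
    rw [Filter.eventually_all_finset]
    intro n _
    by_cases hx : (v x : ℝ) + t = n
    · simp [hx]
    · have hc : ContinuousAt (fun p : Val X × ℝ≥0 => ((p.1 x : ℝ) + p.2)) (v, t) := by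
        refine Continuous.continuousAt ?_
        fun_prop
      filter_upwards [hc.eventually_ne hx] with p h3 _ using h3
  filter_upwards [this] with p h1 h2 h3
  obtain ⟨y, n, hn, hy⟩ := not_noInt_iff.1 h3
  rw [coe_delay] at hy
  refine h2.delay_of_eq hn ?_ hy
  by_contra hc
  exact h1 y n (Finset.mem_range.2 (Nat.lt_succ_of_le hn)) hc hy

/-! ### Topology and measurability of regions -/

/-- A region is given by countably many constraints. -/
theorem diffEquiv_iff_forall : DiffEquiv K v v' ↔
    (∀ x, ∀ n : Fin (K + 1), (((v x : ℝ) ≤ (n : ℕ) ↔ (v' x : ℝ) ≤ (n : ℕ)) ∧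
      (((n : ℕ) : ℝ) ≤ v x ↔ ((n : ℕ) : ℝ) ≤ v' x))) ∧
    ∀ x y, ∀ m : ℤ, (v x : ℝ) ≤ K → (v y : ℝ) ≤ K →
      ((v x : ℝ) - v y ≤ m ↔ (v' x : ℝ) - v' y ≤ m) := by
  unfold DiffEquiv
  refine and_congr ⟨fun h x n => h x n (Nat.lt_succ_iff.1 n.2),
    fun h x n hn => h x ⟨n, Nat.lt_succ_of_le hn⟩⟩ ?_
  exact ⟨fun h x y m hx hy => h x y hx hy m, fun h x y hx hy m => h x y m hx hy⟩

theorem isGδ_setOf_iff_le {Y : Type*} [TopologicalSpace Y]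
    [TopologicalSpace.PseudoMetrizableSpace Y]
    {p : Prop} {f g : Y → ℝ} (hf : Continuous f) (hg : Continuous g) :
    IsGδ {y | p ↔ f y ≤ g y} := by
  by_cases hp : p
  · simp only [hp, true_iff]
    exact (isClosed_le hf hg).isGδ
  · simp only [hp, false_iff, not_le]
    exact (isOpen_lt hg hf).isGδ

theorem isGδ_regionEquiv [Finite X] (v : Val X) : IsGδ {v' | RegionEquiv K v v'} := by
  have : {v' | RegionEquiv K v v'} =
      (⋂ x, ⋂ n : Fin (K + 1), {v' : Val X | ((v x : ℝ) ≤ (n : ℕ) ↔ (v' x : ℝ) ≤ (n : ℕ))} ∩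
        {v' | (((n : ℕ) : ℝ) ≤ v x ↔ ((n : ℕ) : ℝ) ≤ v' x)}) ∩
      ⋂ x, ⋂ y, ⋂ m : ℤ, {v' : Val X | (v x : ℝ) ≤ K → (v y : ℝ) ≤ K →
        ((v x : ℝ) - v y ≤ m ↔ (v' x : ℝ) - v' y ≤ m)} := by
    ext v'
    simp only [mem_ofPred_eq, regionEquiv_iff_diffEquiv, diffEquiv_iff_forall, mem_inter_iff,
      mem_iInter]
  rw [this]
  refine IsGδ.inter (.iInter fun x => .iInter fun n => .inter ?_ ?_)
    (.iInter fun x => .iInter fun y => .iInter fun m => ?_)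
  · exact isGδ_setOf_iff_le (by fun_prop) (by fun_prop)
  · exact isGδ_setOf_iff_le (by fun_prop) (by fun_prop)
  · by_cases hx : (v x : ℝ) ≤ K
    · by_cases hy : (v y : ℝ) ≤ K
      · simp only [hx, hy, true_imp_iff]
        exact isGδ_setOf_iff_le (by fun_prop) (by fun_prop)
      · simp [hy, IsGδ.univ]
    · simp [hx, IsGδ.univ]

theorem measurableSet_regionEquiv [Finite X] (v : Val X) :
    MeasurableSet {v' | RegionEquiv K v v'} := (isGδ_regionEquiv v).measurableSet

end Regions

/-! ### Dimension of sets of delays -/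

section Dim

theorem isometry_nnreal_coe : Isometry (NNReal.toReal) := Isometry.of_dist_eq fun _ _ => rfl

theorem dim_of_nonempty {α : Type*} [EMetricSpace α] {S : Set α} (h : S.Nonempty) :
    dim S = ((dimH S : ℝ≥0∞) : WithBot ℝ≥0∞) := by
  unfold dim
  rw [if_neg h.ne_empty]

theorem dim_lt_dim_iff {α β : Type*} [EMetricSpace α] [EMetricSpace β] {S : Set α} {T : Set β}
    (h : S.Nonempty) : dim S < dim T ↔ dimH S < dimH T := by
  rw [dim_of_nonempty h]
  rcases T.eq_empty_or_nonempty with rfl | hT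
  · simp [dim]
  · rw [dim_of_nonempty hT, WithBot.coe_lt_coe]

theorem dimH_nnreal_le_one (S : Set ℝ≥0) : dimH S ≤ 1 := by
  rw [← isometry_nnreal_coe.dimH_image, ← Real.dimH_univ]
  exact dimH_mono (subset_univ _)

/-- Every neighbourhood in `ℝ≥0` contains an interval of positive length. -/
theorem exists_Ioo_subset_of_mem_nhds {t : ℝ≥0} {S : Set ℝ≥0} (h : S ∈ 𝓝 t) :
    ∃ a b, a < b ∧ Ioo a b ⊆ S := by
  have h1 : ∀ᶠ b in 𝓝[>] t, Icc t b ⊆ S := by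
    obtain ⟨ε, hε, hS⟩ := Metric.mem_nhds_iff.1 h
    have : ∀ᶠ b in 𝓝[>] t, b ∈ Metric.ball t ε := nhdsWithin_le_nhds (Metric.ball_mem_nhds t hε)
    filter_upwards [this, self_mem_nhdsWithin] with b hb hb' c hc
    refine hS ?_
    rw [Metric.mem_ball, NNReal.dist_eq] at *
    have h1 : (t : ℝ) ≤ c := hc.1
    have h2 : (c : ℝ) ≤ b := hc.2
    rw [abs_of_nonneg (by linarith)] at *
    linarith
  obtain ⟨b, hb, hb'⟩ := (h1.and self_mem_nhdsWithin).exists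
  exact ⟨t, b, hb', Ioo_subset_Icc_self.trans hb⟩

theorem dimH_eq_one_of_mem_nhds {t : ℝ≥0} {S : Set ℝ≥0} (h : S ∈ 𝓝 t) : dimH S = 1 := by
  refine le_antisymm (dimH_nnreal_le_one S) ?_
  obtain ⟨a, b, hab, hS⟩ := exists_Ioo_subset_of_mem_nhds h
  rw [← isometry_nnreal_coe.dimH_image]
  have h1 : Ioo (a : ℝ) b ⊆ NNReal.toReal '' S := by
    intro x hx
    refine ⟨⟨x, a.coe_nonneg.trans hx.1.le⟩, hS ⟨hx.1, hx.2⟩, rfl⟩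
  have h2 : dimH (Ioo (a : ℝ) b) = 1 := by
    rw [Real.dimH_of_nonempty_interior, Module.finrank_self, Nat.cast_one]
    rw [interior_Ioo]
    exact nonempty_Ioo.2 hab
  rw [← h2]
  exact dimH_mono h1

end Dim

theorem countable_not_noInt {X : Type*} [Finite X] (K : ℕ) (v : Val X) :
    {t | ¬ NoInt K (delay v t)}.Countable := by
  have : {t | ¬ NoInt K (delay v t)} ⊆ range fun p : X × ℕ => (p.2 : ℝ≥0) - v p.1 := by
    intro t ht
    obtain ⟨x, n, -, h⟩ := not_noInt_iff.1 ht
    refine ⟨(x, n), ?_⟩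
    have : v x + t = n := by rw [coe_delay] at h; exact_mod_cast h
    simp [← this]
  exact (countable_range _).mono this

/-! ### Single steps -/

namespace ClockAutomaton

variable {Q X T AP : Type*} {M : ClockAutomaton Q X T AP} {c c' : Config Q X} {t : ℝ≥0} {e : T}

/-- The configuration reached from `c` by the delay `t` followed by the edge `e`. -/
noncomputable def next (M : ClockAutomaton Q X T AP) (c : Config Q X) (t : ℝ≥0) (e : T) :
    Config Q X :=
  (M.tgt e, resetTo (M.reset e) (delay c.2 t))

theorem step_iff : M.Step c t e c' ↔ t ∈ M.delaysOf c e ∧ c' = M.next c t e := by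
  have aux : ∀ {c'}, M.Step c t e c' → c' = M.next c t e := fun h =>
    Prod.ext h.2.2.2.1 h.2.2.2.2.1
  exact ⟨fun h => ⟨⟨c', h⟩, aux h⟩, fun ⟨⟨c₁, h1⟩, h2⟩ => by rw [h2, ← aux h1]; exact h1⟩

theorem mem_delaysOf : t ∈ M.delaysOf c e ↔ M.src e = c.1 ∧
    (∀ t' ≤ t, delay c.2 t' ∈ M.inv c.1) ∧ delay c.2 t ∈ M.guard e ∧
    resetTo (M.reset e) (delay c.2 t) ∈ M.inv (M.tgt e) := by
  constructor
  · rintro ⟨⟨q, v⟩, h1, h2, h3, rfl, rfl, h6⟩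
    exact ⟨h1, h2, h3, h6⟩
  · rintro ⟨h1, h2, h3, h4⟩
    exact ⟨M.next c t e, h1, h2, h3, rfl, rfl, h4⟩

theorem isState_next (h : t ∈ M.delaysOf c e) : M.IsState (M.next c t e) := (mem_delaysOf.1 h).2.2.2

end ClockAutomaton

section Steps

variable {L X E AP : Type*} {A : TimedAutomaton L X E AP}
  {c c' : Config L X} {t t' : ℝ≥0} {e : E} {v v' : Val X}

namespace TimedAutomaton

theorem mem_delaysOf_iff : t ∈ A.sem.delaysOf c e ↔ A.src e = c.1 ∧ c.2 ∈ guardSet (A.inv c.1) ∧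
    delay c.2 t ∈ guardSet (A.inv c.1) ∧ delay c.2 t ∈ guardSet (A.guard e) ∧
    resetTo (A.reset e) (delay c.2 t) ∈ guardSet (A.inv (A.tgt e)) := by
  rw [ClockAutomaton.mem_delaysOf]
  refine and_congr Iff.rfl ⟨fun ⟨h1, h2⟩ => ⟨?_, h1 t le_rfl, h2⟩,
    fun ⟨h1, h2, h3⟩ => ⟨fun t' ht' => delay_mem_guardSet_of_le h1 h2 ht', h3⟩⟩
  have h3 := h1 0 zero_le
  rwa [delay_zero] at h3

variable [Fintype L] [Fintype E]

theorem guardMax_guard_le (A : TimedAutomaton L X E AP) (e : E) :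
    guardMax (A.guard e) ≤ A.maxConst :=
  le_max_of_le_left (Finset.le_sup (f := fun e => guardMax (A.guard e)) (Finset.mem_univ e))

theorem guardMax_inv_le (A : TimedAutomaton L X E AP) (l : L) : guardMax (A.inv l) ≤ A.maxConst :=
  le_max_of_le_right (Finset.le_sup (f := fun l => guardMax (A.inv l)) (Finset.mem_univ l))

theorem mem_delaysOf_of_regionEquiv {l : L} (h : RegionEquiv A.maxConst v v')
    (h' : RegionEquiv A.maxConst (delay v t) (delay v' t')) (ht : t ∈ A.sem.delaysOf (l, v) e) :
    t' ∈ A.sem.delaysOf (l, v') e := by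
  rw [mem_delaysOf_iff] at *
  exact ⟨ht.1, h.mem_guardSet (A.guardMax_inv_le l) ht.2.1,
    h'.mem_guardSet (A.guardMax_inv_le l) ht.2.2.1,
    h'.mem_guardSet (A.guardMax_guard_le e) ht.2.2.2.1,
    (h'.resetTo _).mem_guardSet (A.guardMax_inv_le _) ht.2.2.2.2⟩

/-- The configuration `c` admits a delay into a region without integer clocks. This is the case in
which the set of the delays from `c` is one-dimensional. -/
def HasOpenDelay (A : TimedAutomaton L X E AP) (c : Config L X) : Prop :=
  ∃ t ∈ A.sem.delays c, NoInt A.maxConst (delay c.2 t)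

/-- The delay `t` from `c` is thick: it leads into a region without integer clocks, unless all
possible delays from `c` lead into regions with integer clocks. These are the delays that follow
edges of the thick graph, see `thinEdge_iff`. -/
def ThickDelay (A : TimedAutomaton L X E AP) (c : Config L X) (t : ℝ≥0) : Prop :=
  NoInt A.maxConst (delay c.2 t) ∨ ¬ A.HasOpenDelay c

theorem exists_thickDelay (hA : A.sem.NonBlocking) (hc : A.sem.IsState c) :
    ∃ e, ∃ t ∈ A.sem.delaysOf c e, A.ThickDelay c t := by
  by_cases h : A.HasOpenDelay c
  · obtain ⟨t, ht, h1⟩ := h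
    obtain ⟨e, he⟩ := mem_iUnion.1 ht
    exact ⟨e, t, he, Or.inl h1⟩
  · obtain ⟨t, ht⟩ := hA c hc
    obtain ⟨e, he⟩ := mem_iUnion.1 ht
    exact ⟨e, t, he, Or.inr h⟩

variable [Finite X]

theorem HasOpenDelay.of_regionEquiv {l : L} (hv : A.HasOpenDelay (l, v))
    (h : RegionEquiv A.maxConst v v') : A.HasOpenDelay (l, v') := by
  obtain ⟨t, ht, h1⟩ := hv
  obtain ⟨e, he⟩ := mem_iUnion.1 ht
  obtain ⟨t', ht'⟩ := h.exists_delay t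
  exact ⟨t', mem_iUnion.2 ⟨e, mem_delaysOf_of_regionEquiv h ht' he⟩, ht'.noInt h1⟩

theorem thickDelay_iff_of_regionEquiv {l : L} (h : RegionEquiv A.maxConst v v')
    (h' : RegionEquiv A.maxConst (delay v t) (delay v' t')) :
    A.ThickDelay (l, v) t ↔ A.ThickDelay (l, v') t' :=
  or_congr h'.noInt_iff
    (not_congr ⟨fun hv => hv.of_regionEquiv h, fun hv => hv.of_regionEquiv h.symm⟩)

theorem delaysOf_mem_nhds {l : L} (ht : t ∈ A.sem.delaysOf (l, v) e)
    (h : NoInt A.maxConst (delay v t)) :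
    {t' | t' ∈ A.sem.delaysOf (l, v) e ∧
      RegionEquiv A.maxConst (delay v t) (delay v t')} ∈ 𝓝 t := by
  have h1 := h.eventually_regionEquiv
  rw [nhds_prod_eq] at h1
  filter_upwards [h1.curry.self_of_nhds] with t' h2
  have h3 := h2 (RegionEquiv.refl _)
  exact ⟨mem_delaysOf_of_regionEquiv (RegionEquiv.refl _) h3 ht, h3⟩

theorem dimH_delays_le (h : ¬ A.HasOpenDelay c) : dimH (A.sem.delays c) = 0 := by
  refine dimH_countable ((countable_not_noInt A.maxConst c.2).mono fun t ht hn => h ⟨t, ht, hn⟩)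

end TimedAutomaton

open TimedAutomaton

variable [Fintype L] [Fintype E] {f : RegionEdge A}

/-! ### Edges of the region automaton -/

theorem mem_delaysOf_of_regionEdge (hv : regionOf A.maxConst v = f.src.2)
    (ht : regionOf A.maxConst (delay v t) = f.mid) :
    t ∈ A.sem.delaysOf (f.src.1, v) f.edge ∧
      A.regionLoc (A.sem.next (f.src.1, v) t f.edge) = f.tgt := by
  obtain ⟨w, w', t', h1, h2, h3, h4⟩ := f.exists_step
  rw [ClockAutomaton.step_iff] at h2
  have e1 := regionOf_eq_iff.1 (h1.trans hv.symm)
  have e2 := regionOf_eq_iff.1 (h3.trans ht.symm)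
  refine ⟨mem_delaysOf_of_regionEquiv e1 e2 h2.1, Prod.ext ?_ ?_⟩
  · exact (congrArg Prod.fst h2.2).symm
  · rw [← h4]
    have h5 : w' = _ := congrArg Prod.snd h2.2
    rw [h5]
    exact regionOf_eq_iff.2 (e2.symm.resetTo _)

theorem mem_delaysOf_regionAutomaton {q : RegionLoc A} (hv : regionOf A.maxConst v = q.2) :
    t ∈ A.regionAutomaton.delaysOf (q, v) f ↔
      f.src = q ∧ regionOf A.maxConst (delay v t) = f.mid := by
  rw [ClockAutomaton.mem_delaysOf]
  refine ⟨fun h => ⟨h.1, h.2.2.1⟩, ?_⟩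
  rintro ⟨rfl, h⟩
  have h1 := (mem_delaysOf_of_regionEdge hv h).1
  rw [ClockAutomaton.mem_delaysOf] at h1
  have h2 : f.tgt.1 = A.tgt f.edge := by
    rw [← (mem_delaysOf_of_regionEdge hv h).2]; rfl
  refine ⟨rfl, h1.2.1, h, ?_⟩
  change _ ∈ guardSet (A.inv f.tgt.1)
  rw [h2]
  exact h1.2.2.2

/-- The edge of the region automaton that is taken by a step of the automaton. -/
noncomputable def regionEdge (h : t ∈ A.sem.delaysOf c e) : RegionEdge A where
  src := A.regionLoc c
  mid := regionOf A.maxConst (delay c.2 t)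
  edge := e
  tgt := A.regionLoc (A.sem.next c t e)
  exists_step := ⟨c.2, _, t, rfl, ClockAutomaton.step_iff.2 ⟨h, rfl⟩, rfl, rfl⟩

theorem delays_regionAutomaton {q : RegionLoc A} (hv : regionOf A.maxConst v = q.2) :
    A.regionAutomaton.delays (q, v) = A.sem.delays (q.1, v) := by
  ext t
  unfold ClockAutomaton.delays
  rw [mem_iUnion, mem_iUnion]
  constructor
  · rintro ⟨f, hf⟩
    rw [mem_delaysOf_regionAutomaton hv] at hf
    obtain ⟨rfl, hf⟩ := hf
    exact ⟨_, (mem_delaysOf_of_regionEdge hv hf).1⟩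
  · rintro ⟨e, he⟩
    refine ⟨regionEdge he, ?_⟩
    rw [mem_delaysOf_regionAutomaton hv]
    exact ⟨Prod.ext rfl hv, rfl⟩

variable [Finite X]

/-- Sets of delays have dimension one if they contain a delay into a region without integer clocks,
and they are countable otherwise. So the dimension drops along `f` iff `f` leads into a region with
an integer clock although this can be avoided. -/
theorem thinEdge_iff_of_mem (hv : regionOf A.maxConst v = f.src.2)
    (ht : regionOf A.maxConst (delay v t) = f.mid) :
    dim (A.regionAutomaton.delaysOf (f.src, v) f) < dim (A.regionAutomaton.delays (f.src, v)) ↔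
      ¬ A.ThickDelay (f.src.1, v) t := by
  have hmem : t ∈ A.regionAutomaton.delaysOf (f.src, v) f :=
    (mem_delaysOf_regionAutomaton hv).2 ⟨rfl, ht⟩
  have hmemA := (mem_delaysOf_of_regionEdge hv ht).1
  have hsub : ∀ t', RegionEquiv A.maxConst (delay v t) (delay v t') ↔
      t' ∈ A.regionAutomaton.delaysOf (f.src, v) f := by
    intro t'
    rw [mem_delaysOf_regionAutomaton hv, ← ht, eq_comm (a := regionOf _ (delay v t')),
      regionOf_eq_iff, and_iff_right rfl]
  rw [dim_lt_dim_iff ⟨t, hmem⟩, delays_regionAutomaton hv]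
  by_cases hI : NoInt A.maxConst (delay v t)
  · have h1 : A.ThickDelay (f.src.1, v) t := Or.inl hI
    have h2 : dimH (A.regionAutomaton.delaysOf (f.src, v) f) = 1 := by
      refine dimH_eq_one_of_mem_nhds (mem_of_superset (delaysOf_mem_nhds hmemA hI) ?_)
      exact fun t' ht' => (hsub t').1 ht'.2
    simp only [h1, not_true, iff_false, not_lt, h2]
    exact dimH_nnreal_le_one _
  · have h2 : dimH (A.regionAutomaton.delaysOf (f.src, v) f) = 0 := by
      refine dimH_countable ((countable_not_noInt A.maxConst v).mono fun t' ht' => ?_)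
      exact fun hn => hI (((hsub t').2 ht').symm.noInt hn)
    rw [h2]
    by_cases hO : A.HasOpenDelay (f.src.1, v)
    · have h3 : dimH (A.sem.delays (f.src.1, v)) = 1 := by
        obtain ⟨t', ht', hn⟩ := hO
        obtain ⟨e, he⟩ := mem_iUnion.1 ht'
        exact dimH_eq_one_of_mem_nhds (mem_of_superset (delaysOf_mem_nhds he hn)
          fun t' ht' => mem_iUnion.2 ⟨e, ht'.1⟩)
      rw [h3]
      simp only [ThickDelay, not_or, not_not]
      exact ⟨fun _ => ⟨hI, hO⟩, fun _ => zero_lt_one⟩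
    · rw [dimH_delays_le hO]
      simp [ThickDelay, hO]

/-- Thin edges are recognized on any step that follows them. -/
theorem thinEdge_iff (hv : regionOf A.maxConst v = f.src.2)
    (ht : regionOf A.maxConst (delay v t) = f.mid) :
    ThinEdge f ↔ ¬ A.ThickDelay (f.src.1, v) t := by
  constructor
  · rintro ⟨v', hv', h⟩
    have e := regionOf_eq_iff.1 (hv.trans hv'.symm)
    obtain ⟨t', ht'⟩ := e.exists_delay t
    rw [thinEdge_iff_of_mem hv' ((regionOf_eq_iff.2 ht'.symm).trans ht)] at h
    rwa [thickDelay_iff_of_regionEquiv e ht']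
  · exact fun h => ⟨v, hv, (thinEdge_iff_of_mem hv ht).2 h⟩

theorem thinEdge_regionEdge_iff (h : t ∈ A.sem.delaysOf c e) :
    ThinEdge (regionEdge h) ↔ ¬ A.ThickDelay c t :=
  thinEdge_iff (f := regionEdge h) rfl rfl

end Steps

/-! ### Trajectories -/

/-- The first `n` terms of a sequence. -/
def initSeg {α : Type*} (n : ℕ) (q : ℕ → α) : Fin n → α := fun i => q i

/-- A tuple of delays, continued by zeros. -/
noncomputable def zeroExt {n : ℕ} (τ : Fin n → ℝ≥0) : ℕ → ℝ≥0 := Function.extend Fin.val τ 0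

@[simp] theorem initSeg_zeroExt {n : ℕ} (τ : Fin n → ℝ≥0) : initSeg n (zeroExt τ) = τ :=
  funext fun i => Fin.val_injective.extend_apply τ 0 i

theorem initSeg_eq_iff {α : Type*} {n : ℕ} {q q' : ℕ → α} :
    initSeg n q = initSeg n q' ↔ ∀ i < n, q i = q' i :=
  ⟨fun h i hi => congrFun h ⟨i, hi⟩, fun h => funext fun i => h i i.2⟩

theorem continuous_initSeg {α : Type*} [TopologicalSpace α] (n : ℕ) :
    Continuous (initSeg n : (ℕ → α) → Fin n → α) :=
  continuous_pi fun _ => continuous_apply _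

namespace ClockAutomaton

variable {Q X T AP : Type*} {M : ClockAutomaton Q X T AP} {s : Config Q X} {e e' : ℕ → T}
  {q q' : ℕ → ℝ≥0} {n i : ℕ}

/-- The configurations that are visited from `s` if the edges `e 0, e 1, …` are taken after the
delays `q 0, q 1, …`. -/
noncomputable def traj (M : ClockAutomaton Q X T AP) (s : Config Q X) (e : ℕ → T) (q : ℕ → ℝ≥0) :
    ℕ → Config Q X
  | 0 => s
  | i + 1 => M.next (M.traj s e q i) (q i) (e i)

/-- The first `n` steps along the edges `e` with the delays `q` are possible. -/
def Valid (M : ClockAutomaton Q X T AP) (s : Config Q X) (e : ℕ → T) (q : ℕ → ℝ≥0) (n : ℕ) : Prop :=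
  ∀ i < n, q i ∈ M.delaysOf (M.traj s e q i) (e i)

theorem traj_congr (he : ∀ j < i, e j = e' j) (hq : ∀ j < i, q j = q' j) :
    M.traj s e q i = M.traj s e' q' i := by
  induction i with
  | zero => rfl
  | succ i ih =>
    simp only [traj]
    rw [ih (fun j hj => he j (hj.trans (Nat.lt_succ_self _)))
      (fun j hj => hq j (hj.trans (Nat.lt_succ_self _))), he i (Nat.lt_succ_self _),
      hq i (Nat.lt_succ_self _)]

theorem Valid.congr (h : M.Valid s e q n) (he : ∀ j < n, e j = e' j) (hq : ∀ j < n, q j = q' j) :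
    M.Valid s e' q' n := by
  intro i hi
  rw [← he i hi, ← hq i hi, ← traj_congr (fun j hj => he j (hj.trans hi))
    (fun j hj => hq j (hj.trans hi))]
  exact h i hi

theorem Valid.mono (h : M.Valid s e q n) (hi : i ≤ n) : M.Valid s e q i :=
  fun j hj => h j (hj.trans_le hi)

theorem valid_succ : M.Valid s e q (n + 1) ↔
    M.Valid s e q n ∧ q n ∈ M.delaysOf (M.traj s e q n) (e n) := by
  constructor
  · exact fun h => ⟨h.mono n.le_succ, h n n.lt_succ_self⟩
  · rintro ⟨h1, h2⟩ i hi
    rcases Nat.lt_succ_iff_lt_or_eq.1 hi with hi | rfl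
    exacts [h1 i hi, h2]

theorem traj_fst (M : ClockAutomaton Q X T AP) (s : Config Q X) (e : ℕ → T) (q q' : ℕ → ℝ≥0)
    (i : ℕ) : (M.traj s e q i).1 = (M.traj s e q' i).1 := by
  cases i <;> rfl

theorem Valid.isState (h : M.Valid s e q n) (hs : M.IsState s) (hi : i ≤ n) :
    M.IsState (M.traj s e q i) := by
  cases i with
  | zero => exact hs
  | succ i => exact isState_next (h i hi)

theorem initSeg_mem_Pol {C : Set (Fin n → ℝ≥0)} :
    initSeg n q ∈ M.Pol s n e C ↔ initSeg n q ∈ C ∧ M.Valid s e q n := by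
  refine and_congr Iff.rfl ⟨?_, fun h => ⟨M.traj s e q, rfl, fun i => step_iff.2 ⟨h i i.2, rfl⟩⟩⟩
  rintro ⟨st, h0, h⟩
  have key : ∀ i ≤ n, st i = M.traj s e q i := by
    intro i
    induction i with
    | zero => exact fun _ => h0
    | succ i ih =>
      intro hi
      have := (step_iff.1 (h ⟨i, hi⟩)).2
      rw [this, ih (Nat.le_of_succ_le hi)]
      rfl
  intro i hi
  rw [← key i hi.le]
  exact (step_iff.1 (h ⟨i, hi⟩)).1

theorem Pol_eq_image {C : Set (Fin n → ℝ≥0)} :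
    M.Pol s n e C = initSeg n '' {q | initSeg n q ∈ C ∧ M.Valid s e q n} := by
  ext τ
  constructor
  · intro h
    rw [← initSeg_zeroExt τ, initSeg_mem_Pol] at h
    exact ⟨_, h, initSeg_zeroExt τ⟩
  · rintro ⟨q, hq, rfl⟩
    exact initSeg_mem_Pol.2 hq

theorem projConstraint_eq {C : Set (Fin n → ℝ≥0)} (hi : i ≤ n)
    (hne : i ≠ 0 ∨ (M.Pol s n e C).Nonempty) :
    M.projConstraint s n e C i hi = initSeg i '' {q | initSeg n q ∈ C ∧ M.Valid s e q n} := by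
  unfold projConstraint
  rw [Pol_eq_image] at *
  split_ifs with h
  · subst h
    obtain ⟨-, q, hq, -⟩ := hne.resolve_left (by simp)
    refine (eq_univ_of_forall fun τ => ?_).symm
    exact ⟨q, hq, Subsingleton.elim _ _⟩
  · rw [image_image]
    rfl

/-- The sequences that agree with an element of `S` before time `i` and then have a possible delay
at time `i`. -/
def extensions (M : ClockAutomaton Q X T AP) (s : Config Q X) (e : ℕ → T) (S : Set (ℕ → ℝ≥0))
    (i : ℕ) : Set (ℕ → ℝ≥0) :=
  {q | (∃ q' ∈ S, ∀ j < i, q j = q' j) ∧ q i ∈ M.delays (M.traj s e q i)}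

/-- Thinness of a nonempty constrained path in terms of sequences of delays: at some time, the
extensions of the admissible delay sequences by an arbitrary delay have a larger dimension than the
admissible sequences. -/
theorem thinPath_iff {C : Set (Fin n → ℝ≥0)} (hne : (M.Pol s n e C).Nonempty) :
    M.ThinPath s n e C ↔ ∃ i < n,
      dimH (initSeg (i + 1) '' {q | initSeg n q ∈ C ∧ M.Valid s e q n}) <
        dimH (initSeg (i + 1) ''
          M.extensions s e {q | initSeg n q ∈ C ∧ M.Valid s e q n} i) := by
  have h1 : ∀ i (h : i < n), M.Pol s (i + 1) e (M.projConstraint s n e C (i + 1) h) =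
      initSeg (i + 1) '' {q | initSeg n q ∈ C ∧ M.Valid s e q n} := by
    intro i h
    rw [projConstraint_eq _ (Or.inl i.succ_ne_zero)]
    refine subset_antisymm (fun τ hτ => hτ.1) ?_
    rintro _ ⟨q, hq, rfl⟩
    exact initSeg_mem_Pol.2 ⟨⟨q, hq, rfl⟩, hq.2.mono h⟩
  have h2 : ∀ i (h : i < n), (⋃ e' : T, M.Pol s (i + 1) (Function.update e i e')
        {τ | Fin.init τ ∈ M.projConstraint s n e C i h.le}) =
      initSeg (i + 1) '' M.extensions s e {q | initSeg n q ∈ C ∧ M.Valid s e q n} i := by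
    intro i h
    have hup : ∀ e', ∀ j < i, Function.update e i e' j = e j := fun e' j hj =>
      Function.update_of_ne hj.ne _ _
    ext τ
    rw [mem_iUnion]
    constructor
    · rintro ⟨e', hτ⟩
      rw [← initSeg_zeroExt τ] at hτ ⊢
      rw [initSeg_mem_Pol, projConstraint_eq _ (Or.inr hne), valid_succ] at hτ
      obtain ⟨⟨q', hq', h3⟩, -, h4⟩ := hτ
      refine ⟨_, ⟨⟨q', hq', ?_⟩, mem_iUnion.2 ⟨e', ?_⟩⟩, rfl⟩
      · exact fun j hj => (initSeg_eq_iff.1 h3 j hj).symm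
      · rwa [traj_congr (hup e') (fun _ _ => rfl), Function.update_self] at h4
    · rintro ⟨q, ⟨⟨q', hq', h3⟩, h4⟩, rfl⟩
      obtain ⟨e', h4⟩ := mem_iUnion.1 h4
      refine ⟨e', initSeg_mem_Pol.2 ⟨?_, valid_succ.2 ⟨?_, ?_⟩⟩⟩
      · rw [projConstraint_eq _ (Or.inr hne)]
        exact ⟨q', hq', initSeg_eq_iff.2 fun j hj => (h3 j hj).symm⟩
      · exact (hq'.2.mono h.le).congr (fun j hj => (hup e' j hj).symm)
          (fun j hj => (h3 j hj).symm)
      · rwa [traj_congr (hup e') (fun _ _ => rfl), Function.update_self]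
  unfold ThinPath
  refine ⟨fun ⟨i, hi, h⟩ => ⟨i, hi, ?_⟩, fun ⟨i, hi, h⟩ => ⟨i, hi, ?_⟩⟩
  all_goals
    have h3 : (initSeg (i + 1) '' {q | initSeg n q ∈ C ∧ M.Valid s e q n}).Nonempty := by
      rw [Pol_eq_image] at hne
      exact (image_nonempty.1 hne).image _
  · rwa [h1 i hi, h2 i hi, dim_lt_dim_iff h3] at h
  · rwa [h1 i hi, h2 i hi, dim_lt_dim_iff h3]

/-- The run from `s` along the edges `e` with the delays `q`. -/
noncomputable def runOf (M : ClockAutomaton Q X T AP) (s : Config Q X) (e : ℕ → T) (q : ℕ → ℝ≥0) :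
    ℕ → Config Q X × (ℝ≥0 × T) :=
  fun i => (M.traj s e q i, (q i, e i))

theorem runOf_mem_Runs (h : ∀ n, M.Valid s e q n) : M.runOf s e q ∈ M.Runs s :=
  ⟨rfl, fun i => step_iff.2 ⟨h (i + 1) i i.lt_succ_self, rfl⟩⟩

theorem eq_traj_of_mem_Runs {ρ : ℕ → Config Q X × (ℝ≥0 × T)} (h : ρ ∈ M.Runs s) (i : ℕ) :
    (ρ i).1 = M.traj s (fun i => (ρ i).2.2) (fun i => (ρ i).2.1) i := by
  induction i with
  | zero => exact h.1
  | succ i ih =>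
    rw [(step_iff.1 (h.2 i)).2, ih]
    rfl

theorem valid_of_mem_Runs {ρ : ℕ → Config Q X × (ℝ≥0 × T)} (h : ρ ∈ M.Runs s) (n : ℕ) :
    M.Valid s (fun i => (ρ i).2.2) (fun i => (ρ i).2.1) n := by
  intro i _
  rw [← eq_traj_of_mem_Runs h]
  exact (step_iff.1 (h.2 i)).1

theorem continuous_resetTo (Y : Set X) : Continuous (resetTo Y : Val X → Val X) := by
  refine continuous_pi fun x => ?_
  unfold resetTo
  split_ifs
  · exact continuous_const
  · exact (continuous_apply x : Continuous fun v : X → ℝ≥0 => v x)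

theorem continuous_traj (M : ClockAutomaton Q X T AP) (s : Config Q X) (e : ℕ → T) (i : ℕ) :
    Continuous fun q => (M.traj s e q i).2 := by
  induction i with
  | zero => exact (continuous_const : Continuous fun _ : ℕ → ℝ≥0 => s.2)
  | succ i ih =>
    exact (continuous_resetTo _).comp (continuous_delay.comp (ih.prodMk (continuous_apply i)))

/-- Along fixed edges, the clock values are affine functions of the delays. -/
theorem traj_convexComb (M : ClockAutomaton Q X T AP) (s : Config Q X) (e : ℕ → T) (q q' : ℕ → ℝ≥0)
    {a b : ℝ≥0} (hab : a + b = 1) (i : ℕ) :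
    (M.traj s e (fun j => a * q j + b * q' j) i).2 =
      fun x => a * (M.traj s e q i).2 x + b * (M.traj s e q' i).2 x := by
  induction i with
  | zero => funext x; simp [traj, ← add_mul, hab]
  | succ i ih =>
    funext x
    simp only [traj, next, resetTo, delay]
    rw [ih]
    split_ifs
    · simp
    · ring

end ClockAutomaton

/-! ### Dimension of sets of delay sequences -/

section Lipschitz

variable {Y : Type*} [PseudoMetricSpace Y] {f g : Y → ℝ≥0} {C D : ℝ≥0}

theorem lipschitzWith_add_nnreal (hf : LipschitzWith C f) (hg : LipschitzWith D g) :
    LipschitzWith (C + D) fun y => f y + g y := by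
  refine LipschitzWith.of_dist_le_mul fun x y => ?_
  have h1 := hf.dist_le_mul x y
  have h2 := hg.dist_le_mul x y
  rw [NNReal.dist_eq] at *
  push_cast
  have : ((f x : ℝ) + g x - (f y + g y)) = (f x - f y) + (g x - g y) := by ring
  rw [this, add_mul]
  exact (abs_add_le _ _).trans (add_le_add h1 h2)

theorem lipschitzWith_const_tsub_nnreal (c : ℝ≥0) (hf : LipschitzWith C f) :
    LipschitzWith C fun y => c - f y := by
  refine LipschitzWith.of_dist_le_mul fun x y => ?_
  have h1 := hf.dist_le_mul x y
  rw [NNReal.dist_eq] at *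
  rw [NNReal.coe_sub_def, NNReal.coe_sub_def]
  refine (abs_max_sub_max_le_abs _ _ _).trans ?_
  rw [show (c : ℝ) - f x - (c - f y) = -(f x - f y) by ring, abs_neg]
  exact h1

theorem exists_lipschitzWith_pi {ι : Type*} [Fintype ι] {f : Y → ι → ℝ≥0}
    (h : ∀ i, ∃ C, LipschitzWith C fun y => f y i) : ∃ C, LipschitzWith C f := by
  choose C hC using h
  refine ⟨Finset.univ.sup C, fun x y => edist_pi_le_iff.2 fun i => (hC i x y).trans ?_⟩
  gcongr
  exact Finset.le_sup (Finset.mem_univ i)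

variable {Q X T AP : Type*} {M : ClockAutomaton Q X T AP} {s : Config Q X} {e : ℕ → T}

theorem exists_lipschitzWith_traj {φ : Y → ℕ → ℝ≥0} (h : ∀ i, ∃ C, LipschitzWith C fun y => φ y i)
    (i : ℕ) (x : X) : ∃ C, LipschitzWith C fun y => (M.traj s e (φ y) i).2 x := by
  induction i with
  | zero => exact ⟨0, LipschitzWith.const (s.2 x)⟩
  | succ i ih =>
    simp only [ClockAutomaton.traj, ClockAutomaton.next, resetTo, delay]
    split_ifs
    · exact ⟨0, LipschitzWith.const _⟩
    · obtain ⟨C, hC⟩ := ih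
      obtain ⟨D, hD⟩ := h i
      exact ⟨_, lipschitzWith_add_nnreal hC hD⟩

end Lipschitz

section Dimension

open scoped Classical

open ClockAutomaton

variable {L X E AP : Type*} [Fintype L] [Fintype E] {A : TimedAutomaton L X E AP}
  {s : Config L X} {e : ℕ → E} {p q q' : ℕ → ℝ≥0} {n i : ℕ}

namespace TimedAutomaton

/-- The `i`-th delay leads into a region without integer clocks. -/
def OpenAt (A : TimedAutomaton L X E AP) (s : Config L X) (e : ℕ → E) (q : ℕ → ℝ≥0) (i : ℕ) :
    Prop :=
  NoInt A.maxConst (delay (A.sem.traj s e q i).2 (q i))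

/-- The `i`-th delay is thick. -/
def ThickAt (A : TimedAutomaton L X E AP) (s : Config L X) (e : ℕ → E) (q : ℕ → ℝ≥0) (i : ℕ) :
    Prop :=
  A.ThickDelay (A.sem.traj s e q i) (q i)

/-- The delay sequences that follow the same regions as `p` during the first `n` steps. -/
def cell (A : TimedAutomaton L X E AP) (s : Config L X) (e : ℕ → E) (p : ℕ → ℝ≥0) (n : ℕ) :
    Set (ℕ → ℝ≥0) :=
  {q | ∀ i < n, RegionEquiv A.maxConst (delay (A.sem.traj s e p i).2 (p i))
    (delay (A.sem.traj s e q i).2 (q i))}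

theorem mem_cell_self : p ∈ A.cell s e p n := fun _ _ => RegionEquiv.refl _

theorem mem_cell_succ : q ∈ A.cell s e p (n + 1) ↔ q ∈ A.cell s e p n ∧
    RegionEquiv A.maxConst (delay (A.sem.traj s e p n).2 (p n))
      (delay (A.sem.traj s e q n).2 (q n)) := by
  constructor
  · exact fun h => ⟨fun i hi => h i (hi.trans n.lt_succ_self), h n n.lt_succ_self⟩
  · rintro ⟨h1, h2⟩ i hi
    rcases Nat.lt_succ_iff_lt_or_eq.1 hi with hi | rfl
    exacts [h1 i hi, h2]

theorem cell_mono (h : i ≤ n) : A.cell s e p n ⊆ A.cell s e p i :=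
  fun _ hq j hj => hq j (hj.trans_le h)

theorem mem_cell_congr (h : ∀ i < n, q i = q' i) : q ∈ A.cell s e p n ↔ q' ∈ A.cell s e p n := by
  refine forall₂_congr fun i hi => ?_
  rw [traj_congr (q' := q') (fun _ _ => rfl) (fun j hj => h j (hj.trans hi)), h i hi]

theorem regionEquiv_traj (h : q ∈ A.cell s e p n) (hi : i ≤ n) :
    RegionEquiv A.maxConst (A.sem.traj s e p i).2 (A.sem.traj s e q i).2 := by
  cases i with
  | zero => exact RegionEquiv.refl _
  | succ i => exact (h i hi).resetTo _

theorem valid_of_mem_cell (h : q ∈ A.cell s e p n) (hp : A.sem.Valid s e p n) :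
    A.sem.Valid s e q n := by
  intro i hi
  have := mem_delaysOf_of_regionEquiv (l := (A.sem.traj s e p i).1)
    (regionEquiv_traj h hi.le) (h i hi) (hp i hi)
  rwa [traj_fst A.sem s e p q] at this

theorem openAt_iff_of_mem_cell (h : q ∈ A.cell s e p n) (hi : i < n) :
    A.OpenAt s e p i ↔ A.OpenAt s e q i := (h i hi).noInt_iff

theorem openAt_congr (h : ∀ j ≤ i, q j = q' j) : A.OpenAt s e q i ↔ A.OpenAt s e q' i := by
  unfold OpenAt
  rw [traj_congr (q' := q') (fun _ _ => rfl) (fun j hj => h j hj.le), h i le_rfl]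

theorem update_mem_cell_succ (hq : q ∈ A.cell s e p n) {t : ℝ≥0}
    (ht : RegionEquiv A.maxConst (delay (A.sem.traj s e p n).2 (p n))
      (delay (A.sem.traj s e q n).2 t)) : Function.update q n t ∈ A.cell s e p (n + 1) := by
  have h : ∀ j < n, q j = Function.update q n t j := fun j hj =>
    (Function.update_of_ne hj.ne _ _).symm
  refine mem_cell_succ.2 ⟨(mem_cell_congr h).1 hq, ?_⟩
  rwa [← traj_congr (fun _ _ => rfl) h, Function.update_self]

variable [Finite X]

theorem hasOpenDelay_iff_of_mem_cell (h : q ∈ A.cell s e p n) (hi : i ≤ n) :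
    A.HasOpenDelay (A.sem.traj s e p i) ↔ A.HasOpenDelay (A.sem.traj s e q i) := by
  have h1 := regionEquiv_traj h hi
  have h2 := traj_fst A.sem s e p q i
  generalize A.sem.traj s e p i = c at *
  generalize A.sem.traj s e q i = c' at *
  obtain ⟨l, v⟩ := c
  obtain ⟨l', v'⟩ := c'
  dsimp only at h1 h2
  subst h2
  exact ⟨fun h => h.of_regionEquiv h1, fun h => h.of_regionEquiv h1.symm⟩

theorem thickAt_iff_of_mem_cell (h : q ∈ A.cell s e p n) (hi : i < n) :
    A.ThickAt s e p i ↔ A.ThickAt s e q i :=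
  or_congr (openAt_iff_of_mem_cell h hi) (not_congr (hasOpenDelay_iff_of_mem_cell h hi.le))

theorem tendsto_update (p : ℕ → ℝ≥0) (n : ℕ) :
    Tendsto (fun z : (ℕ → ℝ≥0) × ℝ≥0 => Function.update z.1 n z.2) (𝓝 p ×ˢ 𝓝 (p n)) (𝓝 p) := by
  have h : Continuous fun z : (ℕ → ℝ≥0) × ℝ≥0 => Function.update z.1 n z.2 :=
    continuous_fst.update n continuous_snd
  have := h.tendsto (p, p n)
  rwa [Function.update_eq_self, nhds_prod_eq] at this

/-- A cell projects onto a neighbourhood in its projection to the earlier delays. -/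
theorem eventually_exists_mem_cell {m : ℕ} (hnm : n ≤ m) {N : Set (ℕ → ℝ≥0)} (hN : N ∈ 𝓝 p) :
    ∀ᶠ q in 𝓝 p, q ∈ A.cell s e p n → ∃ q' ∈ N, q' ∈ A.cell s e p m ∧ ∀ i < n, q' i = q i := by
  induction m, hnm using Nat.le_induction generalizing N with
  | base => filter_upwards [hN] with q h1 h2 using ⟨q, h1, h2, fun _ _ => rfl⟩
  | succ m hnm ih =>
    obtain ⟨N', hN', T, hT, hNT⟩ := Filter.mem_prod_iff.1 (tendsto_update p m hN)
    have h1 := ((continuous_traj A.sem s e m).tendsto p).eventually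
      (eventually_exists_delay (K := A.maxConst) _ hT)
    filter_upwards [ih (N := N' ∩ {q | _}) (inter_mem hN' h1)] with q h2 h3
    obtain ⟨q', ⟨h4, h5⟩, h6, h7⟩ := h2 h3
    obtain ⟨t, ht, h8⟩ := h5 (regionEquiv_traj h6 le_rfl)
    refine ⟨Function.update q' m t, hNT (mk_mem_prod h4 ht), update_mem_cell_succ h6 h8,
      fun i hi => ?_⟩
    rw [Function.update_of_ne (hi.trans_le hnm).ne, h7 i hi]

/-- Near any of its points, a cell contains points with arbitrary values from some box at the
coordinates where the delay leads into a region without integer clocks. -/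
theorem exists_box_of_mem_nhds (n : ℕ) {N : Set (ℕ → ℝ≥0)} (hN : N ∈ 𝓝 p) :
    ∃ a b : ℕ → ℝ≥0, (∀ i, a i < b i) ∧ ∀ x : ℕ → ℝ≥0, (∀ i, x i ∈ Ioo (a i) (b i)) →
      ∃ q ∈ N, q ∈ A.cell s e p n ∧ ∀ i < n, A.OpenAt s e p i → q i = x i := by
  induction n generalizing N with
  | zero =>
    exact ⟨0, 1, fun _ => zero_lt_one, fun x _ =>
      ⟨p, mem_of_mem_nhds hN, mem_cell_self, fun i hi => absurd hi (Nat.not_lt_zero i)⟩⟩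
  | succ n ih =>
    obtain ⟨N', hN', T, hT, hNT⟩ := Filter.mem_prod_iff.1 (tendsto_update p n hN)
    by_cases hO : A.OpenAt s e p n
    · have h1 := hO.eventually_regionEquiv
      rw [nhds_prod_eq] at h1
      obtain ⟨V, hV, T', hT', hVT⟩ := Filter.mem_prod_iff.1 h1
      have h2 := ((continuous_traj A.sem s e n).tendsto p) hV
      obtain ⟨a, b, hab, hx⟩ := ih (inter_mem hN' h2)
      obtain ⟨α, β, hαβ, hT''⟩ := exists_Ioo_subset_of_mem_nhds (inter_mem hT hT')
      refine ⟨Function.update a n α, Function.update b n β, fun i => ?_, fun x hxi => ?_⟩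
      · rcases eq_or_ne i n with rfl | hi
        · simpa using hαβ
        · simpa [hi] using hab i
      · obtain ⟨y, hy, hy'⟩ : ∃ y : ℕ → ℝ≥0, (∀ i, y i ∈ Ioo (a i) (b i)) ∧
            ∀ i < n, y i = x i := by
          have : ∀ i, (Ioo (a i) (b i)).Nonempty := fun i => nonempty_Ioo.2 (hab i)
          choose z hz using this
          refine ⟨fun i => if i < n then x i else z i, fun i => ?_, fun i hi => if_pos hi⟩
          dsimp only
          split_ifs with hi
          · simpa [hi.ne] using hxi i
          · exact hz i
        obtain ⟨q, ⟨h3, h4⟩, h5, h6⟩ := hx y hy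
        have hxn : x n ∈ Ioo α β := by simpa using hxi n
        have h7 := hVT (mk_mem_prod h4 (hT'' hxn).2) (regionEquiv_traj h5 le_rfl)
        refine ⟨Function.update q n (x n), hNT (mk_mem_prod h3 (hT'' hxn).1),
          update_mem_cell_succ h5 h7, fun i hi hOi => ?_⟩
        rcases Nat.lt_succ_iff_lt_or_eq.1 hi with hi | rfl
        · rw [Function.update_of_ne hi.ne, h6 i hi hOi, hy' i hi]
        · exact Function.update_self ..
    · obtain ⟨a, b, hab, hx⟩ := ih (eventually_exists_mem_cell (A := A) (s := s) (e := e)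
        n.le_succ hN)
      refine ⟨a, b, hab, fun x hxi => ?_⟩
      obtain ⟨q, h3, h5, h6⟩ := hx x hxi
      obtain ⟨q', h7, h8, h9⟩ := h3 h5
      refine ⟨q', h7, h8, fun i hi hOi => ?_⟩
      rcases Nat.lt_succ_iff_lt_or_eq.1 hi with hi | rfl
      · rw [h9 i hi, h6 i hi hOi]
      · exact absurd hOi hO

/-- The dimension of a cell is at least the number of its delays into regions without integer
clocks: its projection to these coordinates contains a box. -/
theorem count_le_dimH {N : Set (ℕ → ℝ≥0)} (hN : N ∈ 𝓝 p) (n : ℕ) :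
    (Nat.count (A.OpenAt s e p) n : ℝ≥0∞) ≤ dimH (initSeg n '' (N ∩ A.cell s e p n)) := by
  obtain ⟨a, b, hab, hx⟩ := exists_box_of_mem_nhds (A := A) (s := s) (e := e) n hN
  let I := {k : ℕ // k < n ∧ A.OpenAt s e p k}
  let _ : Fintype I := Nat.CountSet.fintype _ n
  let ψ : (Fin n → ℝ≥0) → I → ℝ := fun τ k => τ ⟨k.1, k.2.1⟩
  have hψ : LipschitzWith 1 ψ := by
    refine fun x y => edist_pi_le_iff.2 fun k => ?_
    rw [ENNReal.coe_one, one_mul]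
    exact (isometry_nnreal_coe.edist_eq _ _).trans_le (edist_le_pi_edist x y _)
  refine le_trans (le_of_eq ?_) (hψ.dimH_image_le _)
  have hsub : (univ.pi fun k : I => Ioo (a k : ℝ) (b k)) ⊆
      ψ '' (initSeg n '' (N ∩ A.cell s e p n)) := by
    intro u hu
    have hne : ∀ i, (Ioo (a i) (b i)).Nonempty := fun i => nonempty_Ioo.2 (hab i)
    choose z hz using hne
    obtain ⟨q, h1, h2, h3⟩ := hx
      (fun i => if h : i < n ∧ A.OpenAt s e p i then (u ⟨i, h⟩).toNNReal else z i) (by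
        intro i
        split_ifs with h
        · have h4 := hu ⟨i, h⟩ (mem_univ _)
          have h5 : 0 ≤ u ⟨i, h⟩ := (a i).coe_nonneg.trans h4.1.le
          refine ⟨Real.lt_toNNReal_iff_coe_lt.2 h4.1, ?_⟩
          exact (Real.toNNReal_lt_iff_lt_coe h5).2 h4.2
        · exact hz i)
    refine ⟨initSeg n q, ⟨q, ⟨h1, h2⟩, rfl⟩, funext fun k => ?_⟩
    have h4 := h3 k.1 k.2.1 k.2.2
    rw [dif_pos k.2] at h4
    change ((q k.1 : ℝ≥0) : ℝ) = u k
    rw [h4]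
    exact Real.coe_toNNReal _ ((a k).coe_nonneg.trans (hu k (mem_univ _)).1.le)
  have hint : (interior (ψ '' (initSeg n '' (N ∩ A.cell s e p n)))).Nonempty := by
    refine Nonempty.mono (interior_mono hsub) ?_
    rw [(isOpen_set_pi finite_univ fun k _ => isOpen_Ioo).interior_eq, univ_pi_nonempty_iff]
    exact fun k => nonempty_Ioo.2 (hab k.1)
  rw [Real.dimH_of_nonempty_interior hint, Module.finrank_fintype_fun_eq_card,
    Nat.count_eq_card_fintype]

/-- A set of delay sequences is covered by countably many Lipschitz images of a Euclidean space of
dimension `d` if at all but `d` times the delay leads to an integer value of some clock: such a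
delay is an affine function of the earlier delays. -/
theorem dimH_le_count {S : Set (ℕ → ℝ≥0)} {G : ℕ → Prop} (n : ℕ)
    (hS : ∀ q ∈ S, ∀ i < n, A.OpenAt s e q i → G i) :
    dimH (initSeg n '' S) ≤ Nat.count G n := by
  let I := {k : ℕ // k < n ∧ G k}
  let _ : Fintype I := Nat.CountSet.fintype _ n
  have key : ∀ m ≤ n, ∃ F : Set ((I → ℝ) → ℕ → ℝ≥0), F.Countable ∧
      (∀ φ ∈ F, ∀ i, ∃ C, LipschitzWith C fun u => φ u i) ∧
      ∀ q ∈ S, ∃ φ ∈ F, ∀ i < m, φ (fun k => (q k : ℝ)) i = q i := by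
    intro m
    induction m with
    | zero =>
      refine fun _ => ⟨{fun _ _ => 0}, countable_singleton _, ?_, fun q _ =>
        ⟨_, rfl, fun i hi => absurd hi (Nat.not_lt_zero i)⟩⟩
      rintro _ rfl i
      exact ⟨0, LipschitzWith.const _⟩
    | succ m ih =>
      intro hm
      obtain ⟨F, hF, hL, hS'⟩ := ih (Nat.le_of_succ_le hm)
      -- extends a parametrization by one coordinate
      have ext : ∀ {φ : (I → ℝ) → ℕ → ℝ≥0} {f : (I → ℝ) → ℝ≥0},
          (∀ i, ∃ C, LipschitzWith C fun u => φ u i) → (∃ C, LipschitzWith C f) →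
          ∀ i, ∃ C, LipschitzWith C fun u => Function.update (φ u) m (f u) i := by
        intro φ f hφ hf i
        rcases eq_or_ne i m with rfl | hi
        · simpa using hf
        · simpa [hi] using hφ i
      by_cases hG : G m
      · refine ⟨(fun φ u => Function.update (φ u) m (u ⟨m, hm, hG⟩).toNNReal) '' F, hF.image _,
          ?_, fun q hq => ?_⟩
        · rintro _ ⟨φ, hφ, rfl⟩
          exact ext (hL φ hφ) ⟨1 * 1, Real.lipschitzWith_toNNReal.comp (LipschitzWith.eval _)⟩
        · obtain ⟨φ, hφ, h1⟩ := hS' q hq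
          refine ⟨_, ⟨φ, hφ, rfl⟩, fun i hi => ?_⟩
          rcases Nat.lt_succ_iff_lt_or_eq.1 hi with hi | rfl
          · simp only [Function.update_of_ne hi.ne]
            exact h1 i hi
          · simp
      · refine ⟨(fun (z : ((I → ℝ) → ℕ → ℝ≥0) × X × ℕ) u => Function.update (z.1 u) m
          (z.2.2 - (A.sem.traj s e (z.1 u) m).2 z.2.1)) '' (F ×ˢ univ),
          (hF.prod countable_univ).image _, ?_, fun q hq => ?_⟩
        · rintro _ ⟨⟨φ, x, k⟩, ⟨hφ, -⟩, rfl⟩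
          obtain ⟨C, hC⟩ := exists_lipschitzWith_traj (M := A.sem) (s := s) (e := e) (hL φ hφ) m x
          exact ext (hL φ hφ) ⟨C, lipschitzWith_const_tsub_nnreal _ hC⟩
        · obtain ⟨φ, hφ, h1⟩ := hS' q hq
          obtain ⟨x, k, -, h2⟩ := not_noInt_iff.1 (mt (hS q hq m hm) hG)
          refine ⟨_, ⟨⟨φ, x, k⟩, ⟨hφ, mem_univ _⟩, rfl⟩, fun i hi => ?_⟩
          rcases Nat.lt_succ_iff_lt_or_eq.1 hi with hi | rfl
          · simp only [Function.update_of_ne hi.ne]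
            exact h1 i hi
          · have h3 : (A.sem.traj s e q i).2 x + q i = k := by
              rw [coe_delay] at h2; exact_mod_cast h2
            simp only [Function.update_self]
            rw [traj_congr (q' := q) (fun _ _ => rfl) h1, ← h3, add_tsub_cancel_left]
  obtain ⟨F, hF, hL, hS'⟩ := key n le_rfl
  have hsub : initSeg n '' S ⊆ ⋃ φ ∈ F, range fun u => initSeg n (φ u) := by
    rintro _ ⟨q, hq, rfl⟩
    obtain ⟨φ, hφ, h1⟩ := hS' q hq
    exact mem_biUnion hφ ⟨_, initSeg_eq_iff.2 h1⟩
  refine (dimH_mono hsub).trans ?_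
  rw [dimH_bUnion hF]
  refine iSup₂_le fun φ hφ => ?_
  obtain ⟨C, hC⟩ := exists_lipschitzWith_pi (f := fun u => initSeg n (φ u)) fun i => hL φ hφ i
  refine hC.dimH_range_le.trans (le_of_eq ?_)
  rw [Real.dimH_univ_pi, Nat.count_eq_card_fintype]

end TimedAutomaton

end Dimension

/-! ### Thick paths and thick delays -/

section Thick

open scoped Classical

open ClockAutomaton TimedAutomaton

variable {L X E AP : Type*} [Fintype L] [Fintype E] [Finite X] {A : TimedAutomaton L X E AP}
  {s : Config L X} {e : ℕ → E} {p q : ℕ → ℝ≥0} {n i : ℕ} {S N : Set (ℕ → ℝ≥0)}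

/-- After a thick delay of `p`, the extensions of the delay sequences in the cell of `p` do not have
a larger dimension than the cell itself. -/
theorem dimH_extensions_le (hi : i < n) (hp : A.ThickAt s e p i) (hN : N ∈ 𝓝 p)
    (hNS : N ∩ A.cell s e p n ⊆ S) (hS : S ⊆ A.cell s e p n) :
    dimH (initSeg (i + 1) '' A.sem.extensions s e S i) ≤ dimH (initSeg (i + 1) '' S) := by
  have h1 := count_le_dimH (A := A) (s := s) (e := e)
    (eventually_exists_mem_cell (A := A) (s := s) (e := e) (Nat.succ_le_of_lt hi) hN) (i + 1)
  refine le_trans (dimH_le_count (A := A) (s := s) (e := e) (G := A.OpenAt s e p) (i + 1) ?_)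
    (h1.trans (dimH_mono ?_))
  · rintro q ⟨⟨q', hq', h2⟩, h3⟩ j hj hO
    have h4 : q ∈ A.cell s e p i :=
      (mem_cell_congr h2).2 (cell_mono hi.le (hS hq'))
    rcases Nat.lt_succ_iff_lt_or_eq.1 hj with hj | rfl
    · exact (openAt_iff_of_mem_cell h4 hj).2 hO
    · exact hp.resolve_right fun h5 =>
        h5 ((hasOpenDelay_iff_of_mem_cell h4 le_rfl).2 ⟨_, h3, hO⟩)
  · rintro _ ⟨q, ⟨h2, h3⟩, rfl⟩
    obtain ⟨q', h4, h5, h6⟩ := h2 h3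
    exact ⟨q', hNS ⟨h4, h5⟩, initSeg_eq_iff.2 h6⟩

/-- After a delay of `p` that is not thick, the extensions of the delay sequences of a set around
`p` have a larger dimension than the set itself, if `p` is generic in this set. -/
theorem dimH_lt_dimH_extensions (hi : i < n)
    (hp : ¬ A.ThickAt s e p i) (hN : N ∈ 𝓝 p) (hNS : N ∩ A.cell s e p n ⊆ S)
    (hS : ∀ q ∈ S, ∀ j < i + 1, A.OpenAt s e q j → A.OpenAt s e p j) :
    dimH (initSeg (i + 1) '' S) < dimH (initSeg (i + 1) '' A.sem.extensions s e S i) := by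
  obtain ⟨h1, h2⟩ := not_or.1 hp
  obtain ⟨t, ht, hI⟩ := not_not.1 h2
  obtain ⟨e', he'⟩ := mem_iUnion.1 ht
  -- `p'` follows `p` before time `i`, and then uses a delay into a region without integer clocks
  have hpp : ∀ j < i, Function.update p i t j = p j := fun j hj =>
    Function.update_of_ne hj.ne _ _
  set p' := Function.update p i t with hp'
  have hpi : p' i = t := Function.update_self ..
  have htraj : A.sem.traj s e p' i = A.sem.traj s e p i := traj_congr (fun _ _ => rfl) hpp
  have hN' : {q | Function.update q i (p i) ∈ {q | q ∈ A.cell s e p i →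
      ∃ q' ∈ N, q' ∈ A.cell s e p n ∧ ∀ j < i, q' j = q j}} ∈ 𝓝 p' := by
    have h3 : Continuous fun q : ℕ → ℝ≥0 => Function.update q i (p i) :=
      continuous_id.update i continuous_const
    refine h3.tendsto p' ?_
    have h4 : Function.update p' i (p i) = p := by simp [hp']
    rw [h4]
    exact eventually_exists_mem_cell hi.le hN
  have h3 := count_le_dimH (A := A) (s := s) (e := e) hN' (i + 1)
  have h4 : Nat.count (A.OpenAt s e p') (i + 1) = Nat.count (A.OpenAt s e p) i + 1 := by
    have h5 : A.OpenAt s e p' i := by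
      unfold OpenAt
      rwa [htraj, hpi]
    rw [Nat.count_succ, if_pos h5]
    congr 1
    refine le_antisymm (Nat.count_mono_left fun j hj => ?_) (Nat.count_mono_left fun j hj => ?_)
    · exact (openAt_congr fun k hk => hpp k (hk.trans_lt hj)).1
    · exact (openAt_congr fun k hk => hpp k (hk.trans_lt hj)).2
  have h5 : dimH (initSeg (i + 1) '' S) ≤ Nat.count (A.OpenAt s e p) i := by
    refine (dimH_le_count (i + 1) hS).trans (le_of_eq ?_)
    rw [Nat.count_succ, if_neg (show ¬ A.OpenAt s e p i from h1), add_zero]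
  refine h5.trans_lt (lt_of_lt_of_le ?_ (h3.trans (dimH_mono ?_)))
  · rw [h4]
    exact_mod_cast Nat.lt_succ_self _
  · rintro _ ⟨q, ⟨h6, h7⟩, rfl⟩
    have hqq : ∀ j < i, Function.update q i (p i) j = q j := fun j hj =>
      Function.update_of_ne hj.ne _ _
    have h8 : q ∈ A.cell s e p i := fun j hj => by
      have h9 := h7 j (hj.trans i.lt_succ_self)
      rwa [traj_congr (q' := p) (fun _ _ => rfl) (fun k hk => hpp k (hk.trans hj)), hpp j hj] at h9
    obtain ⟨q', h9, h10, h11⟩ := h6 ((mem_cell_congr hqq).2 h8)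
    refine ⟨q, ⟨⟨q', hNS ⟨h9, h10⟩, fun j hj => ?_⟩, mem_iUnion.2 ⟨e', ?_⟩⟩, rfl⟩
    · rw [h11 j hj, hqq j hj]
    · have h12 := h7 i i.lt_succ_self
      rw [htraj, hpi] at h12
      have h13 := mem_delaysOf_of_regionEquiv (l := (A.sem.traj s e p i).1)
        (regionEquiv_traj h8 le_rfl) h12 he'
      rwa [traj_fst A.sem s e p q] at h13

/-- A constraint that selects a part of the cell of `p`, and a neighbourhood of `p` within this
cell, defines a thick path if all the delays of `p` are thick. -/
theorem thickPath_of_subset_cell {C : Set (Fin n → ℝ≥0)}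
    (hp : ∀ i < n, A.ThickAt s e p i) (hN : N ∈ 𝓝 p)
    (hNS : N ∩ A.cell s e p n ⊆ {q | initSeg n q ∈ C ∧ A.sem.Valid s e q n})
    (hS : {q | initSeg n q ∈ C ∧ A.sem.Valid s e q n} ⊆ A.cell s e p n) :
    A.sem.ThickPath s n e C := by
  have hne : (A.sem.Pol s n e C).Nonempty := by
    rw [Pol_eq_image]
    exact ⟨_, p, hNS ⟨mem_of_mem_nhds hN, mem_cell_self⟩, rfl⟩
  unfold ThickPath
  rw [thinPath_iff hne]
  rintro ⟨i, hi, h⟩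
  exact h.not_ge (dimH_extensions_le hi (hp i hi) hN hNS hS)

/-! ### Paths of the region automaton -/

variable {f : ℕ → RegionEdge A}

omit [Finite X] in
theorem traj_regionAutomaton (h : A.regionAutomaton.Valid (A.iota s) f q n) :
    A.regionAutomaton.traj (A.iota s) f q n =
      A.iota (A.sem.traj s (fun i => (f i).edge) q n) := by
  induction n with
  | zero => rfl
  | succ n ih =>
    obtain ⟨h1, h2⟩ := valid_succ.1 h
    have h3 := ih h1
    rw [h3] at h2
    obtain ⟨h4, h5⟩ := (mem_delaysOf_regionAutomaton (q := A.regionLoc _) rfl).1 h2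
    simp only [traj]
    rw [h3]
    have h6 : (f n).src.1 = (A.sem.traj s (fun i => (f i).edge) q n).1 := congrArg Prod.fst h4
    have h7 := (mem_delaysOf_of_regionEdge (f := f n) (congrArg Prod.snd h4).symm h5).2
    rw [h6] at h7
    exact Prod.ext h7.symm rfl

omit [Finite X] in
theorem valid_regionAutomaton_iff : A.regionAutomaton.Valid (A.iota s) f q n ↔
    ∀ i < n, (f i).src = A.regionLoc (A.sem.traj s (fun i => (f i).edge) q i) ∧
      regionOf A.maxConst (delay (A.sem.traj s (fun i => (f i).edge) q i).2 (q i)) = (f i).mid := by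
  constructor
  · intro h i hi
    have h1 := h i hi
    rw [traj_regionAutomaton (h.mono hi.le)] at h1
    exact (mem_delaysOf_regionAutomaton (q := A.regionLoc _) rfl).1 h1
  · intro h
    induction n with
    | zero => exact fun i hi => absurd hi (Nat.not_lt_zero i)
    | succ n ih =>
      have h1 := ih fun i hi => h i (hi.trans n.lt_succ_self)
      refine valid_succ.2 ⟨h1, ?_⟩
      rw [traj_regionAutomaton h1]
      exact (mem_delaysOf_regionAutomaton (q := A.regionLoc _) rfl).2 (h n n.lt_succ_self)

omit [Finite X] in
theorem valid_of_valid_regionAutomaton (h : A.regionAutomaton.Valid (A.iota s) f q n) :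
    A.sem.Valid s (fun i => (f i).edge) q n := by
  intro i hi
  obtain ⟨h4, h5⟩ := valid_regionAutomaton_iff.1 h i hi
  have h6 : (f i).src.1 = (A.sem.traj s (fun i => (f i).edge) q i).1 := congrArg Prod.fst h4
  have h7 := (mem_delaysOf_of_regionEdge (f := f i) (congrArg Prod.snd h4).symm h5).1
  rwa [h6] at h7

omit [Finite X] in
/-- The polyhedra of the paths of the region automaton are the cells. -/
theorem setOf_valid_regionAutomaton (h : A.regionAutomaton.Valid (A.iota s) f p n) :
    {q | initSeg n q ∈ univ ∧ A.regionAutomaton.Valid (A.iota s) f q n} =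
      A.cell s (fun i => (f i).edge) p n := by
  have h1 := valid_regionAutomaton_iff.1 h
  ext q
  rw [mem_ofPred_eq, and_iff_right (mem_univ _)]
  refine ⟨fun hq i hi => regionOf_eq_iff.1 ?_, fun hq => valid_regionAutomaton_iff.2 fun i hi => ?_⟩
  · rw [(h1 i hi).2, (valid_regionAutomaton_iff.1 hq i hi).2]
  · rw [(h1 i hi).1, ← (h1 i hi).2]
    exact ⟨Prod.ext (traj_fst _ _ _ _ _ _) (regionOf_eq_iff.2 (regionEquiv_traj hq hi.le)),
      regionOf_eq_iff.2 (hq i hi).symm⟩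

/-- Thickness of a finite path of the region automaton can be read off from any of its runs: its
polyhedron is the cell of the run. -/
theorem thickPath_regionAutomaton_iff (h : A.regionAutomaton.Valid (A.iota s) f p n) :
    A.regionAutomaton.ThickPath (A.iota s) n f univ ↔
      ∀ i < n, A.ThickAt s (fun i => (f i).edge) p i := by
  have hne : (A.regionAutomaton.Pol (A.iota s) n f univ).Nonempty :=
    ⟨initSeg n p, initSeg_mem_Pol.2 ⟨mem_univ _, h⟩⟩
  have hext : ∀ i < n, A.regionAutomaton.extensions (A.iota s) f
      (A.cell s (fun i => (f i).edge) p n) i =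
      A.sem.extensions s (fun i => (f i).edge) (A.cell s (fun i => (f i).edge) p n) i := by
    intro i hi
    ext q
    refine and_congr_right fun ⟨q', hq', h1⟩ => ?_
    rw [← setOf_valid_regionAutomaton h] at hq'
    have h2 : A.regionAutomaton.Valid (A.iota s) f q i :=
      (hq'.2.mono hi.le).congr (fun _ _ => rfl) fun j hj => (h1 j hj).symm
    rw [traj_regionAutomaton h2]
    unfold TimedAutomaton.iota
    rw [delays_regionAutomaton (q := A.regionLoc _) rfl]
    rfl
  unfold ThickPath
  rw [thinPath_iff hne, setOf_valid_regionAutomaton h]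
  constructor
  · intro h1 i hi
    by_contra h2
    refine h1 ⟨i, hi, ?_⟩
    rw [hext i hi]
    refine dimH_lt_dimH_extensions hi h2 univ_mem
      inter_subset_right fun q hq j hj => ?_
    exact (openAt_iff_of_mem_cell hq (Nat.lt_of_lt_of_le hj hi)).2
  · rintro h1 ⟨i, hi, h2⟩
    rw [hext i hi] at h2
    exact h2.not_ge (dimH_extensions_le hi (h1 i hi) univ_mem inter_subset_right subset_rfl)

/-- All runs from `s` with thick delays only satisfy `P`. This is the common reformulation of the
other satisfaction relations. -/
def ThickRunsSatisfy (A : TimedAutomaton L X E AP) (s : Config L X) (P : Set (ℕ → Set AP)) : Prop :=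
  ∀ (e : ℕ → E) (q : ℕ → ℝ≥0), (∀ n, A.sem.Valid s e q n) → (∀ i, A.ThickAt s e q i) →
    (fun i => A.label (A.sem.traj s e q i).1) ∈ P

variable {P : Set (ℕ → Set AP)}

theorem thickInfPath_satisfy_iff :
    (∀ f : ℕ → RegionEdge A, A.regionAutomaton.ThickInfPath (A.iota s) f →
      ∀ ρ ∈ A.regionAutomaton.infPath (A.iota s) f, A.regionAutomaton.word ρ ∈ P) ↔
    ThickRunsSatisfy A s P := by
  constructor
  · intro h e q hv ht
    let f : ℕ → RegionEdge A := fun i => regionEdge (hv (i + 1) i i.lt_succ_self)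
    have hV : ∀ n, A.regionAutomaton.Valid (A.iota s) f q n := fun n =>
      valid_regionAutomaton_iff.2 fun i _ => ⟨rfl, rfl⟩
    have h1 := h f (fun n _ => (thickPath_regionAutomaton_iff (hV n)).2 fun i _ => ht i)
      (A.regionAutomaton.runOf (A.iota s) f q) ⟨runOf_mem_Runs hV, fun _ => rfl⟩
    convert h1 using 2 with i
    simp only [word, runOf]
    rw [traj_regionAutomaton (hV i)]
    rfl
  · rintro h f hf ρ ⟨hρ, hρf⟩
    have hff : (fun i => (ρ i).2.2) = f := funext hρf
    have hV := valid_of_mem_Runs hρ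
    rw [hff] at hV
    have h1 := h _ _ (fun n => valid_of_valid_regionAutomaton (hV n)) fun i =>
      (thickPath_regionAutomaton_iff (hV (i + 1))).1 (hf (i + 1) (Nat.le_add_left 1 i)) i
        i.lt_succ_self
    convert h1 using 2 with i
    simp only [word]
    rw [eq_traj_of_mem_Runs hρ, hff, traj_regionAutomaton (hV i)]
    rfl

omit [Fintype L] [Fintype E] [Finite X] in
/-- A strategy determines a run. -/
theorem exists_traj_of_strategy (A : TimedAutomaton L X E AP) (s : Config L X)
    (g : ℕ → Config L X → ℝ≥0 × E) :
    ∃ (e : ℕ → E) (q : ℕ → ℝ≥0), ∀ i, (q i, e i) = g i (A.sem.traj s e q i) := by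
  let c : ℕ → Config L X := fun i => Nat.rec s (fun i c => A.sem.next c (g i c).1 (g i c).2) i
  refine ⟨fun i => (g i (c i)).2, fun i => (g i (c i)).1, fun i => ?_⟩
  have : A.sem.traj s (fun i => (g i (c i)).2) (fun i => (g i (c i)).1) i = c i := by
    induction i with
    | zero => rfl
    | succ i ih => simp only [traj]; rw [ih]
  rw [this]

/-- Every path of the region automaton is followed by some run. -/
theorem exists_valid_of_path (hf : (f 0).src = A.regionLoc s)
    (hf' : ∀ i, (f i).tgt = (f (i + 1)).src) :
    ∃ q, ∀ n, A.regionAutomaton.Valid (A.iota s) f q n := by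
  have h1 : ∀ i c, ∃ t, (f i).src = A.regionLoc c →
      regionOf A.maxConst (delay c.2 t) = (f i).mid := by
    intro i c
    by_cases hc : (f i).src = A.regionLoc c
    · obtain ⟨v, v', t, h1, h2, h3, h4⟩ := (f i).exists_step
      rw [hc] at h1
      obtain ⟨t', ht'⟩ := (regionOf_eq_iff.1 h1).exists_delay t
      exact ⟨t', fun _ => (regionOf_eq_iff.2 ht'.symm).trans h3⟩
    · exact ⟨0, fun h => absurd h hc⟩
  choose g hg using h1
  obtain ⟨e, q, heq⟩ := exists_traj_of_strategy A s fun i c => (g i c, (f i).edge)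
  have he : e = fun i => (f i).edge := funext fun i => congrArg Prod.snd (heq i)
  subst he
  refine ⟨q, fun n => ?_⟩
  induction n with
  | zero => exact fun i hi => absurd hi (Nat.not_lt_zero i)
  | succ n ih =>
    refine valid_succ.2 ⟨ih, ?_⟩
    have h2 : (f n).src = A.regionLoc (A.sem.traj s (fun i => (f i).edge) q n) := by
      have h3 := congrArg Prod.fst (traj_regionAutomaton ih)
      cases n with
      | zero => exact hf
      | succ n => rw [← hf' n]; exact h3
    have h4 : q n = _ := congrArg Prod.fst (heq n)
    rw [traj_regionAutomaton ih, h4]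
    exact (mem_delaysOf_regionAutomaton (q := A.regionLoc _) rfl).2 ⟨h2, hg n _ h2⟩

theorem thickGraphPath_satisfy_iff :
    (∀ f : ℕ → ThickEdge A, IsThickGraphPath (A.regionLoc s) f →
      (fun i => A.regionAutomaton.label (f i).1.src) ∈ P) ↔ ThickRunsSatisfy A s P := by
  constructor
  · intro h e q hv ht
    exact h (fun i => ⟨regionEdge (hv (i + 1) i i.lt_succ_self),
      fun h => (thinEdge_regionEdge_iff _).1 h (ht i)⟩) ⟨rfl, fun _ => rfl⟩
  · rintro h f ⟨hf, hf'⟩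
    obtain ⟨q, hq⟩ := exists_valid_of_path hf hf'
    have hq' := fun i => valid_regionAutomaton_iff.1 (hq (i + 1)) i i.lt_succ_self
    have h1 := h _ _ (fun n => valid_of_valid_regionAutomaton (hq n)) fun i => by
      have h2 := (hq' i).1
      by_contra h3
      refine (f i).2 ((thinEdge_iff (congrArg Prod.snd h2).symm (hq' i).2).2 ?_)
      rwa [show (f i).1.src.1 = _ from congrArg Prod.fst h2]
    convert h1 using 2 with i
    rw [(hq' i).1]
    rfl

end Thick

/-! ### Thick points of basic open sets -/

section ThickPoints

open scoped Classical

open ClockAutomaton TimedAutomaton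

variable {L X E AP : Type*} {A : TimedAutomaton L X E AP}
  {s : Config L X} {e e' : ℕ → E} {p q q' : ℕ → ℝ≥0} {n i : ℕ}

/-- Polyhedra of paths are convex. -/
theorem valid_convexComb (hq : A.sem.Valid s e q n) (hq' : A.sem.Valid s e q' n) {a b : ℝ≥0}
    (hab : a + b = 1) : A.sem.Valid s e (fun j => a * q j + b * q' j) n := by
  intro i hi
  have h1 := mem_delaysOf_iff.1 (hq i hi)
  have h2 := mem_delaysOf_iff.1 (hq' i hi)
  rw [traj_fst A.sem s e q' q] at h2
  have h3 := traj_convexComb A.sem s e q q' hab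
  have h4 : delay (A.sem.traj s e (fun j => a * q j + b * q' j) i).2 (a * q i + b * q' i) =
      fun x => a * delay (A.sem.traj s e q i).2 (q i) x +
        b * delay (A.sem.traj s e q' i).2 (q' i) x := by
    funext x
    simp only [delay]
    rw [h3]
    ring
  rw [mem_delaysOf_iff, traj_fst A.sem s e _ q]
  refine ⟨h1.1, ?_, ?_, ?_, ?_⟩
  · rw [h3]; exact convexComb_mem_guardSet h1.2.1 h2.2.1 hab
  · rw [h4]; exact convexComb_mem_guardSet h1.2.2.1 h2.2.2.1 hab
  · rw [h4]; exact convexComb_mem_guardSet h1.2.2.2.1 h2.2.2.2.1 hab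
  · have := h3 (i + 1)
    simp only [traj, next] at this
    change resetTo (A.reset (e i)) _ = _ at this
    rw [this]
    exact convexComb_mem_guardSet h1.2.2.2.2 h2.2.2.2.2 hab

variable [Fintype L] [Fintype E] [Finite X]

omit [Fintype L] [Fintype E] [Finite X] in
theorem continuous_traj_prod (A : TimedAutomaton L X E AP) (s : Config L X) (e : ℕ → E) (i : ℕ) :
    Continuous fun q : ℕ → ℝ≥0 => ((A.sem.traj s e q i).2, q i) :=
  (continuous_traj A.sem s e i).prodMk (continuous_apply i)

theorem TimedAutomaton.OpenAt.eventually (h : A.OpenAt s e p i) : ∀ᶠ q in 𝓝 p, A.OpenAt s e q i :=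
  ((continuous_delay.comp (continuous_traj_prod A s e i)).tendsto p).eventually
    (NoInt.eventually h)

/-- On a segment, the clock values are affine functions, so if one end point of the segment avoids
the integer values at time `i`, then so do almost all of its points. -/
theorem TimedAutomaton.OpenAt.eventually_convexComb (h : A.OpenAt s e q i) :
    ∀ᶠ b in 𝓝[>] (0 : ℝ≥0), A.OpenAt s e (fun j => (1 - b) * p j + b * q j) i := by
  have h1 : ∀ x : X, ∀ k ∈ Finset.range (A.maxConst + 1), ∀ᶠ b : ℝ≥0 in 𝓝[>] 0,
      (1 - (b : ℝ)) * delay (A.sem.traj s e p i).2 (p i) x +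
        b * delay (A.sem.traj s e q i).2 (q i) x ≠ k := by
    intro x k hk
    have hq := h x k (Nat.lt_succ_iff.1 (Finset.mem_range.1 hk))
    by_cases hp : (delay (A.sem.traj s e p i).2 (p i) x : ℝ) = k
    · filter_upwards [self_mem_nhdsWithin] with b (hb : 0 < b) hc
      have hb' : (b : ℝ) ≠ 0 := by exact_mod_cast hb.ne'
      rw [hp] at hc
      refine hq (mul_left_cancel₀ hb' ?_)
      linarith
    · have hc : Continuous fun b : ℝ≥0 => (1 - (b : ℝ)) * delay (A.sem.traj s e p i).2 (p i) x +
        b * delay (A.sem.traj s e q i).2 (q i) x := by fun_prop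
      refine nhdsWithin_le_nhds (hc.continuousAt.eventually_ne ?_)
      simpa using hp
  have h2 : ∀ᶠ b in 𝓝[>] (0 : ℝ≥0), b ≤ 1 :=
    nhdsWithin_le_nhds (Iic_mem_nhds zero_lt_one)
  filter_upwards [h2, eventually_all.2 fun x => (Filter.eventually_all_finset _).2 (h1 x)]
    with b hb h3 x k hk
  have h4 := h3 x k (Finset.mem_range.2 (Nat.lt_succ_of_le hk))
  rw [traj_convexComb A.sem s e p q (tsub_add_cancel_of_le hb)]
  convert h4 using 1
  simp only [coe_delay, NNReal.coe_add, NNReal.coe_mul, NNReal.coe_sub hb, NNReal.coe_one]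
  ring

/-- A nonempty relatively open part of a thick constrained path contains a delay sequence all of
whose delays are thick. Such a delay sequence is obtained by maximizing the number of delays into
regions without integer clocks. By convexity, such a maximal sequence is generic among all the delay
sequences along the given edges. -/
theorem exists_thickAt_of_thickPath {C U : Set (Fin n → ℝ≥0)} (hU : IsOpen U)
    (hC : A.sem.ThickPath s n e C)
    (hUC : ∀ q, initSeg n q ∈ U → A.sem.Valid s e q n → initSeg n q ∈ C)
    (hqU : initSeg n q ∈ U) (hq : A.sem.Valid s e q n) :
    ∃ p, initSeg n p ∈ U ∧ A.sem.Valid s e p n ∧ ∀ i < n, A.ThickAt s e p i := by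
  let D : Set (ℕ → ℝ≥0) := {q | initSeg n q ∈ U ∧ A.sem.Valid s e q n}
  obtain ⟨p, ⟨hpU, hp⟩, hmax⟩ : ∃ p ∈ D, ∀ q ∈ D,
      Nat.count (A.OpenAt s e q) n ≤ Nat.count (A.OpenAt s e p) n := by
    obtain ⟨p, hp, hmin⟩ := (measure fun q : ℕ → ℝ≥0 => n - Nat.count (A.OpenAt s e q) n).wf.has_min
      D ⟨q, hqU, hq⟩
    refine ⟨p, hp, fun q hq => ?_⟩
    have h1 : ¬ (n - Nat.count (A.OpenAt s e q) n < n - Nat.count (A.OpenAt s e p) n) := hmin q hq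
    have h2 := Nat.count_le (p := A.OpenAt s e p) (n := n)
    have h3 := Nat.count_le (p := A.OpenAt s e q) (n := n)
    omega
  have hgen : ∀ q, A.sem.Valid s e q n → ∀ j < n, A.OpenAt s e q j → A.OpenAt s e p j := by
    intro q hq j hj hO
    by_contra hn
    have hlim : Tendsto (fun (b : ℝ≥0) j => (1 - b) * p j + b * q j) (𝓝[>] 0) (𝓝 p) := by
      have hc : Continuous fun (b : ℝ≥0) (j : ℕ) => (1 - b) * p j + b * q j := by fun_prop
      have := hc.tendsto 0
      simp only [tsub_zero, one_mul, zero_mul, add_zero] at this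
      exact this.mono_left nhdsWithin_le_nhds
    have h1 : ∀ᶠ b in 𝓝[>] (0 : ℝ≥0), b ≤ 1 := nhdsWithin_le_nhds (Iic_mem_nhds zero_lt_one)
    have h2 : ∀ᶠ b : ℝ≥0 in 𝓝[>] 0, ∀ i ∈ Finset.range n, A.OpenAt s e p i →
        A.OpenAt s e (fun j => (1 - b) * p j + b * q j) i := by
      refine (Filter.eventually_all_finset _).2 fun i _ => ?_
      by_cases hi : A.OpenAt s e p i
      · filter_upwards [hlim.eventually hi.eventually] with b hb _ using hb
      · simp [hi]
    have h3 := ((continuous_initSeg n).tendsto p).eventually (hU.mem_nhds hpU)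
    obtain ⟨b, hb, hb2, hb3, hb4⟩ := (h1.and (h2.and ((hO.eventually_convexComb (p := p)).and
      (hlim.eventually h3)))).exists
    have h4 := hmax _ ⟨hb4, valid_convexComb hp hq (tsub_add_cancel_of_le hb)⟩
    refine h4.not_gt ?_
    rw [Nat.count_eq_card_filter_range, Nat.count_eq_card_filter_range]
    refine Finset.card_lt_card ⟨fun i hi => ?_, fun hsub => hn ?_⟩
    · rw [Finset.mem_filter] at *
      exact ⟨hi.1, hb2 i hi.1 hi.2⟩
    · exact (Finset.mem_filter.1 (hsub (Finset.mem_filter.2 ⟨Finset.mem_range.2 hj, hb3⟩))).2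
  refine ⟨p, hpU, hp, fun i hi => ?_⟩
  by_contra hn
  have hne : (A.sem.Pol s n e C).Nonempty := by
    rw [Pol_eq_image]
    exact ⟨_, p, ⟨hUC p hpU hp, hp⟩, rfl⟩
  refine hC ((thinPath_iff hne).2 ⟨i, hi, ?_⟩)
  refine dimH_lt_dimH_extensions hi hn ((continuous_initSeg n).tendsto p (hU.mem_nhds hpU)) ?_ ?_
  · rintro q ⟨h1, h2⟩
    exact ⟨hUC q h1 (valid_of_mem_cell h2 hp), valid_of_mem_cell h2 hp⟩
  · exact fun q hq j hj => hgen q hq.2 j (Nat.lt_of_lt_of_le hj hi)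

/-- If all delays of `p` are thick, then the cell of `p` is open in the polyhedron of the path. -/
theorem eventually_mem_cell (hp : ∀ i < n, A.ThickAt s e p i) :
    ∀ᶠ q in 𝓝 p, A.sem.Valid s e q n → q ∈ A.cell s e p n := by
  induction n with
  | zero => exact Eventually.of_forall fun q _ i hi => absurd hi (Nat.not_lt_zero i)
  | succ n ih =>
    have hlim := (continuous_traj_prod A s e n).tendsto p
    have h1 := ih fun i hi => hp i (hi.trans n.lt_succ_self)
    rcases hp n n.lt_succ_self with hO | hO
    · filter_upwards [h1, hlim.eventually (NoInt.eventually_regionEquiv hO)] with q h2 h3 hq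
      have h4 := h2 (hq.mono n.le_succ)
      exact mem_cell_succ.2 ⟨h4, h3 (regionEquiv_traj h4 le_rfl)⟩
    · filter_upwards [h1, hlim.eventually (eventually_regionEquiv_of_not_noInt (K := A.maxConst)
        _ _)] with q h2 h3 hq
      have h4 := h2 (hq.mono n.le_succ)
      refine mem_cell_succ.2 ⟨h4, h3 (regionEquiv_traj h4 le_rfl) fun hI => hO ?_⟩
      exact (hasOpenDelay_iff_of_mem_cell h4 le_rfl).2
        ⟨_, mem_iUnion.2 ⟨_, hq n n.lt_succ_self⟩, hI⟩

omit [Finite X] in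
/-- A finite thick path can be continued to an infinite one. -/
theorem exists_thick_extension (hA : A.sem.NonBlocking) (hs : A.sem.IsState s)
    (hv : A.sem.Valid s e p n) (hp : ∀ i < n, A.ThickAt s e p i) :
    ∃ e' p', (∀ i < n, e' i = e i) ∧ (∀ i < n, p' i = p i) ∧ (∀ m, A.sem.Valid s e' p' m) ∧
      ∀ i, A.ThickAt s e' p' i := by
  have h1 : ∀ c : Config L X, ∃ z : ℝ≥0 × E, A.sem.IsState c →
      z.1 ∈ A.sem.delaysOf c z.2 ∧ A.ThickDelay c z.1 := by
    intro c
    by_cases hc : A.sem.IsState c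
    · obtain ⟨e, t, h1, h2⟩ := exists_thickDelay hA hc
      exact ⟨(t, e), fun _ => ⟨h1, h2⟩⟩
    · exact ⟨(0, e 0), fun h => absurd h hc⟩
  choose g hg using h1
  obtain ⟨e', p', h2⟩ := exists_traj_of_strategy A s fun i c => if i < n then (p i, e i) else g c
  have he : ∀ i < n, e' i = e i := fun i hi => by
    have := h2 i; rw [if_pos hi] at this; exact congrArg Prod.snd this
  have hp' : ∀ i < n, p' i = p i := fun i hi => by
    have := h2 i; rw [if_pos hi] at this; exact congrArg Prod.fst this
  have htr : ∀ i ≤ n, A.sem.traj s e' p' i = A.sem.traj s e p i := fun i hi =>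
    traj_congr (fun j hj => he j (hj.trans_le hi)) fun j hj => hp' j (hj.trans_le hi)
  have h3 : ∀ i, A.sem.IsState (A.sem.traj s e' p' i) →
      p' i ∈ A.sem.delaysOf (A.sem.traj s e' p' i) (e' i) ∧ A.ThickAt s e' p' i := by
    intro i hi
    by_cases hin : i < n
    · unfold ThickAt
      rw [htr i hin.le, he i hin, hp' i hin]
      exact ⟨hv i hin, hp i hin⟩
    · have h4 := h2 i
      rw [if_neg hin] at h4
      have h5 := hg _ hi
      rw [← h4] at h5
      exact h5
  have h4 : ∀ m, A.sem.Valid s e' p' m := by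
    intro m
    induction m with
    | zero => exact fun i hi => absurd hi (Nat.not_lt_zero i)
    | succ m ih => exact valid_succ.2 ⟨ih, (h3 m (ih.isState hs le_rfl)).1⟩
  exact ⟨e', p', he, hp', h4, fun i => (h3 i ((h4 i).isState hs le_rfl)).2⟩

omit [Fintype L] [Fintype E] [Finite X] in
theorem exists_isOpen_initSeg {P : (ℕ → ℝ≥0) → Prop} (h : ∀ᶠ q in 𝓝 p, P q)
    (hP : ∀ q q', (∀ i < n, q i = q' i) → P q → P q') :
    ∃ U : Set (Fin n → ℝ≥0), IsOpen U ∧ initSeg n p ∈ U ∧ ∀ q, initSeg n q ∈ U → P q := by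
  let g : (Fin n → ℝ≥0) → ℕ → ℝ≥0 := fun τ i => if h : i < n then τ ⟨i, h⟩ else p i
  have hg : Continuous g := by
    refine continuous_pi fun i => ?_
    by_cases hi : i < n
    · simp only [g, hi, dif_pos]; exact continuous_apply _
    · simp only [g, hi, dif_neg, not_false_iff]; exact continuous_const
  have hgp : g (initSeg n p) = p := by
    funext i
    simp [g, initSeg]
  have h1 : ∀ᶠ τ in 𝓝 (initSeg n p), P (g τ) := by
    refine (hg.tendsto _).eventually ?_
    rwa [hgp]
  obtain ⟨U, hU1, hU2, hU3⟩ := eventually_nhds_iff.1 h1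
  refine ⟨U, hU2, hU3, fun q hq => hP _ _ (fun i hi => ?_) (hU1 _ hq)⟩
  simp [g, hi, initSeg]

/-! ### The topology on runs -/

/-- The set `U` isolates the cell of the thick infinite path `(e, p)` among the delay sequences of
length `n` along `e`. The cylinders of such sets are basic open sets of the space of runs, and every
nonempty open set contains one of them (see `exists_isolating_cyl_subset`). -/
structure Isolates (A : TimedAutomaton L X E AP) (s : Config L X) (n : ℕ) (e : ℕ → E)
    (p : ℕ → ℝ≥0) (U : Set (Fin n → ℝ≥0)) : Prop where
  isOpen : IsOpen U
  mem : initSeg n p ∈ U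
  valid : ∀ m, A.sem.Valid s e p m
  thick : ∀ i, A.ThickAt s e p i
  cell : ∀ q, initSeg n q ∈ U → A.sem.Valid s e q n → q ∈ A.cell s e p n

omit [Finite X] in
theorem Isolates.mono {U V : Set (Fin n → ℝ≥0)} (h : Isolates A s n e p U) (hV : IsOpen V)
    (hp : initSeg n p ∈ V) : Isolates A s n e p (V ∩ U) :=
  ⟨hV.inter h.isOpen, ⟨hp, h.mem⟩, h.valid, h.thick, fun q hq => h.cell q hq.2⟩

theorem exists_isolates (n : ℕ) (hv : ∀ m, A.sem.Valid s e p m) (hp : ∀ i, A.ThickAt s e p i) :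
    ∃ U, Isolates A s n e p U := by
  obtain ⟨U, h1, h2, h3⟩ := exists_isOpen_initSeg (eventually_mem_cell (n := n) fun i _ => hp i)
    fun q q' h h4 h5 => (mem_cell_congr h).1
      (h4 (h5.congr (fun _ _ => rfl) fun i hi => (h i hi).symm))
  exact ⟨U, h1, h2, hv, hp, h3⟩

theorem Isolates.isOpen_cyl {U : Set (Fin n → ℝ≥0)} (h : Isolates A s n e p U) :
    IsOpen[A.sem.runTopology s] (A.sem.cyl s n e U) := by
  refine TopologicalSpace.isOpen_generateFrom_of_mem (Or.inr (Or.inr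
    ⟨n, e, U, ?_, h.isOpen.measurableSet, ⟨U, h.isOpen, ?_⟩, rfl⟩))
  · refine thickPath_of_subset_cell (p := p) (N := initSeg n ⁻¹' U) (fun i _ => h.thick i)
      ((continuous_initSeg n).tendsto p (h.isOpen.mem_nhds h.mem)) ?_ fun q hq => h.cell q hq.1 hq.2
    exact fun q hq => ⟨hq.1, valid_of_mem_cell hq.2 (h.valid n)⟩
  · ext τ
    exact ⟨fun hτ => ⟨hτ.1, mem_univ _, hτ.2⟩, fun hτ => ⟨hτ.1, hτ.2.2⟩⟩

omit [Finite X] in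
theorem Isolates.runOf_mem_cyl {U : Set (Fin n → ℝ≥0)} (h : Isolates A s n e p U) :
    (⟨A.sem.runOf s e p, runOf_mem_Runs h.valid⟩ : A.sem.Runs s) ∈ A.sem.cyl s n e U :=
  ⟨fun _ _ => rfl, h.mem⟩

theorem thickAt_of_mem_cyl {U : Set (Fin n → ℝ≥0)} (h : Isolates A s n e p U) {ρ : A.sem.Runs s}
    (hρ : ρ ∈ A.sem.cyl s n e U) (hi : i < n) :
    A.ThickAt s (fun i => (ρ.1 i).2.2) (fun i => (ρ.1 i).2.1) i := by
  have h1 : ∀ j < n, (fun i => (ρ.1 i).2.2) j = e j := hρ.1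
  have h2 := h.cell (fun i => (ρ.1 i).2.1) hρ.2
    ((valid_of_mem_Runs ρ.2 n).congr h1 fun _ _ => rfl)
  have h3 := (thickAt_iff_of_mem_cell h2 hi).1 (h.thick i)
  unfold ThickAt
  rw [traj_congr (fun j hj => h1 j (hj.trans hi)) fun _ _ => rfl]
  exact h3

omit [Fintype L] [Fintype E] [Finite X] in
/-- Around each of its points, an open set of runs contains the cylinder of a relatively open subset
of a thick constrained path: among finitely many basic open sets, the one with the longest path is
sufficient for thickness. -/
theorem exists_thickPath_of_isOpen {W : Set (A.sem.Runs s)} (hW : IsOpen[A.sem.runTopology s] W)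
    {ρ : A.sem.Runs s} (hρ : ρ ∈ W) :
    ∃ (n : ℕ) (e : ℕ → E) (U C : Set (Fin n → ℝ≥0)), IsOpen U ∧ A.sem.ThickPath s n e C ∧
      (∀ q, initSeg n q ∈ U → A.sem.Valid s e q n → initSeg n q ∈ C) ∧
      ρ ∈ A.sem.cyl s n e U ∧ A.sem.cyl s n e U ⊆ W := by
  induction hW with
  | univ =>
    refine ⟨0, fun i => (ρ.1 i).2.2, univ, univ, isOpen_univ, ?_, fun _ _ _ => mem_univ _,
      ⟨fun _ _ => rfl, mem_univ _⟩, subset_univ _⟩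
    rintro ⟨i, hi, -⟩
    exact absurd hi (Nat.not_lt_zero i)
  | basic B hB =>
    rcases hB with rfl | rfl | ⟨n, e, C, h1, -, ⟨U, hU, h2⟩, rfl⟩
    · refine ⟨0, fun i => (ρ.1 i).2.2, univ, univ, isOpen_univ, ?_, fun _ _ _ => mem_univ _,
        ⟨fun _ _ => rfl, mem_univ _⟩, subset_univ _⟩
      rintro ⟨i, hi, -⟩
      exact absurd hi (Nat.not_lt_zero i)
    · exact absurd hρ (notMem_empty ρ)
    · have h3 : ∀ q, A.sem.Valid s e q n → (initSeg n q ∈ C ↔ initSeg n q ∈ U) := by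
        intro q hq
        have h4 : initSeg n q ∈ A.sem.Pol s n e C ↔ initSeg n q ∈ U ∩ A.sem.Pol s n e univ := by
          rw [h2]
        rw [mem_inter_iff, initSeg_mem_Pol, initSeg_mem_Pol] at h4
        simpa [hq] using h4
      have h4 : ∀ ρ : A.sem.Runs s, (∀ i < n, (ρ.1 i).2.2 = e i) →
          A.sem.Valid s e (fun i => (ρ.1 i).2.1) n := fun ρ h =>
        (valid_of_mem_Runs ρ.2 n).congr h fun _ _ => rfl
      refine ⟨n, e, U, C, hU, h1, fun q hq hv => (h3 q hv).2 hq,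
        ⟨hρ.1, (h3 _ (h4 ρ hρ.1)).1 hρ.2⟩, fun ρ' h5 => ⟨h5.1, (h3 _ (h4 ρ' h5.1)).2 h5.2⟩⟩
  | inter W₁ W₂ _ _ ih₁ ih₂ =>
    obtain ⟨n₁, e₁, U₁, C₁, a1, a2, a3, a4, a5⟩ := ih₁ hρ.1
    obtain ⟨n₂, e₂, U₂, C₂, b1, b2, b3, b4, b5⟩ := ih₂ hρ.2
    have key : ∀ {n₁ n₂ : ℕ} {e₁ e₂ : ℕ → E} {U₁ C₁ : Set (Fin n₁ → ℝ≥0)}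
        {U₂ : Set (Fin n₂ → ℝ≥0)},
        n₂ ≤ n₁ → IsOpen U₁ → A.sem.ThickPath s n₁ e₁ C₁ →
        (∀ q, initSeg n₁ q ∈ U₁ → A.sem.Valid s e₁ q n₁ → initSeg n₁ q ∈ C₁) →
        ρ ∈ A.sem.cyl s n₁ e₁ U₁ → IsOpen U₂ → ρ ∈ A.sem.cyl s n₂ e₂ U₂ →
        ∃ (n : ℕ) (e : ℕ → E) (U C : Set (Fin n → ℝ≥0)), IsOpen U ∧ A.sem.ThickPath s n e C ∧
          (∀ q, initSeg n q ∈ U → A.sem.Valid s e q n → initSeg n q ∈ C) ∧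
          ρ ∈ A.sem.cyl s n e U ∧
          A.sem.cyl s n e U ⊆ A.sem.cyl s n₁ e₁ U₁ ∩ A.sem.cyl s n₂ e₂ U₂ := by
      intro n₁ n₂ e₁ e₂ U₁ C₁ U₂ hle a1 a2 a3 a4 b1 b4
      have hc : Continuous fun (τ : Fin n₁ → ℝ≥0) (i : Fin n₂) => τ (Fin.castLE hle i) := by
        fun_prop
      refine ⟨n₁, e₁, U₁ ∩ (fun τ i => τ (Fin.castLE hle i)) ⁻¹' U₂, C₁, a1.inter (b1.preimage hc),
        a2, fun q hq => a3 q hq.1, ⟨a4.1, a4.2, b4.2⟩, fun ρ' h => ⟨⟨h.1, h.2.1⟩, ⟨?_, h.2.2⟩⟩⟩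
      intro i hi
      rw [h.1 i (hi.trans_le hle), ← a4.1 i (hi.trans_le hle), b4.1 i hi]
    rcases le_total n₂ n₁ with h | h
    · obtain ⟨n, e, U, C, c1, c2, c3, c4, c5⟩ := key h a1 a2 a3 a4 b1 b4
      exact ⟨n, e, U, C, c1, c2, c3, c4, c5.trans (inter_subset_inter a5 b5)⟩
    · obtain ⟨n, e, U, C, c1, c2, c3, c4, c5⟩ := key h b1 b2 b3 b4 a1 a4
      exact ⟨n, e, U, C, c1, c2, c3, c4,
        (c5.trans (inter_subset_inter b5 a5)).trans (inter_comm _ _).subset⟩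
  | sUnion S _ ih =>
    obtain ⟨W', hW', hρ'⟩ := hρ
    obtain ⟨n, e, U, C, c1, c2, c3, c4, c5⟩ := ih W' hW' hρ'
    exact ⟨n, e, U, C, c1, c2, c3, c4, c5.trans (subset_sUnion_of_mem hW')⟩

/-- The cylinders of isolating sets form a pseudo-base: the open set contains the cylinder of a
thick constrained path, this path contains a delay sequence with thick delays only, and that sequence has
an infinite thick continuation. -/
theorem exists_isolating_cyl_subset (hA : A.sem.NonBlocking) (hs : A.sem.IsState s)
    {W : Set (A.sem.Runs s)} (hW : IsOpen[A.sem.runTopology s] W) (hne : W.Nonempty) (N : ℕ) :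
    ∃ n ≥ N, ∃ e p U, Isolates A s n e p U ∧ A.sem.cyl s n e U ⊆ W := by
  obtain ⟨ρ, hρ⟩ := hne
  obtain ⟨n, e, U, C, h1, h2, h3, h4, h5⟩ := exists_thickPath_of_isOpen hW hρ
  obtain ⟨p, hpU, hp, hpt⟩ := exists_thickAt_of_thickPath h1 h2 h3
    (q := fun i => (ρ.1 i).2.1) h4.2
    ((valid_of_mem_Runs ρ.2 n).congr (fun i hi => h4.1 i hi) fun _ _ => rfl)
  obtain ⟨e', p', he, hpp, hv', ht'⟩ := exists_thick_extension hA hs hp hpt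
  obtain ⟨U', hU'⟩ := exists_isolates (max n N) hv' ht'
  have hc : Continuous fun (τ : Fin (max n N) → ℝ≥0) (i : Fin n) =>
      τ (Fin.castLE (le_max_left n N) i) := by fun_prop
  refine ⟨max n N, le_max_right n N, e', p', _, hU'.mono (h1.preimage hc) ?_, fun ρ' hρ' => h5 ?_⟩
  · have : initSeg n p' = initSeg n p := initSeg_eq_iff.2 hpp
    rw [← this] at hpU
    exact hpU
  · refine ⟨fun i hi => ?_, hρ'.2.1⟩
    rw [hρ'.1 i (hi.trans_le (le_max_left n N)), he i hi]

end ThickPoints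

/-! ### Large satisfaction -/

section Large

open ClockAutomaton TimedAutomaton

variable {L X E AP : Type*} [Fintype L] [Fintype E] [Finite X] {A : TimedAutomaton L X E AP}
  {s : Config L X} {e : ℕ → E} {p : ℕ → ℝ≥0} {n : ℕ} {P : Set (ℕ → Set AP)}

theorem isNowhereDense_of_forall_exists {α : Type*} [TopologicalSpace α] {S : Set α}
    (h : ∀ W : Set α, IsOpen W → W.Nonempty → ∃ W' ⊆ W, IsOpen W' ∧ W'.Nonempty ∧ Disjoint W' S) :
    IsNowhereDense S := by
  rw [IsNowhereDense, ← not_nonempty_iff_eq_empty]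
  intro hne
  obtain ⟨W', h1, h2, h3, h4⟩ := h _ isOpen_interior hne
  obtain ⟨x, hx⟩ := h3
  have h5 : x ∈ closure S := interior_subset (h1 hx)
  exact (h4.closure_right h2).le_bot ⟨hx, h5⟩

theorem IsNowhereDense.exists_isOpen_subset {α : Type*} [TopologicalSpace α] {S : Set α}
    (h : IsNowhereDense S) {W : Set α} (hW : IsOpen W) (hne : W.Nonempty) :
    ∃ W' ⊆ W, IsOpen W' ∧ W'.Nonempty ∧ Disjoint W' S := by
  refine ⟨W \ closure S, sdiff_subset, hW.sdiff isClosed_closure, ?_,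
    disjoint_sdiff_left.mono_right subset_closure⟩
  by_contra hc
  rw [not_nonempty_iff_eq_empty, sdiff_eq_empty] at hc
  have h1 := interior_maximal hc hW
  rw [h] at h1
  exact hne.not_subset_empty h1

/-- Almost all runs, in the sense of category, have thick delays only: the runs with a delay before
time `N` that is not thick are nowhere dense, since they avoid the cylinders of isolating sets of
length at least `N`. -/
theorem ThickRunsSatisfy.largelySatisfies (hA : A.sem.NonBlocking) (hs : A.sem.IsState s)
    (h : ThickRunsSatisfy A s P) : A.sem.LargelySatisfies s P := by
  let _ := A.sem.runTopology s
  have h1 : ∀ N : ℕ, IsMeagre {ρ : A.sem.Runs s | ¬ ∀ i < N,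
      A.ThickAt s (fun i => (ρ.1 i).2.2) (fun i => (ρ.1 i).2.1) i} := by
    intro N
    refine (isNowhereDense_of_forall_exists fun W hW hne => ?_).isMeagre
    obtain ⟨n, hn, e, p, U, hU, hsub⟩ := exists_isolating_cyl_subset hA hs hW hne N
    refine ⟨_, hsub, hU.isOpen_cyl, ⟨_, hU.runOf_mem_cyl⟩, ?_⟩
    exact disjoint_left.2 fun ρ hρ h2 => h2 fun i hi => thickAt_of_mem_cyl hU hρ (hi.trans_le hn)
  refine (isMeagre_iUnion h1).mono fun ρ hρ => ?_
  by_contra hn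
  simp only [mem_iUnion, mem_ofPred_eq, not_exists, not_not] at hn
  refine hρ ?_
  have h2 := h _ _ (valid_of_mem_Runs ρ.2) fun i => hn (i + 1) i i.lt_succ_self
  change A.sem.word ρ.1 ∈ P
  convert h2 using 2 with i
  unfold word
  rw [eq_traj_of_mem_Runs ρ.2]
  rfl

/-- A `Gδ` subset of a Polish space is a Baire space, as it is a dense `Gδ` subset of its
closure. -/
theorem baireSpace_of_isGδ {α : Type*} [TopologicalSpace α] [PolishSpace α] {S : Set α}
    (hS : IsGδ S) : BaireSpace S := by
  have : PolishSpace (closure S) := isClosed_closure.polishSpace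
  have : BaireSpace ((↑) ⁻¹' S : Set (closure S)) :=
    (hS.preimage continuous_subtype_val).baireSpace_of_dense
      (by simp [Subtype.dense_iff, inter_eq_right.mpr subset_closure])
  have h : Homeomorph ((↑) ⁻¹' S : Set (closure S)) S := ⟨⟨fun x => ⟨x, x.2⟩,
    fun x => ⟨⟨x, subset_closure x.2⟩, x.2⟩, by grind, by grind⟩, by fun_prop, by fun_prop⟩
  exact h.baireSpace

/-- The pairs of delay and edge sequences that define runs from `s` all of whose delays are
thick. -/
def thickSeqs (A : TimedAutomaton L X E AP) (s : Config L X) : Set (ℕ → ℝ≥0 × E) :=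
  {w | (∀ n, A.sem.Valid s (fun j => (w j).2) (fun j => (w j).1) n) ∧
    ∀ i, A.ThickAt s (fun j => (w j).2) (fun j => (w j).1) i}

section Discrete

variable [TopologicalSpace E] [DiscreteTopology E]

omit [Fintype L] [Fintype E] [Finite X] in
theorem continuous_traj_pair (A : TimedAutomaton L X E AP) (s : Config L X) (i : ℕ) :
    Continuous fun w : ℕ → ℝ≥0 × E =>
      (A.sem.traj s (fun j => (w j).2) (fun j => (w j).1) i).2 := by
  induction i with
  | zero => exact (continuous_const : Continuous fun _ : ℕ → ℝ≥0 × E => s.2)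
  | succ i ih =>
    have h1 : Continuous fun z : E × Val X => resetTo (A.sem.reset z.1) z.2 :=
      continuous_prod_of_discrete_left.2 fun e => continuous_resetTo (A.sem.reset e)
    have h2 : Continuous fun w : ℕ → ℝ≥0 × E => (w i).2 := by fun_prop
    have h3 : Continuous fun w : ℕ → ℝ≥0 × E => (w i).1 := by fun_prop
    exact h1.comp (h2.prodMk (continuous_delay.comp (ih.prodMk h3)))

omit [Fintype L] [Fintype E] [Finite X] in
theorem isOpen_traj_fst (A : TimedAutomaton L X E AP) (s : Config L X) (i : ℕ) (l : L) :
    IsOpen {w : ℕ → ℝ≥0 × E | (A.sem.traj s (fun j => (w j).2) (fun j => (w j).1) i).1 = l} := by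
  cases i with
  | zero => exact isOpen_const (p := s.1 = l)
  | succ i =>
    have h2 : Continuous fun w : ℕ → ℝ≥0 × E => (w i).2 := by fun_prop
    exact (isOpen_discrete {e | A.tgt e = l}).preimage h2

theorem isGδ_thickSeqs (A : TimedAutomaton L X E AP) (s : Config L X) :
    IsGδ (thickSeqs A s) := by
  let c : (ℕ → ℝ≥0 × E) → ℕ → Config L X := fun w =>
    A.sem.traj s (fun j => (w j).2) (fun j => (w j).1)
  -- whether the `i`-th step is possible and thick depends on the regions before the step and
  -- before the reset only
  let T : ℕ → Set (ℕ → ℝ≥0 × E) := fun i =>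
    {w | (w i).1 ∈ A.sem.delaysOf (c w i) (w i).2 ∧ A.ThickDelay (c w i) (w i).1}
  let code : ℕ → (ℕ → ℝ≥0 × E) → (E × L) × Region X A.maxConst × Region X A.maxConst := fun i w =>
    (((w i).2, (c w i).1), regionOf _ (c w i).2, regionOf _ (delay (c w i).2 (w i).1))
  have hT : ∀ i, T i = ⋃ κ ∈ code i '' T i, {w | code i w = κ} := by
    intro i
    ext w
    simp only [mem_iUnion, mem_ofPred_eq, exists_prop, exists_eq_right']
    refine ⟨fun hw => ⟨w, hw, rfl⟩, ?_⟩
    rintro ⟨w', ⟨h1, h2⟩, h3⟩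
    simp only [code, Prod.mk.injEq] at h3
    obtain ⟨⟨h4, h5⟩, h6, h7⟩ := h3
    rw [regionOf_eq_iff] at h6 h7
    rw [h4] at h1
    change _ ∈ A.sem.delaysOf (c w i) _ ∧ A.ThickDelay (c w i) _
    have h8 : c w i = ((c w' i).1, (c w i).2) := Prod.ext h5.symm rfl
    rw [h8]
    exact ⟨mem_delaysOf_of_regionEquiv h6 h7 h1, (thickDelay_iff_of_regionEquiv h6 h7).1 h2⟩
  have hreg : ∀ {f : (ℕ → ℝ≥0 × E) → Val X}, Continuous f → ∀ r : Region X A.maxConst,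
      IsGδ {w | regionOf _ (f w) = r} := by
    intro f hf r
    obtain ⟨v, rfl⟩ := exists_regionOf_eq r
    simp only [eq_comm (b := regionOf _ v), regionOf_eq_iff]
    exact (isGδ_regionEquiv v).preimage hf
  have hTG : ∀ i, IsGδ (T i) := by
    intro i
    rw [hT i]
    refine IsGδ.biUnion (toFinite _) fun κ _ => ?_
    obtain ⟨⟨ε, l⟩, r, r'⟩ := κ
    have h2 : Continuous fun w : ℕ → ℝ≥0 × E => (w i).2 := by fun_prop
    have h3 : Continuous fun w : ℕ → ℝ≥0 × E => (w i).1 := by fun_prop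
    have : {w | code i w = ((ε, l), r, r')} = ({w | (w i).2 = ε} ∩ {w | (c w i).1 = l}) ∩
        ({w | regionOf _ (c w i).2 = r} ∩ {w | regionOf _ (delay (c w i).2 (w i).1) = r'}) := by
      ext w
      simp only [code, Prod.mk.injEq, mem_inter_iff, mem_ofPred_eq]
    rw [this]
    refine (IsOpen.isGδ ?_).inter ((hreg (continuous_traj_pair A s i) r).inter (hreg ?_ r'))
    · exact ((isOpen_discrete {ε}).preimage h2).inter (isOpen_traj_fst A s i l)
    · exact continuous_delay.comp ((continuous_traj_pair A s i).prodMk h3)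
  have : thickSeqs A s = ⋂ i, T i := by
    ext w
    rw [mem_iInter]
    exact ⟨fun h i => ⟨h.1 (i + 1) i i.lt_succ_self, h.2 i⟩,
      fun h => ⟨fun n i _ => (h i).1, fun i => (h i).2⟩⟩
  rw [this]
  exact IsGδ.iInter hTG

end Discrete

/-- Basic open sets are not meagre. The runs with thick delays form a Baire space for the product
topology, and nowhere dense sets of runs are nowhere dense in this space, since both topologies have
the cylinders of isolating sets as a pseudo-base. -/
theorem Isolates.not_isMeagre (hA : A.sem.NonBlocking) (hs : A.sem.IsState s)
    {U : Set (Fin n → ℝ≥0)} (hU : Isolates A s n e p U) :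
    letI := A.sem.runTopology s
    ¬ IsMeagre (A.sem.cyl s n e U) := by
  let _ := A.sem.runTopology s
  let _ : TopologicalSpace E := ⊥
  have _ : DiscreteTopology E := ⟨rfl⟩
  have _ : BaireSpace (thickSeqs A s) := baireSpace_of_isGδ (isGδ_thickSeqs A s)
  let run : thickSeqs A s → A.sem.Runs s := fun w => ⟨_, runOf_mem_Runs w.2.1⟩
  have hcont : ∀ n, Continuous fun w : thickSeqs A s => initSeg n fun j => (w.1 j).1 := fun n =>
    (continuous_initSeg n).comp
      (continuous_pi fun j => ((continuous_apply j).comp continuous_subtype_val).fst)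
  -- cylinders are open in the product topology
  have hopen : ∀ {n : ℕ} (e : ℕ → E) {U : Set (Fin n → ℝ≥0)}, IsOpen U →
      IsOpen (run ⁻¹' A.sem.cyl s n e U) := by
    intro n e U hU
    have : run ⁻¹' A.sem.cyl s n e U = (⋂ i : Fin n, {w | (w.1 i).2 = e i}) ∩
        (fun w : thickSeqs A s => initSeg n fun j => (w.1 j).1) ⁻¹' U := by
      ext w
      simp only [mem_inter_iff, mem_iInter, mem_preimage, mem_ofPred_eq]
      exact and_congr ⟨fun h i => h i i.2, fun h i hi => h ⟨i, hi⟩⟩ Iff.rfl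
    rw [this]
    refine (isOpen_iInter_of_finite fun i => ?_).inter (hU.preimage (hcont n))
    have h1 : Continuous fun w : thickSeqs A s => (w.1 i).2 :=
      ((continuous_apply _).comp continuous_subtype_val).snd
    exact (isOpen_discrete {e i}).preimage h1
  have hmem : ∀ {n : ℕ} {e : ℕ → E} {p : ℕ → ℝ≥0} {U : Set (Fin n → ℝ≥0)},
      Isolates A s n e p U → (run ⁻¹' A.sem.cyl s n e U).Nonempty := fun {n e p U} hU =>
    ⟨⟨fun j => (p j, e j), hU.valid, hU.thick⟩, hU.runOf_mem_cyl⟩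
  have hnd : ∀ S : Set (A.sem.Runs s), IsNowhereDense S → IsNowhereDense (run ⁻¹' S) := by
    intro S hS
    refine isNowhereDense_of_forall_exists fun O hO ⟨w, hw⟩ => ?_
    -- `O` contains a cylinder around `w`
    obtain ⟨O', hO', rfl⟩ := isOpen_induced_iff.1 hO
    obtain ⟨I, u, hu, hsub⟩ := isOpen_pi_iff.1 hO' w.1 hw
    obtain ⟨m, hm⟩ : ∃ m, ∀ i ∈ I, i < m := ⟨I.sup id + 1, fun i hi =>
      Nat.lt_succ_of_le (Finset.le_sup (f := id) hi)⟩
    obtain ⟨V, hV⟩ := exists_isolates m w.2.1 w.2.2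
    have hV₀ : IsOpen {τ : Fin m → ℝ≥0 | ∀ i : Fin m, i.1 ∈ I → (τ i, (w.1 i).2) ∈ u i} := by
      simp only [ofPred_forall]
      refine isOpen_iInter_of_finite fun i => isOpen_iInter_of_finite fun hi => ?_
      exact (hu i hi).1.preimage ((continuous_apply i).prodMk continuous_const)
    have hV' := hV.mono hV₀ fun i hi => (hu i hi).2
    obtain ⟨W, hWsub, hW, hWne, hWS⟩ :=
      IsNowhereDense.exists_isOpen_subset hS hV'.isOpen_cyl ⟨_, hV'.runOf_mem_cyl⟩
    obtain ⟨n', -, e', p', U', hU', hsub'⟩ := exists_isolating_cyl_subset hA hs hW hWne 0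
    refine ⟨_, fun w' hw' => hsub fun i hi => ?_, hopen e' hU'.isOpen, hmem hU',
      (hWS.mono_left hsub').preimage run⟩
    have h1 := hWsub (hsub' hw')
    have h2 := h1.2.1 ⟨i, hm i hi⟩ hi
    have h3 : (w'.1 i).2 = (w.1 i).2 := h1.1 i (hm i hi)
    rw [← h3] at h2
    exact h2
  intro hM
  refine not_isMeagre_of_isOpen (hopen e hU.isOpen) (hmem hU) ?_
  rw [isMeagre_iff_countable_union_isNowhereDense] at *
  obtain ⟨F, hF, hFc, hFsub⟩ := hM
  refine ⟨(fun S => run ⁻¹' S) '' F, ?_, hFc.image _, fun w hw => ?_⟩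
  · rintro _ ⟨S, hS, rfl⟩
    exact hnd S (hF S hS)
  · obtain ⟨S, hS, hw'⟩ := hFsub hw
    exact ⟨_, ⟨S, hS, rfl⟩, hw'⟩

/-- If a run with thick delays violates the safety property, then so do all the runs in the cylinder
of some set that isolates a prefix of it, and this cylinder is not meagre. -/
theorem largelySatisfies_iff (hA : A.sem.NonBlocking) (hs : A.sem.IsState s) (hP : IsSafety P) :
    A.sem.LargelySatisfies s P ↔ ThickRunsSatisfy A s P := by
  refine ⟨fun h e p hv ht => ?_, fun h => h.largelySatisfies hA hs⟩
  by_contra hn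
  obtain ⟨n, hn⟩ := (hP _).1 hn
  obtain ⟨U, hU⟩ := exists_isolates n hv ht
  let _ := A.sem.runTopology s
  refine hU.not_isMeagre hA hs (IsMeagre.mono ?_ h)
  intro ρ hρ
  refine hn _ fun j hj => ?_
  have h1 : (ρ.1 j).1.1 = _ := congrArg Prod.fst (eq_traj_of_mem_Runs ρ.2 j)
  unfold word
  rw [h1, traj_fst A.sem s _ _ p, traj_congr (fun i hi => hρ.1 i (hi.trans_le hj)) fun _ _ => rfl]
  rfl

end Large

/-! ### Laws of Markov chains -/

section ChainLaw

variable {S : Type*} [MeasurableSpace S] {ν : Measure S} [IsProbabilityMeasure ν]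
  {κ : Kernel S S} [IsMarkovKernel κ]

instance : IsProbabilityMeasure (chainLaw ν κ) := by
  unfold chainLaw
  infer_instance

/-- The joint law of the states up to time `n` and of the state at time `n + 1`. -/
theorem map_chainLaw (n : ℕ) : (chainLaw ν κ).map (fun ω => (Preorder.frestrictLe n ω, ω (n + 1))) =
    (chainLaw ν κ).map (Preorder.frestrictLe n) ⊗ₘ
      κ.comap (fun h : (Finset.Iic n → S) => h ⟨n, Finset.mem_Iic.2 le_rfl⟩)
        (measurable_pi_apply _) :=
  (Kernel.map_frestrictLe_trajMeasure_compProd_eq_map_trajMeasure (X := fun _ => S)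
    (κ := fun n => κ.comap (fun h : (Finset.Iic n → S) => h ⟨n, Finset.mem_Iic.2 le_rfl⟩)
      (measurable_pi_apply _))).symm

omit [IsProbabilityMeasure ν] in
theorem map_chainLaw_zero : (chainLaw ν κ).map (fun ω => ω 0) = ν := by
  have h0 : (fun ω : ℕ → S => ω 0) =
      (fun h : (Finset.Iic 0 → S) => h ⟨0, Finset.mem_Iic.2 le_rfl⟩) ∘ Preorder.frestrictLe 0 := rfl
  have h1 : Measurable (fun h : (Finset.Iic 0 → S) => h ⟨0, Finset.mem_Iic.2 le_rfl⟩) :=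
    measurable_pi_apply _
  have h2 : Measurable (Preorder.frestrictLe (π := fun _ : ℕ => S) 0) := by fun_prop
  rw [h0, ← Measure.map_map h1 h2]
  unfold chainLaw Kernel.trajMeasure
  rw [Measure.map_comp _ _ h2, Kernel.traj_map_frestrictLe, Kernel.partialTraj_self,
    Measure.id_comp, Measure.map_map h1 (MeasurableEquiv.measurable _)]
  exact Measure.map_id

/-- An invariant set `G` of states that almost surely is not left, and a relation `R` between
consecutive states that almost surely holds in `G`, hold forever with probability one. -/
theorem ae_chainLaw {G : Set S} {R : S → S → Prop} (hG : MeasurableSet G)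
    (hR : MeasurableSet {p : S × S | R p.1 p.2}) (hν : ∀ᵐ x ∂ν, x ∈ G)
    (hκ : ∀ x ∈ G, ∀ᵐ y ∂κ x, y ∈ G ∧ R x y) :
    ∀ᵐ ω ∂chainLaw ν κ, ∀ n, ω n ∈ G ∧ R (ω n) (ω (n + 1)) := by
  have key : ∀ n, (∀ᵐ ω ∂chainLaw ν κ, ω n ∈ G) →
      ∀ᵐ ω ∂chainLaw ν κ, ω (n + 1) ∈ G ∧ R (ω n) (ω (n + 1)) := by
    intro n hn
    have hm : Measurable (fun ω : ℕ → S => (Preorder.frestrictLe n ω, ω (n + 1))) := by fun_prop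
    have hm' : Measurable (Preorder.frestrictLe (π := fun _ : ℕ => S) n) := by fun_prop
    have he : Measurable (fun h : (Finset.Iic n → S) => h ⟨n, Finset.mem_Iic.2 le_rfl⟩) :=
      measurable_pi_apply _
    have hM : MeasurableSet {p : (Finset.Iic n → S) × S |
        p.2 ∈ G ∧ R (p.1 ⟨n, Finset.mem_Iic.2 le_rfl⟩) p.2} :=
      (measurable_snd hG).inter
        (((he.comp measurable_fst).prodMk measurable_snd) hR)
    have h1 : ∀ᵐ p ∂(chainLaw ν κ).map (fun ω => (Preorder.frestrictLe n ω, ω (n + 1))),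
        p.2 ∈ G ∧ R (p.1 ⟨n, Finset.mem_Iic.2 le_rfl⟩) p.2 := by
      rw [map_chainLaw]
      refine Measure.ae_compProd_of_ae_ae hM ?_
      have h2 : ∀ᵐ x ∂(chainLaw ν κ).map (Preorder.frestrictLe n),
          x ⟨n, Finset.mem_Iic.2 le_rfl⟩ ∈ G := by
        rwa [ae_map_iff hm'.aemeasurable (he hG)]
      filter_upwards [h2] with x hx
      exact hκ _ hx
    exact (ae_map_iff hm.aemeasurable hM).1 h1
  have hG' : ∀ n, ∀ᵐ ω ∂chainLaw ν κ, ω n ∈ G := by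
    intro n
    induction n with
    | zero =>
      rw [← map_chainLaw_zero (ν := ν) (κ := κ)] at hν
      have h0 : Measurable fun ω : ℕ → S => ω 0 := measurable_pi_apply 0
      exact (ae_map_iff (p := fun x => x ∈ G) h0.aemeasurable (by simpa using hG)).1 hν
    | succ n ih => exact (key n ih).mono fun _ h => h.1
  refine ae_all_iff.2 fun n => ?_
  filter_upwards [hG' n, key n (hG' n)] with ω h1 h2
  exact ⟨h1, h2.2⟩

/-- If each set `B i` is entered with positive probability from each point of the preceding set,
then with positive probability the chain runs through the first `n` of these sets. -/
theorem chainLaw_cylinder_ne_zero {B : ℕ → Set S} (hB : ∀ i, MeasurableSet (B i))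
    (h0 : ν (B 0) ≠ 0) (h : ∀ i, ∀ x ∈ B i, κ x (B (i + 1)) ≠ 0) (n : ℕ) :
    chainLaw ν κ {ω | ∀ i ≤ n, ω i ∈ B i} ≠ 0 := by
  induction n with
  | zero =>
    rw [← map_chainLaw_zero (ν := ν) (κ := κ),
      Measure.map_apply (measurable_pi_apply 0) (hB 0)] at h0
    convert h0 using 2
    ext ω
    simp
  | succ n ih =>
    intro hz
    apply ih
    have hm : Measurable (fun ω : ℕ → S => (Preorder.frestrictLe n ω, ω (n + 1))) := by fun_prop
    have hm' : Measurable (Preorder.frestrictLe (π := fun _ : ℕ => S) n) := by fun_prop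
    let C : Set (Finset.Iic n → S) := {x | ∀ i, x i ∈ B i.1}
    have hC : MeasurableSet C := by
      simp only [C, ofPred_forall]
      exact MeasurableSet.iInter fun i => measurable_pi_apply i (hB i.1)
    have h1 : {ω : ℕ → S | ∀ i ≤ n, ω i ∈ B i} = Preorder.frestrictLe n ⁻¹' C := by
      ext ω
      simp [C]
    have h2 : {ω : ℕ → S | ∀ i ≤ n + 1, ω i ∈ B i} =
        (fun ω : ℕ → S => (Preorder.frestrictLe n ω, ω (n + 1))) ⁻¹' (C ×ˢ B (n + 1)) := by
      ext ω
      constructor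
      · intro h
        exact ⟨fun i => h i ((Finset.mem_Iic.1 i.2).trans n.le_succ), h _ le_rfl⟩
      · rintro ⟨h3, h4⟩ i hi
        rcases hi.lt_or_eq with hi | rfl
        · exact h3 ⟨i, Finset.mem_Iic.2 (Nat.lt_succ_iff.1 hi)⟩
        · exact h4
    rw [h2, ← Measure.map_apply hm (hC.prod (hB _)), map_chainLaw,
      Measure.compProd_apply_prod hC (hB _), setLIntegral_eq_zero_iff hC
        (Kernel.measurable_coe _ (hB _))] at hz
    rw [h1, ← Measure.map_apply hm' hC]
    refine measure_mono_null (fun x hx => ?_) hz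
    simp only [mem_compl_iff, mem_ofPred_eq, Classical.not_imp]
    exact ⟨hx, h n _ (hx ⟨n, Finset.mem_Iic.2 le_rfl⟩)⟩

end ChainLaw

/-- The set `S` need not be measurable; `μ S` is its outer measure. -/
theorem inter_nonempty_of_measure_eq_one {Ω : Type*} [MeasurableSpace Ω] {μ : Measure Ω}
    [IsProbabilityMeasure μ] {B S : Set Ω} (hB : MeasurableSet B) (hB0 : μ B ≠ 0) (hS : μ S = 1) :
    (B ∩ S).Nonempty := by
  by_contra h
  rw [not_nonempty_iff_eq_empty] at h
  have h1 : S ⊆ Bᶜ := fun x hx hxB => by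
    have : x ∈ B ∩ S := ⟨hxB, hx⟩
    simp [h] at this
  have h2 : (1 : ℝ≥0∞) ≤ μ Bᶜ := hS ▸ measure_mono h1
  exact hB0 ((prob_compl_eq_one_iff hB).1 (le_antisymm prob_le_one h2))

theorem measure_eq_one_of_ae {Ω : Type*} [MeasurableSpace Ω] {μ : Measure Ω}
    [IsProbabilityMeasure μ] {S : Set Ω} (h : ∀ᵐ ω ∂μ, ω ∈ S) : μ S = 1 := by
  rw [measure_congr (eventuallyEq_univ.2 (show S ∈ ae μ from h)), measure_univ]

/-! ### Measurability of region-invariant sets -/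

instance {X : Type*} {K : ℕ} : DiscreteMeasurableSpace (Region X K) := ⟨fun _ => trivial⟩

theorem measurable_regionOf {X : Type*} [Finite X] {K : ℕ} :
    Measurable (regionOf K : Val X → Region X K) := by
  refine measurable_to_countable' fun r => ?_
  obtain ⟨v, rfl⟩ := exists_regionOf_eq r
  convert measurableSet_regionEquiv (K := K) v using 1
  ext w
  exact regionOf_eq_iff.trans ⟨RegionEquiv.symm, RegionEquiv.symm⟩

section Code

variable {L X E AP : Type*} [Fintype L] [MeasurableSpace L] [DiscreteMeasurableSpace L] [Finite X]
  [Fintype E] [MeasurableSpace E] [DiscreteMeasurableSpace E] {A : TimedAutomaton L X E AP}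

/-- A set of configurations with a delay and an edge is measurable if membership depends only on the
location, the edge, and the regions before and after the delay: these range over a finite set. -/
theorem measurableSet_of_regionEquiv {G : Set (Config L X × (ℝ≥0 × E))}
    (h : ∀ l e v v' t t', RegionEquiv A.maxConst v v' →
      RegionEquiv A.maxConst (delay v t) (delay v' t') →
      ((l, v), (t, e)) ∈ G → ((l, v'), (t', e)) ∈ G) : MeasurableSet G := by
  let code : Config L X × (ℝ≥0 × E) → (L × E) × (Region X A.maxConst × Region X A.maxConst) :=
    fun z => ((z.1.1, z.2.2), (regionOf _ z.1.2, regionOf _ (delay z.1.2 z.2.1)))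
  have hd : Measurable fun z : Config L X × (ℝ≥0 × E) => delay z.1.2 z.2.1 :=
    measurable_snd.comp (measurable_delay.comp
      (measurable_fst.prodMk (measurable_fst.comp measurable_snd)))
  have hcode : Measurable code :=
    ((measurable_fst.comp measurable_fst).prodMk (measurable_snd.comp measurable_snd)).prodMk
      ((measurable_regionOf.comp (measurable_snd.comp measurable_fst)).prodMk
        (measurable_regionOf.comp hd))
  have : G = code ⁻¹' (code '' G) := by
    refine (subset_preimage_image _ _).antisymm ?_
    rintro ⟨⟨l, v⟩, t, e⟩ ⟨⟨⟨l', v'⟩, t', e'⟩, hG, hc⟩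
    simp only [code, Prod.mk.injEq] at hc
    obtain ⟨⟨rfl, rfl⟩, h1, h2⟩ := hc
    exact h _ _ _ _ _ _ (regionOf_eq_iff.1 h1) (regionOf_eq_iff.1 h2) hG
  rw [this]
  exact hcode (toFinite _).measurableSet

variable (A) in
theorem measurableSet_mem_delaysOf :
    MeasurableSet {z : Config L X × (ℝ≥0 × E) | z.2.1 ∈ A.sem.delaysOf z.1 z.2.2} :=
  measurableSet_of_regionEquiv (A := A)
    fun _ _ _ _ _ _ h h' ht => A.mem_delaysOf_of_regionEquiv h h' ht

variable (A) in
/-- The configurations with a delay and an edge that can be taken, where the delay is thick. -/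
def thickSteps : Set (Config L X × (ℝ≥0 × E)) :=
  {z | z.2.1 ∈ A.sem.delaysOf z.1 z.2.2 ∧ A.ThickDelay z.1 z.2.1}

theorem measurableSet_thickSteps : MeasurableSet (thickSteps A) :=
  measurableSet_of_regionEquiv (A := A) fun _ _ _ _ _ _ h h' ht =>
    ⟨A.mem_delaysOf_of_regionEquiv h h' ht.1, (A.thickDelay_iff_of_regionEquiv h h').1 ht.2⟩

/-- The steps that follow the edge `f` of the region automaton. -/
def followSet (f : RegionEdge A) : Set (Config L X × (ℝ≥0 × E)) :=
  {z | A.regionLoc z.1 = f.src ∧ regionOf A.maxConst (delay z.1.2 z.2.1) = f.mid ∧ z.2.2 = f.edge}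

theorem measurableSet_followSet (f : RegionEdge A) : MeasurableSet (followSet f) := by
  refine measurableSet_of_regionEquiv (A := A) fun l e v v' t t' h h' ht => ?_
  simpa only [followSet, TimedAutomaton.regionLoc, mem_ofPred_eq, ← regionOf_eq_iff.2 h,
    ← regionOf_eq_iff.2 h'] using ht

theorem measurableSet_delays (c : Config L X) : MeasurableSet (A.sem.delays c) := by
  refine MeasurableSet.iUnion fun e => ?_
  have : Measurable fun t : ℝ≥0 => (c, (t, e)) := by fun_prop
  exact this (measurableSet_mem_delaysOf A)

end Code

/-! ### Lebesgue measure on delays -/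

theorem lebesgue_apply (B : Set ℝ≥0) :
    lebesgue B = volume ((fun t : ℝ≥0 => (t : ℝ)) '' B) :=
  (MeasurableEmbedding.subtype_coe measurableSet_Ici).comap_apply _ _

theorem lebesgue_countable {B : Set ℝ≥0} (h : B.Countable) : lebesgue B = 0 := by
  rw [lebesgue_apply]
  exact (h.image _).measure_zero _

theorem lebesgue_pos_of_mem_nhds {B : Set ℝ≥0} {t : ℝ≥0} (h : B ∈ 𝓝 t) : 0 < lebesgue B := by
  obtain ⟨a, b, hab, hB⟩ := exists_Ioo_subset_of_mem_nhds h
  rw [lebesgue_apply]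
  have h1 : (0 : ℝ≥0∞) < volume (Ioo (a : ℝ) b) := by
    rw [Real.volume_Ioo]
    exact ENNReal.ofReal_pos.2 (sub_pos.2 (by exact_mod_cast hab))
  refine h1.trans_le (measure_mono fun y hy => ?_)
  exact ⟨⟨y, a.2.trans hy.1.le⟩, hB ⟨hy.1, hy.2⟩, rfl⟩

/-! ### One step of the stochastic process -/

namespace StochasticTimedAutomaton

variable {L X E AP : Type*} [Fintype L] [MeasurableSpace L] [DiscreteMeasurableSpace L] [Finite X]
  [Fintype E] [Nonempty E] [MeasurableSpace E] [DiscreteMeasurableSpace E]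
  {A : StochasticTimedAutomaton L X E AP} {c : Config L X} {e : E}

omit [Fintype L] [Finite X] [DiscreteMeasurableSpace E] in
theorem edgeKernel_apply (h : ∃ e, A.Enabled c e) :
    A.edgeKernel c = ∑ e, A.edgeProb c e • Measure.dirac e := by
  classical
  exact if_pos h

omit [Fintype L] [Finite X] in
theorem ae_enabled (h : ∃ e, A.Enabled c e) : ∀ᵐ e ∂A.edgeKernel c, A.Enabled c e := by
  rw [ae_iff, edgeKernel_apply h]
  simp only [Measure.coe_finsetSum, Measure.smul_apply, Finset.sum_apply, smul_eq_mul]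
  refine Finset.sum_eq_zero fun e _ => ?_
  by_cases he : A.Enabled c e
  · rw [Measure.dirac_apply' _ MeasurableSet.of_discrete]
    simp [he]
  · simp [edgeProb, he]

omit [Fintype L] [Finite X] [DiscreteMeasurableSpace E] in
theorem edgeKernel_singleton_ne_zero (h : A.Enabled c e) : A.edgeKernel c {e} ≠ 0 := by
  rw [edgeKernel_apply ⟨e, h⟩]
  simp only [Measure.coe_finsetSum, Measure.smul_apply, Finset.sum_apply, smul_eq_mul]
  intro h0
  have h1 := (Finset.sum_eq_zero_iff.1 h0) e (Finset.mem_univ e)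
  rw [Measure.dirac_apply_of_mem (mem_singleton e), mul_one, edgeProb, if_pos h] at h1
  refine ENNReal.div_ne_zero.2 ⟨by exact_mod_cast (A.weight_pos e).ne', ?_⟩ h1
  refine ENNReal.sum_ne_top.2 fun e _ => ?_
  split_ifs <;> simp

omit [Fintype L] [MeasurableSpace L] [DiscreteMeasurableSpace L] [Finite X] [Fintype E]
  [Nonempty E] [MeasurableSpace E] [DiscreteMeasurableSpace E] in
theorem _root_.STA.TimedAutomaton.enabled_iff {A : TimedAutomaton L X E AP} {t : ℝ≥0} :
    A.Enabled (c.1, delay c.2 t) e ∧ c.2 ∈ guardSet (A.inv c.1) ↔ t ∈ A.sem.delaysOf c e := by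
  have h : A.Enabled (c.1, delay c.2 t) e ↔ 0 ∈ A.sem.delaysOf (c.1, delay c.2 t) e := Iff.rfl
  rw [h, TimedAutomaton.mem_delaysOf_iff, TimedAutomaton.mem_delaysOf_iff, delay_zero]
  tauto

omit [Nonempty E] in
/-- Almost every delay is thick: when some delay avoids the integers, the law of the delay has a
density, and the delays that do not avoid the integers are countably many. -/
theorem ae_thickDelay (hc : A.sem.IsState c) :
    ∀ᵐ t ∂A.μ c, t ∈ A.sem.delays c ∧ A.ThickDelay c t := by
  have h1 : ∀ᵐ t ∂A.μ c, t ∈ A.sem.delays c :=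
    (prob_compl_eq_zero_iff (measurableSet_delays c)).2 (A.h1 c hc)
  refine h1.and ?_
  by_cases h : A.HasOpenDelay c
  · obtain ⟨t, ht, hn⟩ := h
    obtain ⟨e, he⟩ := mem_iUnion.1 ht
    have hpos : 0 < lebesgue (A.sem.delays c) :=
      lebesgue_pos_of_mem_nhds (mem_of_superset (TimedAutomaton.delaysOf_mem_nhds he hn)
        fun t' ht' => mem_iUnion.2 ⟨e, ht'.1⟩)
    have hco := countable_not_noInt A.maxConst c.2
    have h2 : A.μ c {t | ¬ NoInt A.maxConst (delay c.2 t)} = 0 :=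
      (A.h2_pos c hc hpos _ hco.measurableSet).2
        (le_antisymm ((Measure.restrict_apply_le _ _).trans (lebesgue_countable hco).le) zero_le)
    have h3 : ∀ᵐ t ∂A.μ c, NoInt A.maxConst (delay c.2 t) := h2
    exact h3.mono fun t ht => Or.inl ht
  · exact Eventually.of_forall fun t => Or.inr h

theorem ae_stepKernel (hc : A.sem.IsState c) :
    ∀ᵐ p ∂A.stepKernel c, (c, p) ∈ thickSteps A.toTimedAutomaton := by
  have hm : Measurable fun p : ℝ≥0 × E => (c, p) := measurable_prodMk_left
  refine Kernel.ae_compProd_of_ae_ae (hm measurableSet_thickSteps) ?_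
  filter_upwards [ae_thickDelay hc] with t ht
  rw [Kernel.comap_apply]
  obtain ⟨e, he⟩ := mem_iUnion.1 ht.1
  filter_upwards [ae_enabled (A := A) ⟨e, (TimedAutomaton.enabled_iff.2 he).1⟩] with e' he'
  exact ⟨TimedAutomaton.enabled_iff.1 ⟨he', hc⟩, ht.2⟩

omit [DiscreteMeasurableSpace L] [Nonempty E] [MeasurableSpace E] [DiscreteMeasurableSpace E] in
/-- The delays into the region that is reached by a thick delay have positive probability: they
contain an interval, or else only finitely many delays are possible, each of positive
probability. -/
theorem μ_ne_zero {t : ℝ≥0} (ht : t ∈ A.sem.delaysOf c e) (hthick : A.ThickDelay c t) :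
    A.μ c {t' | RegionEquiv A.maxConst (delay c.2 t) (delay c.2 t')} ≠ 0 := by
  have hc : A.sem.IsState c := (TimedAutomaton.enabled_iff.2 ht).2
  have hM : MeasurableSet {t' | RegionEquiv A.maxConst (delay c.2 t) (delay c.2 t')} := by
    have h : Measurable fun t' : ℝ≥0 => delay c.2 t' := (continuous_delay.comp
      (Continuous.prodMk continuous_const continuous_id)).measurable
    exact h (measurableSet_regionEquiv _)
  rcases hthick with h | h
  · have h1 := TimedAutomaton.delaysOf_mem_nhds ht h
    have hpos : 0 < lebesgue (A.sem.delays c) :=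
      lebesgue_pos_of_mem_nhds (mem_of_superset h1 fun t' ht' => mem_iUnion.2 ⟨e, ht'.1⟩)
    intro h0
    rw [A.h2_pos c hc hpos _ hM, Measure.restrict_apply hM] at h0
    refine (lebesgue_pos_of_mem_nhds (mem_of_superset h1 ?_)).ne' h0
    exact fun t' ht' => ⟨ht'.2, mem_iUnion.2 ⟨e, ht'.1⟩⟩
  · have hco : (A.sem.delays c).Countable :=
      (countable_not_noInt A.maxConst c.2).mono fun t ht hn => h ⟨t, ht, hn⟩
    have hE := A.h2_zero c hc (lebesgue_countable hco)
    -- `uniformOn` of an infinite set is the zero measure, so `h2_zero` forces finiteness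
    have hfin : (A.sem.delays c).Finite := by
      by_contra hinf
      have h0 := uniformOn_eq_zero.2 (Or.inl hinf)
      have := (hE univ MeasurableSet.univ).2 (by simp [h0])
      simp at this
    rw [Ne, hE _ hM, uniformOn_eq_zero_iff hfin]
    exact Nonempty.ne_empty ⟨t, mem_iUnion.2 ⟨e, ht⟩, RegionEquiv.refl _⟩

omit [DiscreteMeasurableSpace E] in
theorem stepKernel_ne_zero {f : RegionEdge A.toTimedAutomaton} (hf : ¬ ThinEdge f)
    (hc : A.regionLoc c = f.src) :
    A.stepKernel c {p | (c, p) ∈ followSet f} ≠ 0 := by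
  have hv : regionOf A.maxConst c.2 = f.src.2 := congrArg Prod.snd hc
  obtain ⟨l, v⟩ := c
  obtain rfl : l = f.src.1 := congrArg Prod.fst hc
  obtain ⟨w, -, t', h1, -, h3, -⟩ := f.exists_step
  obtain ⟨t, ht⟩ := (regionOf_eq_iff.1 (h1.trans hv.symm)).exists_delay t'
  have ht : regionOf A.maxConst (delay v t) = f.mid := by rw [← h3, regionOf_eq_iff.2 ht]
  have htd := (mem_delaysOf_of_regionEdge hv ht).1
  have hthick : A.ThickDelay (f.src.1, v) t := by
    by_contra h
    exact hf ((thinEdge_iff hv ht).2 h)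
  intro h0
  apply μ_ne_zero htd hthick
  have h2 : ∀ᵐ p ∂A.stepKernel (f.src.1, v), ((f.src.1, v), p) ∉ followSet f :=
    measure_eq_zero_iff_ae_notMem.1 h0
  rw [measure_eq_zero_iff_ae_notMem]
  filter_upwards [Kernel.ae_ae_of_ae_compProd h2] with t' ht' hE
  have hmid : regionOf A.maxConst (delay v t') = f.mid := by rw [← ht, regionOf_eq_iff.2 hE]
  have hen := TimedAutomaton.enabled_iff.2 (mem_delaysOf_of_regionEdge hv hmid).1
  apply edgeKernel_singleton_ne_zero hen.1
  rw [measure_eq_zero_iff_ae_notMem]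
  rw [Kernel.comap_apply] at ht'
  filter_upwards [ht'] with e' he' h
  exact he' ⟨hc, hmid, h⟩

omit [Fintype L] [Finite X] [DiscreteMeasurableSpace E] in
theorem outKernel_apply : A.outKernel c = (A.stepKernel c).map (Prod.mk c) := by
  rw [outKernel, Kernel.prod_apply, Kernel.id_apply, Measure.dirac_prod]

theorem ae_outKernel (hc : A.sem.IsState c) :
    ∀ᵐ z ∂A.outKernel c, z ∈ thickSteps A.toTimedAutomaton ∧ z.1 = c := by
  rw [outKernel_apply]
  have h1 : ∀ᵐ z ∂(A.stepKernel c).map (Prod.mk c), z ∈ thickSteps A.toTimedAutomaton :=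
    (ae_map_iff measurable_prodMk_left.aemeasurable measurableSet_thickSteps).2 (ae_stepKernel hc)
  refine h1.and ?_
  refine (ae_map_iff measurable_prodMk_left.aemeasurable ?_).2 (Eventually.of_forall fun _ => rfl)
  exact measurable_fst (measurableSet_singleton c)

theorem outKernel_ne_zero {f : RegionEdge A.toTimedAutomaton} (hf : ¬ ThinEdge f)
    (hc : A.regionLoc c = f.src) : A.outKernel c (followSet f) ≠ 0 := by
  rw [outKernel_apply, Measure.map_apply measurable_prodMk_left (measurableSet_followSet f)]
  exact stepKernel_ne_zero hf hc

end StochasticTimedAutomaton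

/-! ### Almost-sure satisfaction -/

namespace StochasticTimedAutomaton

variable {L X E AP : Type*} [Fintype L] [MeasurableSpace L] [DiscreteMeasurableSpace L] [Finite X]
  [Fintype E] [Nonempty E] [MeasurableSpace E] [DiscreteMeasurableSpace E]
  {A : StochasticTimedAutomaton L X E AP} {s : Config L X} {P : Set (ℕ → Set AP)}

instance : IsProbabilityMeasure (A.prob s) := by
  unfold prob
  infer_instance

theorem ae_prob (hs : A.sem.IsState s) : ∀ᵐ ω ∂A.prob s,
    ω ∈ A.sem.Runs s ∧ ∀ i, A.ThickDelay (ω i).1 (ω i).2.1 := by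
  have h1 : ∀ᵐ ω ∂A.prob s, (ω 0).1 = s := by
    have h := (ae_outKernel hs).mono fun _ h => h.2
    rw [← map_chainLaw_zero (ν := A.outKernel s)
      (κ := A.outKernel.comap A.fire (measurable_fire _))] at h
    have hm : Measurable fun ω : ℕ → Config L X × (ℝ≥0 × E) => ω 0 := measurable_pi_apply 0
    exact (ae_map_iff hm.aemeasurable (measurable_fst (measurableSet_singleton s))).1 h
  have hR : MeasurableSet {p : (Config L X × (ℝ≥0 × E)) × (Config L X × (ℝ≥0 × E)) |
      p.2.1 = A.fire p.1} :=
    measurableSet_eq_fun (measurable_fst.comp measurable_snd)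
      ((measurable_fire _).comp measurable_fst)
  have h2 : ∀ᵐ ω ∂A.prob s, ∀ n, ω n ∈ thickSteps A.toTimedAutomaton ∧
      (ω (n + 1)).1 = A.fire (ω n) := by
    refine ae_chainLaw (R := fun z z' => z'.1 = A.fire z) measurableSet_thickSteps hR
      ((ae_outKernel hs).mono fun _ h => h.1) fun z hz => ?_
    exact ae_outKernel (ClockAutomaton.isState_next hz.1)
  filter_upwards [h1, h2] with ω h1 h2
  refine ⟨⟨h1, fun i => ClockAutomaton.step_iff.2 ⟨(h2 i).1.1, (h2 i).2⟩⟩, fun i => (h2 i).1.2⟩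

/-- Almost all runs have thick delays only. Conversely, a path of the thick graph that violates the
safety property has a bad prefix, and this prefix is followed with positive probability. -/
theorem almostSurelySatisfies_iff (hs : A.sem.IsState s) (hP : IsSafety P) :
    A.AlmostSurelySatisfies s P ↔ ThickRunsSatisfy A.toTimedAutomaton s P := by
  constructor
  · intro h
    rw [← thickGraphPath_satisfy_iff]
    intro f hf
    by_contra hw
    obtain ⟨n, hn⟩ := (hP _).1 hw
    have hm : MeasurableSet
        {ω : ℕ → Config L X × (ℝ≥0 × E) | ∀ i ≤ n, ω i ∈ followSet (f i).1} := by
      simp only [ofPred_forall]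
      exact MeasurableSet.iInter fun i => MeasurableSet.iInter fun _ =>
        measurable_pi_apply i (measurableSet_followSet _)
    have hpos : A.prob s {ω | ∀ i ≤ n, ω i ∈ followSet (f i).1} ≠ 0 := by
      refine chainLaw_cylinder_ne_zero (κ := A.outKernel.comap A.fire (measurable_fire _))
        (B := fun i => followSet (f i).1) (fun i => measurableSet_followSet _)
        (outKernel_ne_zero (f 0).2 hf.1.symm) (fun i z hz => ?_) n
      obtain ⟨⟨l, v⟩, t, e⟩ := z
      obtain ⟨hz1, hz2, rfl⟩ := hz
      obtain rfl : l = (f i).1.src.1 := congrArg Prod.fst hz1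
      refine outKernel_ne_zero (f (i + 1)).2 ?_
      rw [← hf.2 i]
      exact (mem_delaysOf_of_regionEdge (congrArg Prod.snd hz1) hz2).2
    obtain ⟨ω, hω, -, hω'⟩ := inter_nonempty_of_measure_eq_one hm hpos h
    refine hn _ (fun j hj => ?_) hω'
    change A.label (ω j).1.1 = A.label (f j).1.src.1
    rw [← (hω j hj).1]
    rfl
  · intro h
    refine measure_eq_one_of_ae ?_
    filter_upwards [ae_prob hs] with ω hω
    refine ⟨hω.1, ?_⟩
    have htr := ClockAutomaton.eq_traj_of_mem_Runs hω.1
    have := h (fun i => (ω i).2.2) (fun i => (ω i).2.1)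
      (fun n => ClockAutomaton.valid_of_mem_Runs hω.1 n)
      fun i => by
        have := hω.2 i
        rw [htr i] at this
        exact this
    convert this using 2 with i
    exact congrArg A.label (congrArg Prod.fst (htr i))

end StochasticTimedAutomaton

/-! ### The finite Markov chain -/

section MarkovChain

variable {L X E AP : Type*} [Fintype L] [Finite X] [Fintype E]
  {A : TimedAutomaton L X E AP} {s : Config L X} {P : Set (ℕ → Set AP)}

instance : DiscreteMeasurableSpace (RegionEdge A) := ⟨fun _ => trivial⟩

/-- `(ℓ, v)` is a state for some `v` in the region. -/
def IsRegionState (A : TimedAutomaton L X E AP) (q : RegionLoc A) : Prop :=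
  ∃ v, regionOf A.maxConst v = q.2 ∧ A.sem.IsState (q.1, v)

theorem IsRegionState.thickOut_nonempty (hA : A.sem.NonBlocking) {q : RegionLoc A}
    (hq : IsRegionState A q) : (thickOut A q).Nonempty := by
  obtain ⟨v, hv, hs⟩ := hq
  obtain ⟨e, t, ht, hthick⟩ := A.exists_thickDelay hA hs
  exact ⟨regionEdge ht, Prod.ext rfl hv, fun h => (thinEdge_regionEdge_iff ht).1 h hthick⟩

omit [Finite X] in
theorem isRegionState_tgt (f : RegionEdge A) : IsRegionState A f.tgt := by
  obtain ⟨v, v', t, -, h, -, hv'⟩ := f.exists_step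
  exact ⟨v', hv', h.2.2.2.2.2⟩

variable [MeasurableSpace L] [DiscreteMeasurableSpace L]

theorem mcKernel_apply (hA : A.sem.NonBlocking) {q : RegionLoc A} (hq : IsRegionState A q) :
    mcKernel A q = (uniformOn (thickOut A q)).map RegionEdge.tgt := by
  classical
  exact if_pos (hq.thickOut_nonempty hA)

theorem ae_mcKernel (hA : A.sem.NonBlocking) {q : RegionLoc A} (hq : IsRegionState A q) :
    ∀ᵐ q' ∂mcKernel A q, IsRegionState A q' ∧ ∃ f ∈ thickOut A q, f.tgt = q' := by
  rw [mcKernel_apply hA hq, ae_map_iff measurable_from_top.aemeasurable MeasurableSet.of_discrete,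
    ae_iff, uniformOn_eq_zero_iff (toFinite _), eq_empty_iff_forall_notMem]
  rintro f ⟨hf, h⟩
  exact h ⟨isRegionState_tgt f, f, hf, rfl⟩

theorem mcKernel_ne_zero (hA : A.sem.NonBlocking) {f : RegionEdge A} (hf : ¬ ThinEdge f)
    (hq : IsRegionState A f.src) : mcKernel A f.src {f.tgt} ≠ 0 := by
  rw [mcKernel_apply hA hq, Measure.map_apply measurable_from_top MeasurableSet.of_discrete, Ne,
    uniformOn_eq_zero_iff (toFinite _)]
  exact Nonempty.ne_empty ⟨f, ⟨rfl, hf⟩, rfl⟩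

/-- The trajectories of the chain are the paths of the thick graph, and each finite path has
positive probability. Since the automaton is non-blocking, the absorbing locations of the chain are never
reached. -/
theorem mcSatisfies_iff (hA : A.sem.NonBlocking) (hs : A.sem.IsState s) (hP : IsSafety P) :
    MCSatisfies A (A.regionLoc s) P ↔ ThickRunsSatisfy A s P := by
  rw [← thickGraphPath_satisfy_iff]
  have hq : IsRegionState A (A.regionLoc s) := ⟨s.2, rfl, hs⟩
  constructor
  · intro h f hf
    by_contra hw
    obtain ⟨n, hn⟩ := (hP _).1 hw
    have hm : MeasurableSet {ω : ℕ → RegionLoc A | ∀ i ≤ n, ω i ∈ ({(f i).1.src} : Set _)} := by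
      simp only [ofPred_forall]
      exact MeasurableSet.iInter fun i => MeasurableSet.iInter fun _ =>
        measurable_pi_apply i MeasurableSet.of_discrete
    have hf' : ∀ i, IsRegionState A (f i).1.src := by
      intro i
      cases i with
      | zero => rw [hf.1]; exact hq
      | succ i => rw [← hf.2 i]; exact isRegionState_tgt _
    have hpos := chainLaw_cylinder_ne_zero (ν := Measure.dirac (A.regionLoc s)) (κ := mcKernel A)
      (B := fun i => {(f i).1.src}) (fun i => MeasurableSet.of_discrete)
      (by rw [hf.1, Measure.dirac_apply_of_mem (mem_singleton _)]; exact one_ne_zero)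
      (fun i z hz => by
        rw [mem_singleton_iff.1 hz, ← hf.2 i]
        exact mcKernel_ne_zero hA (f i).2 (hf' i)) n
    obtain ⟨ω, hω, hω'⟩ := inter_nonempty_of_measure_eq_one hm hpos h
    exact hn _ (fun j hj => congrArg _ (hω j hj)) hω'
  · intro h
    refine measure_eq_one_of_ae ?_
    have h1 : ∀ᵐ ω ∂chainLaw (Measure.dirac (A.regionLoc s)) (mcKernel A),
        ω 0 = A.regionLoc s := by
      have h0 : ∀ᵐ q ∂Measure.dirac (A.regionLoc s), q = A.regionLoc s := by
        rw [ae_dirac_eq]; exact rfl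
      rw [← map_chainLaw_zero (ν := Measure.dirac (A.regionLoc s)) (κ := mcKernel A)] at h0
      have hm : Measurable fun ω : ℕ → RegionLoc A => ω 0 := measurable_pi_apply 0
      exact (ae_map_iff hm.aemeasurable MeasurableSet.of_discrete).1 h0
    have h2 := ae_chainLaw (ν := Measure.dirac (A.regionLoc s)) (κ := mcKernel A)
      (G := {q | IsRegionState A q}) (R := fun q q' => ∃ f ∈ thickOut A q, f.tgt = q')
      MeasurableSet.of_discrete MeasurableSet.of_discrete (by rw [ae_dirac_eq]; exact hq)
      fun q hq => ae_mcKernel hA hq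
    filter_upwards [h1, h2] with ω h1 h2
    choose f hf hf' using fun n => (h2 n).2
    have := h (fun i => ⟨f i, (hf i).2⟩)
      ⟨(hf 0).1.trans h1, fun i => (hf' i).trans (hf (i + 1)).1.symm⟩
    simpa only [(hf _).1] using this

end MarkovChain

end STA

theorem mainTheorem2 {L X E AP : Type*}
    [Fintype L] [MeasurableSpace L] [DiscreteMeasurableSpace L] [Finite X]
    [Fintype E] [Nonempty E] [MeasurableSpace E] [DiscreteMeasurableSpace E]
    (A : STA.StochasticTimedAutomaton L X E AP)
    (s : STA.Config L X) (hs : A.sem.IsState s)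
    (P : Set (ℕ → Set AP)) (hP : STA.IsSafety P) :
    [ A.AlmostSurelySatisfies s P,
      A.sem.LargelySatisfies s P,
      ∀ f : ℕ → STA.RegionEdge A.toTimedAutomaton,
        A.regionAutomaton.ThickInfPath (A.iota s) f →
          ∀ ρ ∈ A.regionAutomaton.infPath (A.iota s) f, A.regionAutomaton.word ρ ∈ P,
      ∀ f : ℕ → STA.ThickEdge A.toTimedAutomaton,
        STA.IsThickGraphPath (A.regionLoc s) f →
          (fun i => A.regionAutomaton.label (f i).1.src) ∈ P,
      STA.MCSatisfies A.toTimedAutomaton (A.regionLoc s) P ].TFAE := by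
  have ha := STA.StochasticTimedAutomaton.almostSurelySatisfies_iff hs hP
  have hb := STA.largelySatisfies_iff A.nonBlocking hs hP
  have hc := STA.thickInfPath_satisfy_iff (A := A.toTimedAutomaton) (s := s) (P := P)
  have hd := STA.thickGraphPath_satisfy_iff (A := A.toTimedAutomaton) (s := s) (P := P)
  have he := STA.mcSatisfies_iff A.nonBlocking hs hP
  tfae_have 1 ↔ 2 := ha.trans hb.symm
  tfae_have 2 ↔ 3 := hb.trans hc.symm
  tfae_have 3 ↔ 4 := hc.trans hd.symm
  tfae_have 4 ↔ 5 := hd.trans he.symm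
  tfae_finish
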